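/- Let $U\in C^2(\mathbb R^2)$ with $\int_{\mathbb R^2}e^{-U}<\infty$, and let $\pi=e^{-U}/\int e^{-U}$ (also denoting the measure $\pi(x)\,dx$). Let $\mathcal L_0=\Delta-\nabla U\cdot\nabla$ and assume the Lyapunov condition: there are $W\in C^2(\mathbb R^2)$ with $W\ge 1$ and $R_0>0$ such that for every increasing sequence $r_k\to\infty$ with $r_k\ge R_0$ there are $\lambda_k\to\infty$ and a nondecreasing sequence $b_k\ge 0$ with $\mathcal L_0W\le-\lambda_kW+b_k\mathbf 1_{B(0,r_k)}$ on $\mathbb R^2$ for all $k$. *Rate.* For a flow $v$, let $r(v)\in[0,\infty]$ be the infimum of $\int|\nabla\phi|^2\,d\pi\big/\int|\phi|^2\,d\pi$ over all nonzero complex $\phi\in H^1(\pi)$ with $\int\phi\,d\pi=0$ and $v\cdot\nabla\phi=i\mu\phi$ for some $\mu\in\mathbb R$ ($r(v)=\infty$ if there are none). *Construction.* For each integer $n\ge1$ let $\chi_n\in C^\infty(\mathbb R^2;[0,1])$ be any cutoff with $\chi_n=1$ on $B(0,\tfrac32n)$ and $\chi_n=0$ outside $B(0,\tfrac74n)$.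 Put $\delta_n=\tfrac12\inf_{[-2n,2n]^2}\pi$ and let $\pi_n=M_n^{-1}[(\pi-\delta_n)\chi_n+\delta_n]$ on the torus $\mathbb T^2_{2n}$ obtained from $[-2n,2n]^2$ by identifying opposite sides, with $M_n$ such that $\int_{\mathbb T^2_{2n}}\pi_n=1$. Let $\bar\pi_n(p)=\int_{-2n}^{2n}\pi_n(p,q)\,dq$, and let $Z_n(x,y)=(P_n(x),Q_n(x,y))$ be the map from the unit torus $\mathbb T^2=[-\tfrac12,\tfrac12]^2$ to $\mathbb T^2_{2n}$ determined by $$\int_0^{P_n(x)}\bar\pi_n(p)\,dp=x,\qquad \frac1{\bar\pi_n(P_n(x))}\int_0^{Q_n(x,y)}\pi_n(P_n(x),q)\,dq=y .$$ It pushes Lebesgue measure forward to $\pi_n$. For $m\ge1$ let $\Psi_m(x,y)=\sin(2\pi mx)\cos(2\pi my)$ (here $\pi=3.14\ldots$), whose zero set divides $\mathbb T^2$ into closed cells of side $1/(2m)$, and let $D(n,m)$ be the union of the images $Z_n(C)$ over those cells $C$ with $Z_n(C)\subset B(0,\tfrac32n)$. For a positive integer $\varphi(n)$ let $$v_n=\frac{M_n}{\pi}\,\nabla^\perp\bigl(\chi_n\,\Psi_{\varphi(n)}\circ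 Z_n^{-1}\bigr),\qquad \nabla^\perp=(-\partial_2,\partial_1),$$ extended by zero to $\mathbb R^2$. *Claim.* There are integers $m_0(n)$ with $D(n,m)\supset B(0,n)$ for all $n\ge1$ and $m\ge m_0(n)$. For every such $m_0$ there is a choice of integers $\varphi(n)\to\infty$ with $\varphi(n)\ge m_0(n)$ such that, for each $n\ge1$: $v_n$ is $C^1$, and more generally $C^k$ whenever $U$ is $C^{k+1}$, $0\le k\le\infty$ (so $v_n$ is smooth if $U$ is); $\nabla\cdot(\pi v_n)=0$; $v_n$ is compactly supported in $B(0,2n)$; $v_n$ coincides on $B(0,\tfrac32n)$ with the pushforward $(\tilde v_n\cdot\nabla Z_n)\circ Z_n^{-1}$ of the cellular flow $\tilde v_n=\nabla^\perp\Psi_{\varphi(n)}$; and $\int|v_n|^2\,d\pi<\infty$. Moreover, $\{v_n\}$ is asymptotically relaxation enhancing: $r(v_n)\to\infty$ as $n\to\infty$. -/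

import Mathlib

open MeasureTheory Filter Topology Metric
open scoped ContDiff ENNReal

noncomputable section

namespace RelaxFlow

/-- The Euclidean plane `ℝ²`. -/
abbrev Plane : Type := EuclideanSpace ℝ (Fin 2)

/-- The partial derivative `∂ᵢ f`. -/
def pderiv (i : Fin 2) (f : Plane → ℝ) (z : Plane) : ℝ :=
  fderiv ℝ f z (EuclideanSpace.single i 1)

/-- The divergence of a vector field on the plane. -/
def divergence (v : Plane → Plane) (z : Plane) : ℝ :=
  ∑ i : Fin 2, pderiv i (fun w => v w i) z

/-- The rotated gradient `∇^⊥ ψ = (-∂₂ψ, ∂₁ψ)`. -/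
def perpGrad (ψ : Plane → ℝ) (z : Plane) : Plane :=
  !₂[-pderiv 1 ψ z, pderiv 0 ψ z]

/-! ### The target measure and the Lyapunov condition -/

/-- The probability density `π ∝ e^{-U}`. -/
def gibbsDensity (U : Plane → ℝ) (z : Plane) : ℝ :=
  Real.exp (-U z) / ∫ w, Real.exp (-U w)

/-- The measure `π(dx)` with density `gibbsDensity U`. -/
def gibbsMeasure (U : Plane → ℝ) : Measure Plane :=
  volume.withDensity (fun z => ENNReal.ofReal (gibbsDensity U z))

/-- The generator `L₀ f = -∇U · ∇f + Δf`. -/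
def generator (U f : Plane → ℝ) (z : Plane) : ℝ :=
  -(inner ℝ (gradient U z) (gradient f z)) + Laplacian.laplacian f z

/-- The Lyapunov condition: there are a `C²` function `W ≥ 1` and a radius `R₀ > 0` such that for
every increasing sequence of radii `rₖ → ∞` with `rₖ ≥ R₀` there are `λₖ → ∞` and a nondecreasing
sequence `bₖ ≥ 0` with `L₀ W ≤ -λₖ W + bₖ 1_{B(0,rₖ)}` everywhere. -/
def LyapunovCondition (U : Plane → ℝ) : Prop :=
  ∃ W : Plane → ℝ, ContDiff ℝ 2 W ∧ (∀ z, 1 ≤ W z) ∧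
    ∃ R₀ : ℝ, 0 < R₀ ∧
      ∀ r : ℕ → ℝ, StrictMono r → Tendsto r atTop atTop → (∀ k, R₀ ≤ r k) →
        ∃ lam b : ℕ → ℝ, Tendsto lam atTop atTop ∧ Monotone b ∧ (∀ k, 0 ≤ b k) ∧
          ∀ k z, generator U W z ≤
            -lam k * W z + b k * (ball (0 : Plane) (r k)).indicator (fun _ => (1 : ℝ)) z

/-! ### Weighted Sobolev eigenfunctions and the rate `r(v)` -/

/-- `g` is the weak gradient (with respect to Lebesgue measure) of the complex function `φ`. -/
def HasWeakGradient (φ : Plane → ℂ) (g : Plane → EuclideanSpace ℂ (Fin 2)) : Prop :=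
  LocallyIntegrable φ volume ∧ LocallyIntegrable g volume ∧
    ∀ ψ : Plane → ℝ, ContDiff ℝ ∞ ψ → HasCompactSupport ψ → ∀ i : Fin 2,
      ∫ z, φ z * (pderiv i ψ z : ℂ) = -∫ z, g z i * (ψ z : ℂ)

/-- `φ`, with weak gradient `g`, is a nonzero mean-zero element of `H¹(μ)` which is an eigenfunction
of `v · ∇` with an imaginary eigenvalue: `v · ∇φ = i ν φ` for some real `ν`. -/
structure IsH1Eigenfunction (μ : Measure Plane) (v : Plane → Plane)
    (φ : Plane → ℂ) (g : Plane → EuclideanSpace ℂ (Fin 2)) : Prop where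
  memLp : MemLp φ 2 μ
  hasWeakGradient : HasWeakGradient φ g
  memLp_grad : MemLp g 2 μ
  mean_zero : ∫ z, φ z ∂μ = 0
  ne_zero : ¬ φ =ᵐ[μ] 0
  eigen : ∃ ν : ℝ, ∀ᵐ z ∂μ, ∑ i : Fin 2, (v z i : ℂ) * g z i = Complex.I * (ν : ℂ) * φ z

/-- `r(v; μ)`: the infimum of `∫ |∇φ|² dμ / ∫ |φ|² dμ` over the nonzero mean-zero `H¹(μ)`
eigenfunctions of `v · ∇`; it is `∞` when there are none. -/
def relaxationRate (μ : Measure Plane) (v : Plane → Plane) : ℝ≥0∞ :=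
  ⨅ (φ : Plane → ℂ) (g : Plane → EuclideanSpace ℂ (Fin 2)) (_ : IsH1Eigenfunction μ v φ g),
    ENNReal.ofReal ((∫ z, ‖g z‖ ^ 2 ∂μ) / ∫ z, ‖φ z‖ ^ 2 ∂μ)

/-- Finite energy: `∫ |v|² dμ < ∞`. -/
def FiniteEnergy (μ : Measure Plane) (v : Plane → Plane) : Prop :=
  Integrable (fun z => ‖v z‖ ^ 2) μ

/-- A sequence of flows `v₁, v₂, …` with finite energies is asymptotically relaxation enhancing
when `r(vₙ) → ∞`. -/
def AsymptoticallyRelaxationEnhancing (μ : Measure Plane) (v : ℕ → Plane → Plane) : Prop :=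
  (∀ n, 1 ≤ n → FiniteEnergy μ (v n)) ∧
    Tendsto (fun n => relaxationRate μ (v n)) atTop (𝓝 ⊤)

/-! ### The construction

Functions and maps on the tori `𝕋² = [-1/2,1/2]²` and `𝕋²_{2n} = [-2n,2n]²` (opposite sides
identified) are represented by their lifts to `ℝ²`. In this section `ρ` is the density `π`, and
`χ` is the cutoff `χₙ`. -/

/-- A cutoff at scale `n`: smooth, with values in `[0,1]`, equal to `1` on `B(0,3n/2)` and to `0`
outside `B(0,7n/4)`. -/
structure IsCutoff (n : ℕ) (χ : Plane → ℝ) : Prop where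
  smooth : ContDiff ℝ ∞ χ
  nonneg : ∀ z, 0 ≤ χ z
  le_one : ∀ z, χ z ≤ 1
  eq_one : ∀ z ∈ ball (0 : Plane) (3 * n / 2), χ z = 1
  eq_zero : ∀ z ∉ ball (0 : Plane) (7 * n / 4), χ z = 0

/-- The square `[-2n,2n]²`. -/
def square (n : ℕ) : Set Plane := {z | ∀ i, z i ∈ Set.Icc (-2 * n : ℝ) (2 * n)}

/-- `δₙ = ½ inf_{[-2n,2n]²} π`. -/
def floorLevel (ρ : Plane → ℝ) (n : ℕ) : ℝ := 1 / 2 * sInf (ρ '' square n)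

/-- The unnormalized density `(π - δₙ) χₙ + δₙ`. -/
def cutDensity (ρ χ : Plane → ℝ) (n : ℕ) (z : Plane) : ℝ :=
  (ρ z - floorLevel ρ n) * χ z + floorLevel ρ n

/-- The normalizing constant `Mₙ`. -/
def normConst (ρ χ : Plane → ℝ) (n : ℕ) : ℝ := ∫ z in square n, cutDensity ρ χ n z

/-- The representative of `t` modulo `4n` in `[-2n,2n)`. -/
def wrap (n : ℕ) (t : ℝ) : ℝ := t - 4 * n * (⌊(t + 2 * n) / (4 * n)⌋ : ℝ)

/-- The density `πₙ = Mₙ⁻¹ [(π - δₙ) χₙ + δₙ]` on the torus `𝕋²_{2n}`, as a `4n`-periodic function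
of the coordinates `(p, q)`. -/
def torusDensity (ρ χ : Plane → ℝ) (n : ℕ) (p q : ℝ) : ℝ :=
  (normConst ρ χ n)⁻¹ * cutDensity ρ χ n !₂[wrap n p, wrap n q]

/-- The marginal `π̄ₙ(p) = ∫_{-2n}^{2n} πₙ(p,q) dq`. -/
def marginal (ρ χ : Plane → ℝ) (n : ℕ) (p : ℝ) : ℝ :=
  ∫ q in (-2 * n : ℝ)..(2 * n), torusDensity ρ χ n p q

/-- The distribution function `∫₀ᵖ π̄ₙ` of the marginal, started at the origin. -/
def marginalCdf (ρ χ : Plane → ℝ) (n : ℕ) (p : ℝ) : ℝ :=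
  ∫ s in (0 : ℝ)..p, marginal ρ χ n s

/-- The conditional distribution function `π̄ₙ(p)⁻¹ ∫₀^q πₙ(p,s) ds`, started at the origin. -/
def conditionalCdf (ρ χ : Plane → ℝ) (n : ℕ) (p q : ℝ) : ℝ :=
  (marginal ρ χ n p)⁻¹ * ∫ s in (0 : ℝ)..q, torusDensity ρ χ n p s

/-- `Pₙ`, the inverse of the marginal distribution function, so that `Pₙ' = 1 / π̄ₙ(Pₙ)`. -/
def transportP (ρ χ : Plane → ℝ) (n : ℕ) (x : ℝ) : ℝ :=
  Function.invFun (marginalCdf ρ χ n) x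

/-- `Qₙ(x, ·)`, the inverse of the conditional distribution function at `Pₙ(x)`, so that
`∂Qₙ/∂y = π̄ₙ(Pₙ) / πₙ(Pₙ, Qₙ)`. -/
def transportQ (ρ χ : Plane → ℝ) (n : ℕ) (x y : ℝ) : ℝ :=
  Function.invFun (conditionalCdf ρ χ n (transportP ρ χ n x)) y

/-- (The lift of) the diffeomorphism `Zₙ(x,y) = (Pₙ(x), Qₙ(x,y))` from `𝕋²` to `𝕋²_{2n}`, which
fixes the origin and pushes Lebesgue measure forward to `πₙ`. -/
def transport (ρ χ : Plane → ℝ) (n : ℕ) (z : Plane) : Plane :=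
  !₂[transportP ρ χ n (z 0), transportQ ρ χ n (z 0) (z 1)]

/-- The pushforward `Z_# v = (v · ∇Z) ∘ Z⁻¹` of a vector field. -/
def pushforward (Z : Plane → Plane) (v : Plane → Plane) (z : Plane) : Plane :=
  fderiv ℝ Z (Function.invFun Z z) (v (Function.invFun Z z))

/-- The stream function `Ψ_m(x,y) = sin(2πmx) cos(2πmy)`. -/
def cellStream (m : ℕ) (z : Plane) : ℝ :=
  Real.sin (2 * Real.pi * m * z 0) * Real.cos (2 * Real.pi * m * z 1)

/-- The cellular flow `∇^⊥ Ψ_m`. -/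
def cellFlow (m : ℕ) : Plane → Plane := perpGrad (cellStream m)

/-- The closed cells of side `1/(2m)` of the cellular flow: their edges form the zero set of
`Ψ_m`, that is, the lines `x ∈ (1/(2m)) ℤ` and `y ∈ 1/(4m) + (1/(2m)) ℤ`. -/
def cell (m : ℕ) (i j : ℤ) : Set Plane :=
  {z | z 0 ∈ Set.Icc ((i : ℝ) / (2 * m)) ((i + 1) / (2 * m)) ∧
    z 1 ∈ Set.Icc ((2 * j - 1 : ℝ) / (4 * m)) ((2 * j + 1) / (4 * m))}

/-- `D(n,m)`, the union of the images `Zₙ(C)` of the cells `C` with `Zₙ(C) ⊆ B(0,3n/2)`. -/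
def cellRegion (ρ χ : Plane → ℝ) (n m : ℕ) : Set Plane :=
  ⋃ (i : ℤ) (j : ℤ) (_ : transport ρ χ n '' cell m i j ⊆ ball (0 : Plane) (3 * n / 2)),
    transport ρ χ n '' cell m i j

/-- `m₀` is a threshold function: `D(n,m) ⊇ B(0,n)` for all `n ≥ 1` and `m ≥ m₀(n)`. -/
def IsCellThreshold (ρ : Plane → ℝ) (χ : ℕ → Plane → ℝ) (m₀ : ℕ → ℕ) : Prop :=
  ∀ n, 1 ≤ n → ∀ m, m₀ n ≤ m → ball (0 : Plane) n ⊆ cellRegion ρ (χ n) n m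

/-- The transplanted stream function `Ψ'_m = Ψ_m ∘ Zₙ⁻¹`. -/
def transplantedStream (ρ χ : Plane → ℝ) (n m : ℕ) (z : Plane) : ℝ :=
  cellStream m (Function.invFun (transport ρ χ n) z)

/-- The flow `(Mₙ / π) ∇^⊥ (χₙ Ψ'_m)` on the plane. -/
def planeFlow (ρ χ : Plane → ℝ) (n m : ℕ) (z : Plane) : Plane :=
  (normConst ρ χ n / ρ z) • perpGrad (fun w => χ w * transplantedStream ρ χ n m w) z

end RelaxFlow

end

noncomputable section

namespace RelaxFlow

/-! ### Convergence in `L²` -/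

/-! Geometry of the flow. The inverse of `transport` is the explicit triangular map `cdfMap`, as
regular as the density, whose Jacobian determinant is `torusDensity` (`det_fderiv_cdfMap`). Hence
the flow, multiplied by the density, is a constant times the rotated gradient of a function as
smooth as the density, which gives regularity, support and zero divergence. Where the cutoff is 1
the determinant is the density divided by `normConst`, and this makes the flow the pushforward of
the cellular flow (`planeFlow_eq_pushforward`). Covering `ball 0 n` by images of cells is a
compactness statement (`exists_threshold`).

Rate. Split an eigenfunction into real and imaginary parts; up to sign and order they satisfy v·∇f =
a f' and v·∇f' = -a f. Two mechanisms make f almost constant on `ball 0 n` when the cells are small.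

If a = 0, then f is constant along the streamlines, so on each cell it is constant, in a weak sense,
on the boundary: its averages over the four edges agree (`StrongLimit.edges_eq`). Neighbouring cells
share an edge and the relevant cells are connected through edges (`const_on_cells`), so a single
constant t serves all cells. The Poincaré inequality on each cell then bounds f - t by the cell side
times the gradient (`exists_setIntegral_sub_sq_le`).

If a ≠ 0, then f is a multiple of v·∇f', which integrates to zero over every cell because the stream
function vanishes on its boundary. So t = 0 works (`setIntegral_sq_le_of_eigen`).

In both cases the error is at most 2L²/m² times the Dirichlet energy, where L bounds the derivative
of the transport map near the ball; m is chosen so large that this factor is at most 1/n. Since f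
has mean zero and most of the mass lies in the ball, the constant t is itself small, so the L² norm
of f on the ball is controlled (`setIntegral_sq_le_of_mean_zero`).

Finally the Lyapunov condition bounds λ∫f² by twice the energy plus b∫f² over a fixed ball
(`lyapunov_weak`). For fixed k and large n the ball term is absorbed, leaving (λ_k - 1)∫f² ≤
3∫|∇f|². As λ_k is arbitrarily large, the rate tends to infinity (`tendsto_relaxationRate`).

No trace theory is used: edge averages are written as integrals over the whole cell, identities are
proved for C¹ functions, and they pass to weakly differentiable functions by mollification
(`StrongLimit`). -/

theorem tendsto_integral_mul_of_L2 {α : Type*} [MeasurableSpace α] {μ : Measure α}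
    {u w : ℕ → α → ℝ} {f g : α → ℝ}
    (hu : ∀ k, MemLp (u k) 2 μ) (hw : ∀ k, MemLp (w k) 2 μ) (hf : MemLp f 2 μ) (hg : MemLp g 2 μ)
    (huf : Tendsto (fun k => eLpNorm (u k - f) 2 μ) atTop (𝓝 0))
    (hwg : Tendsto (fun k => eLpNorm (w k - g) 2 μ) atTop (𝓝 0)) :
    Tendsto (fun k => ∫ x, u k x * w k x ∂μ) atTop (𝓝 (∫ x, f x * g x ∂μ)) := by
  have key : ∀ (a b : α → ℝ) (ha : MemLp a 2 μ) (hb : MemLp b 2 μ),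
      inner ℝ (hb.toLp b) (ha.toLp a) = ∫ x, a x * b x ∂μ := by
    intro a b ha hb
    rw [L2.inner_def]
    refine integral_congr_ae ?_
    filter_upwards [ha.coeFn_toLp, hb.coeFn_toLp] with x h1 h2
    simp [h1, h2]
  have h1 := (Lp.tendsto_Lp_iff_tendsto_eLpNorm'' u hu f hf).2 huf
  have h2 := (Lp.tendsto_Lp_iff_tendsto_eLpNorm'' w hw g hg).2 hwg
  have := h2.inner (𝕜 := ℝ) h1
  simpa only [key] using this

theorem tendsto_integral_mul_const_of_L2 {α : Type*} [MeasurableSpace α] {μ : Measure α}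
    {u : ℕ → α → ℝ} {f w : α → ℝ}
    (hu : ∀ k, MemLp (u k) 2 μ) (hw : MemLp w 2 μ) (hf : MemLp f 2 μ)
    (huf : Tendsto (fun k => eLpNorm (u k - f) 2 μ) atTop (𝓝 0)) :
    Tendsto (fun k => ∫ x, u k x * w x ∂μ) atTop (𝓝 (∫ x, f x * w x ∂μ)) :=
  tendsto_integral_mul_of_L2 hu (fun _ => hw) hf hw huf (by simp)

theorem tendsto_integral_sq_of_L2 {α : Type*} [MeasurableSpace α] {μ : Measure α}
    {u : ℕ → α → ℝ} {f : α → ℝ} (hu : ∀ k, MemLp (u k) 2 μ) (hf : MemLp f 2 μ)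
    (huf : Tendsto (fun k => eLpNorm (u k - f) 2 μ) atTop (𝓝 0)) :
    Tendsto (fun k => ∫ x, u k x ^ 2 ∂μ) atTop (𝓝 (∫ x, f x ^ 2 ∂μ)) := by
  simpa only [pow_two] using tendsto_integral_mul_of_L2 hu hu hf hf huf huf

/-! ### Partial derivatives on `ℝ × ℝ` and Green's formula on rectangles -/

/-- The derivative of `u` with respect to the first coordinate. -/
def dX (u : ℝ × ℝ → ℝ) (z : ℝ × ℝ) : ℝ := fderiv ℝ u z (1, 0)

/-- The derivative of `u` with respect to the second coordinate. -/
def dY (u : ℝ × ℝ → ℝ) (z : ℝ × ℝ) : ℝ := fderiv ℝ u z (0, 1)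

/-- The closed square with lower left corner `(a, b)` and side `h`. -/
def box (a b h : ℝ) : Set (ℝ × ℝ) := Set.Icc a (a + h) ×ˢ Set.Icc b (b + h)

theorem isCompact_box (a b h : ℝ) : IsCompact (box a b h) := isCompact_Icc.prod isCompact_Icc

theorem measurableSet_box (a b h : ℝ) : MeasurableSet (box a b h) :=
  measurableSet_Icc.prod measurableSet_Icc

theorem continuous_dX {u : ℝ × ℝ → ℝ} (hu : ContDiff ℝ 1 u) : Continuous (dX u) :=
  (hu.continuous_fderiv one_ne_zero).clm_apply continuous_const

theorem continuous_dY {u : ℝ × ℝ → ℝ} (hu : ContDiff ℝ 1 u) : Continuous (dY u) :=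
  (hu.continuous_fderiv one_ne_zero).clm_apply continuous_const

theorem hasDerivAt_dX {u : ℝ × ℝ → ℝ} (hu : ContDiff ℝ 1 u) (x y : ℝ) :
    HasDerivAt (fun s => u (s, y)) (dX u (x, y)) x := by
  have h1 : HasFDerivAt u (fderiv ℝ u (x, y)) (x, y) :=
    (hu.differentiable one_ne_zero _).hasFDerivAt
  have h2 : HasDerivAt (fun s : ℝ => (s, y)) ((1 : ℝ), (0 : ℝ)) x :=
    (hasDerivAt_id x).prodMk (hasDerivAt_const x y)
  exact h1.comp_hasDerivAt x h2

theorem hasDerivAt_dY {u : ℝ × ℝ → ℝ} (hu : ContDiff ℝ 1 u) (x y : ℝ) :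
    HasDerivAt (fun s => u (x, s)) (dY u (x, y)) y := by
  have h1 : HasFDerivAt u (fderiv ℝ u (x, y)) (x, y) :=
    (hu.differentiable one_ne_zero _).hasFDerivAt
  have h2 : HasDerivAt (fun s : ℝ => (x, s)) ((0 : ℝ), (1 : ℝ)) y :=
    (hasDerivAt_const y x).prodMk (hasDerivAt_id y)
  exact h1.comp_hasDerivAt y h2

theorem contDiff_dX {u : ℝ × ℝ → ℝ} (hu : ContDiff ℝ 2 u) : ContDiff ℝ 1 (dX u) :=
  (hu.fderiv_right (m := 1) (by norm_num)).clm_apply contDiff_const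

theorem contDiff_dY {u : ℝ × ℝ → ℝ} (hu : ContDiff ℝ 2 u) : ContDiff ℝ 1 (dY u) :=
  (hu.fderiv_right (m := 1) (by norm_num)).clm_apply contDiff_const

theorem dX_dY_comm {u : ℝ × ℝ → ℝ} (hu : ContDiff ℝ 2 u) (z : ℝ × ℝ) :
    dX (dY u) z = dY (dX u) z := by
  have hd : DifferentiableAt ℝ (fderiv ℝ u) z :=
    (hu.fderiv_right (m := 1) (by norm_num)).differentiable one_ne_zero z
  have hs := (hu.contDiffAt (x := z)).isSymmSndFDerivAt (by simp)
  have e1 : ∀ v w : ℝ × ℝ, fderiv ℝ (fun z => fderiv ℝ u z v) z w = fderiv ℝ (fderiv ℝ u) z w v := by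
    intro v w
    rw [fderiv_clm_apply hd (by fun_prop)]
    simp
  have := hs (1, 0) (0, 1)
  rw [← e1, ← e1] at this
  exact this

theorem dX_mul {u w : ℝ × ℝ → ℝ} (hu : ContDiff ℝ 1 u) (hw : ContDiff ℝ 1 w) (z : ℝ × ℝ) :
    dX (fun z => u z * w z) z = u z * dX w z + w z * dX u z := by
  unfold dX
  rw [fderiv_fun_mul (hu.differentiable one_ne_zero z) (hw.differentiable one_ne_zero z)]
  simp

theorem dY_mul {u w : ℝ × ℝ → ℝ} (hu : ContDiff ℝ 1 u) (hw : ContDiff ℝ 1 w) (z : ℝ × ℝ) :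
    dY (fun z => u z * w z) z = u z * dY w z + w z * dY u z := by
  unfold dY
  rw [fderiv_fun_mul (hu.differentiable one_ne_zero z) (hw.differentiable one_ne_zero z)]
  simp

theorem integrableOn_box {u : ℝ × ℝ → ℝ} (hu : Continuous u) (a b h : ℝ) :
    IntegrableOn u (box a b h) :=
  hu.continuousOn.integrableOn_compact (isCompact_box a b h)

theorem setIntegral_box {u : ℝ × ℝ → ℝ} (hu : Continuous u) {h : ℝ} (hh : 0 ≤ h) (a b : ℝ) :
    ∫ z in box a b h, u z = ∫ x in a..(a + h), ∫ y in b..(b + h), u (x, y) := by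
  have : (volume : Measure (ℝ × ℝ)) = (volume : Measure ℝ).prod volume := rfl
  rw [box, this, setIntegral_prod _ (this ▸ integrableOn_box hu a b h)]
  rw [intervalIntegral.integral_of_le (by linarith), integral_Icc_eq_integral_Ioc]
  refine integral_congr_ae (ae_of_all _ fun x => ?_)
  simp only
  rw [intervalIntegral.integral_of_le (by linarith), integral_Icc_eq_integral_Ioc]

theorem setIntegral_box_symm {u : ℝ × ℝ → ℝ} (hu : Continuous u) {h : ℝ} (hh : 0 ≤ h) (a b : ℝ) :
    ∫ z in box a b h, u z = ∫ y in b..(b + h), ∫ x in a..(a + h), u (x, y) := by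
  have : (volume : Measure (ℝ × ℝ)) = (volume : Measure ℝ).prod volume := rfl
  have hi := integrableOn_box hu a b h
  rw [box, IntegrableOn, this, ← Measure.prod_restrict] at hi
  rw [box, this, ← Measure.prod_restrict, integral_prod_symm _ hi]
  rw [intervalIntegral.integral_of_le (by linarith), integral_Icc_eq_integral_Ioc]
  refine integral_congr_ae (ae_of_all _ fun x => ?_)
  simp only
  rw [intervalIntegral.integral_of_le (by linarith), integral_Icc_eq_integral_Ioc]

/-- The integrand is the divergence of u·(-∂₂θ, ∂₁θ), the second derivatives of θ cancelling by
symmetry. Its flux through an edge involves only the tangential derivative of θ there, which is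
zero. Differentiability is demanded of θ rather than u because u will be an approximating sequence
that is only C¹. -/
theorem green_box {u θ : ℝ × ℝ → ℝ} (hu : ContDiff ℝ 1 u) (hθ : ContDiff ℝ 2 θ)
    {a b h : ℝ} (hh : 0 ≤ h) (hl : ∀ y, θ (a, y) = 0) (hr : ∀ y, θ (a + h, y) = 0)
    (hb : ∀ x, θ (x, b) = 0) (ht : ∀ x, θ (x, b + h) = 0) :
    ∫ z in box a b h, (dY u z * dX θ z - dX u z * dY θ z) = 0 := by
  have hθ1 : ContDiff ℝ 1 θ := hθ.of_le (by norm_num)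
  have hx := contDiff_dX hθ
  have hy := contDiff_dY hθ
  have e1 : ∀ y, dY θ (a, y) = 0 := fun y => by
    have := hasDerivAt_dY hθ1 a y
    simp only [hl] at this
    exact this.unique (hasDerivAt_const y 0)
  have e2 : ∀ y, dY θ (a + h, y) = 0 := fun y => by
    have := hasDerivAt_dY hθ1 (a + h) y
    simp only [hr] at this
    exact this.unique (hasDerivAt_const y 0)
  have e3 : ∀ x, dX θ (x, b) = 0 := fun x => by
    have := hasDerivAt_dX hθ1 x b
    simp only [hb] at this
    exact this.unique (hasDerivAt_const x 0)
  have e4 : ∀ x, dX θ (x, b + h) = 0 := fun x => by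
    have := hasDerivAt_dX hθ1 x (b + h)
    simp only [ht] at this
    exact this.unique (hasDerivAt_const x 0)
  set P : ℝ × ℝ → ℝ := fun z => (-u z) * dY θ z
  set Q : ℝ × ℝ → ℝ := fun z => u z * dX θ z
  have hun : ContDiff ℝ 1 (fun z => - u z) := hu.neg
  have hP : ContDiff ℝ 1 P := hun.mul hy
  have hQ : ContDiff ℝ 1 Q := hu.mul hx
  have hpt : ∀ z, fderiv ℝ P z (1, 0) + fderiv ℝ Q z (0, 1)
      = dY u z * dX θ z - dX u z * dY θ z := by
    intro z
    have h1 : fderiv ℝ P z (1, 0) = _ := dX_mul hun hy z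
    have h2 : fderiv ℝ Q z (0, 1) = _ := dY_mul hu hx z
    have h3 : dX (fun z => - u z) z = - dX u z := by
      simp [dX, fderiv_fun_neg]
    rw [h1, h2, h3, dX_dY_comm hθ]
    ring
  have hc : Continuous fun z => dY u z * dX θ z - dX u z * dY θ z :=
    ((continuous_dY hu).mul hx.continuous).sub ((continuous_dX hu).mul hy.continuous)
  have := integral2_divergence_prod_of_hasFDerivAt P Q (fderiv ℝ P) (fderiv ℝ Q) a b (a + h) (b + h)
    hP.continuous.continuousOn hQ.continuous.continuousOn
    (fun x _ => (hP.differentiable one_ne_zero x).hasFDerivAt)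
    (fun x _ => (hQ.differentiable one_ne_zero x).hasFDerivAt)
    (by
      simp only [hpt]
      exact hc.continuousOn.integrableOn_compact (isCompact_uIcc.prod isCompact_uIcc))
  simp only [hpt] at this
  rw [setIntegral_box hc hh, this]
  simp [P, Q, e1, e2, e3, e4]

/-! ### Edge averages and the Poincaré inequality on a square -/

/-- The average of `f` over the left edge of a square, written as an integral over the square;
`g` is the first partial derivative of `f`. -/
def edgeL (a b h : ℝ) (f g : ℝ × ℝ → ℝ) : ℝ :=
  (h ^ 2)⁻¹ * ∫ z in box a b h, (f z - (a + h - z.1) * g z)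

/-- The average of `f` over the right edge of a square. -/
def edgeR (a b h : ℝ) (f g : ℝ × ℝ → ℝ) : ℝ :=
  (h ^ 2)⁻¹ * ∫ z in box a b h, (f z + (z.1 - a) * g z)

/-- The average of `f` over the bottom edge of a square; `g` is the second partial derivative. -/
def edgeB (a b h : ℝ) (f g : ℝ × ℝ → ℝ) : ℝ :=
  (h ^ 2)⁻¹ * ∫ z in box a b h, (f z - (b + h - z.2) * g z)

/-- The average of `f` over the top edge of a square. -/
def edgeT (a b h : ℝ) (f g : ℝ × ℝ → ℝ) : ℝ :=
  (h ^ 2)⁻¹ * ∫ z in box a b h, (f z + (z.2 - b) * g z)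

/-- The integrand is the derivative of -(a + h - x) w(x). This is what allows a boundary value to be
written as an interior integral, continuous under L² convergence of the function and its derivative.
-/
theorem integral_left_endpoint {w w' : ℝ → ℝ} (hw : ∀ x, HasDerivAt w (w' x) x)
    (hw' : Continuous w') (a h : ℝ) :
    ∫ x in a..(a + h), (w x - (a + h - x) * w' x) = h * w a := by
  have hwc : Continuous w := continuous_iff_continuousAt.2 fun x => (hw x).continuousAt
  have := intervalIntegral.integral_eq_sub_of_hasDerivAt (a := a) (b := a + h)
    (f := fun x => -((a + h - x) * w x)) (f' := fun x => w x - (a + h - x) * w' x)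
    (fun x _ => by
      have h1 := (((hasDerivAt_id x).const_sub (a + h)).mul (hw x)).neg
      refine h1.congr_deriv ?_
      simp; ring)
    ((by fun_prop : Continuous fun x => w x - (a + h - x) * w' x).intervalIntegrable _ _)
  rw [this]; ring

theorem integral_right_endpoint {w w' : ℝ → ℝ} (hw : ∀ x, HasDerivAt w (w' x) x)
    (hw' : Continuous w') (a h : ℝ) :
    ∫ x in a..(a + h), (w x + (x - a) * w' x) = h * w (a + h) := by
  have hwc : Continuous w := continuous_iff_continuousAt.2 fun x => (hw x).continuousAt
  have := intervalIntegral.integral_eq_sub_of_hasDerivAt (a := a) (b := a + h)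
    (f := fun x => (x - a) * w x) (f' := fun x => w x + (x - a) * w' x)
    (fun x _ => by
      have h1 := (((hasDerivAt_id x).sub_const a).mul (hw x))
      refine h1.congr_deriv ?_
      simp)
    ((by fun_prop : Continuous fun x => w x + (x - a) * w' x).intervalIntegrable _ _)
  rw [this]; ring

theorem edgeL_eq {u : ℝ × ℝ → ℝ} (hu : ContDiff ℝ 1 u) {h : ℝ} (hh : 0 < h) (a b : ℝ) :
    edgeL a b h u (dX u) = h⁻¹ * ∫ y in b..(b + h), u (a, y) := by
  have hc := continuous_dX hu
  have hcu := hu.continuous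
  rw [edgeL, setIntegral_box_symm (by fun_prop) hh.le]
  simp only [integral_left_endpoint (fun x => hasDerivAt_dX hu x _)
    (hc.comp (Continuous.prodMk_left _)), intervalIntegral.integral_const_mul]
  field_simp

theorem edgeR_eq {u : ℝ × ℝ → ℝ} (hu : ContDiff ℝ 1 u) {h : ℝ} (hh : 0 < h) (a b : ℝ) :
    edgeR a b h u (dX u) = h⁻¹ * ∫ y in b..(b + h), u (a + h, y) := by
  have hc := continuous_dX hu
  have hcu := hu.continuous
  rw [edgeR, setIntegral_box_symm (by fun_prop) hh.le]
  simp only [integral_right_endpoint (fun x => hasDerivAt_dX hu x _)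
    (hc.comp (Continuous.prodMk_left _)), intervalIntegral.integral_const_mul]
  field_simp

theorem edgeB_eq {u : ℝ × ℝ → ℝ} (hu : ContDiff ℝ 1 u) {h : ℝ} (hh : 0 < h) (a b : ℝ) :
    edgeB a b h u (dY u) = h⁻¹ * ∫ x in a..(a + h), u (x, b) := by
  have hc := continuous_dY hu
  have hcu := hu.continuous
  rw [edgeB, setIntegral_box (by fun_prop) hh.le]
  simp only [integral_left_endpoint (fun y => hasDerivAt_dY hu _ y)
    (hc.comp (Continuous.prodMk_right _)), intervalIntegral.integral_const_mul]
  field_simp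

theorem edgeT_eq {u : ℝ × ℝ → ℝ} (hu : ContDiff ℝ 1 u) {h : ℝ} (hh : 0 < h) (a b : ℝ) :
    edgeT a b h u (dY u) = h⁻¹ * ∫ x in a..(a + h), u (x, b + h) := by
  have hc := continuous_dY hu
  have hcu := hu.continuous
  rw [edgeT, setIntegral_box (by fun_prop) hh.le]
  simp only [integral_right_endpoint (fun y => hasDerivAt_dY hu _ y)
    (hc.comp (Continuous.prodMk_right _)), intervalIntegral.integral_const_mul]
  field_simp

/-- Cauchy–Schwarz, obtained from the nonnegativity of the variance of w on the interval. -/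
theorem sq_intervalIntegral_le {w : ℝ → ℝ} (hw : Continuous w) {c d : ℝ} (hcd : c ≤ d) :
    (∫ x in c..d, w x) ^ 2 ≤ (d - c) * ∫ x in c..d, w x ^ 2 := by
  rcases hcd.eq_or_lt with rfl | hlt
  · simp
  set I := ∫ x in c..d, w x
  have h0 : 0 ≤ ∫ x in c..d, (w x - I / (d - c)) ^ 2 :=
    intervalIntegral.integral_nonneg hcd fun x _ => sq_nonneg _
  have h1 : ∫ x in c..d, (w x - I / (d - c)) ^ 2
      = (∫ x in c..d, w x ^ 2) - 2 * (I / (d - c)) * I + (d - c) * (I / (d - c)) ^ 2 := by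
    have : ∀ x, (w x - I / (d - c)) ^ 2
        = (w x ^ 2 - 2 * (I / (d - c)) * w x) + (I / (d - c)) ^ 2 := fun x => by ring
    simp only [this]
    rw [intervalIntegral.integral_add, intervalIntegral.integral_sub,
      intervalIntegral.integral_const_mul, intervalIntegral.integral_const]
    · simp [I]
    all_goals exact Continuous.intervalIntegrable (by fun_prop) _ _
  have h2 : 0 < d - c := by linarith
  rw [h1] at h0
  have h3 : (∫ x in c..d, w x ^ 2) - 2 * (I / (d - c)) * I + (d - c) * (I / (d - c)) ^ 2
      = (∫ x in c..d, w x ^ 2) - I ^ 2 / (d - c) := by field_simp; ring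
  rw [h3, sub_nonneg, div_le_iff₀ h2] at h0
  linarith

theorem sq_sub_le_integral_sq_deriv {w w' : ℝ → ℝ} (hw : ∀ x, HasDerivAt w (w' x) x)
    (hw' : Continuous w') {a h x₁ x₂ : ℝ} (h1 : x₁ ∈ Set.Icc a (a + h))
    (h2 : x₂ ∈ Set.Icc a (a + h)) :
    (w x₁ - w x₂) ^ 2 ≤ h * ∫ x in a..(a + h), w' x ^ 2 := by
  wlog hle : x₂ ≤ x₁ generalizing x₁ x₂
  · have := this h2 h1 (le_of_not_ge hle)
    rwa [← neg_sub, neg_sq] at this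
  have e : w x₁ - w x₂ = ∫ x in x₂..x₁, w' x :=
    (intervalIntegral.integral_eq_sub_of_hasDerivAt (fun x _ => hw x)
      (hw'.intervalIntegrable _ _)).symm
  have hn : ∀ c d : ℝ, c ≤ d → 0 ≤ ∫ x in c..d, w' x ^ 2 := fun c d hcd =>
    intervalIntegral.integral_nonneg hcd fun x _ => sq_nonneg _
  rw [e]
  calc (∫ x in x₂..x₁, w' x) ^ 2 ≤ (x₁ - x₂) * ∫ x in x₂..x₁, w' x ^ 2 :=
        sq_intervalIntegral_le hw' hle
    _ ≤ h * ∫ x in a..(a + h), w' x ^ 2 := by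
        refine mul_le_mul (by linarith [h1.2, h2.1]) ?_ (hn _ _ hle) (by linarith [h1.1, h1.2])
        exact intervalIntegral.integral_mono_interval h2.1 hle h1.2
          (ae_of_all _ fun x => sq_nonneg _)
          (Continuous.intervalIntegrable (by fun_prop) _ _)

/-- A point (x, y) is joined to (a, y') on the left edge by a vertical and then a horizontal
segment. Each increment is at most a one-dimensional energy, and averaging over y' and then over the
square gives the constant. The edge average is subtracted, not the mean, because edge averages can
be compared between neighbouring cells. -/
theorem poincare_box {u : ℝ × ℝ → ℝ} (hu : ContDiff ℝ 1 u) {h : ℝ} (hh : 0 < h) (a b : ℝ) :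
    ∫ z in box a b h, (u z - edgeL a b h u (dX u)) ^ 2 ≤
      2 * h ^ 2 * ((∫ z in box a b h, dX u z ^ 2) + ∫ z in box a b h, dY u z ^ 2) := by
  have hcx := continuous_dX hu
  have hcy := continuous_dY hu
  have hcu := hu.continuous
  have hY : Continuous fun x => ∫ t in b..(b + h), dY u (x, t) ^ 2 :=
    intervalIntegral.continuous_parametric_intervalIntegral_of_continuous' (by fun_prop) _ _
  have hX : Continuous fun y => ∫ s in a..(a + h), dX u (s, y) ^ 2 :=
    intervalIntegral.continuous_parametric_intervalIntegral_of_continuous' (by fun_prop) _ _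
  set T := edgeL a b h u (dX u)
  set IX := ∫ z in box a b h, dX u z ^ 2 with hIX
  set IY := ∫ z in box a b h, dY u z ^ 2 with hIY
  have eX : IX = ∫ y in b..(b + h), ∫ s in a..(a + h), dX u (s, y) ^ 2 :=
    setIntegral_box_symm (by fun_prop) hh.le a b
  have eY : IY = ∫ x in a..(a + h), ∫ t in b..(b + h), dY u (x, t) ^ 2 :=
    setIntegral_box (by fun_prop) hh.le a b
  have hpt : ∀ x ∈ Set.Icc a (a + h), ∀ y ∈ Set.Icc b (b + h),
      (u (x, y) - T) ^ 2 ≤ 2 * h * (∫ t in b..(b + h), dY u (x, t) ^ 2) + 2 * IX := by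
    intro x hx y hy
    have hT : u (x, y) - T = h⁻¹ * ∫ y' in b..(b + h), (u (x, y) - u (a, y')) := by
      rw [intervalIntegral.integral_sub, intervalIntegral.integral_const]
      · simp only [T, edgeL_eq hu hh, add_sub_cancel_left, smul_eq_mul]
        field_simp
      all_goals exact Continuous.intervalIntegrable (by fun_prop) _ _
    have h1 : (∫ y' in b..(b + h), (u (x, y) - u (a, y'))) ^ 2 ≤
        h * ∫ y' in b..(b + h), (u (x, y) - u (a, y')) ^ 2 := by
      simpa using sq_intervalIntegral_le (w := fun y' => u (x, y) - u (a, y')) (by fun_prop)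
        (show b ≤ b + h by linarith)
    have h2 : ∫ y' in b..(b + h), (u (x, y) - u (a, y')) ^ 2 ≤
        ∫ y' in b..(b + h), (2 * h * (∫ t in b..(b + h), dY u (x, t) ^ 2)
          + 2 * h * ∫ s in a..(a + h), dX u (s, y') ^ 2) := by
      refine intervalIntegral.integral_mono_on (by linarith)
        (Continuous.intervalIntegrable (by fun_prop) _ _)
        (Continuous.intervalIntegrable (by fun_prop) _ _) fun y' hy' => ?_
      have i1 := sq_sub_le_integral_sq_deriv (fun s => hasDerivAt_dY hu x s)
        (hcy.comp (Continuous.prodMk_right _)) hy hy'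
      have i2 := sq_sub_le_integral_sq_deriv (fun s => hasDerivAt_dX hu s y')
        (hcx.comp (Continuous.prodMk_left _)) hx (Set.left_mem_Icc.2 (by linarith : a ≤ a + h))
      -- This is (p + q)² ≤ 2p² + 2q² for the two increments of the path.
      nlinarith [sq_nonneg ((u (x, y) - u (x, y')) - (u (x, y') - u (a, y')))]
    rw [intervalIntegral.integral_add (Continuous.intervalIntegrable (by fun_prop) _ _)
      (Continuous.intervalIntegrable (by fun_prop) _ _), intervalIntegral.integral_const,
      intervalIntegral.integral_const_mul, ← eX] at h2
    simp only [add_sub_cancel_left, smul_eq_mul] at h2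
    rw [hT, mul_pow, inv_pow, inv_mul_le_iff₀ (by positivity)]
    nlinarith
  rw [setIntegral_box (by fun_prop) hh.le]
  have h3 : ∫ x in a..(a + h), ∫ y in b..(b + h), (u (x, y) - T) ^ 2 ≤
      ∫ x in a..(a + h), h * (2 * h * (∫ t in b..(b + h), dY u (x, t) ^ 2) + 2 * IX) := by
    refine intervalIntegral.integral_mono_on (by linarith) ?_
      (Continuous.intervalIntegrable (by fun_prop) _ _) fun x hx => ?_
    · exact Continuous.intervalIntegrable
        (intervalIntegral.continuous_parametric_intervalIntegral_of_continuous' (by fun_prop) _ _)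
        _ _
    · calc _ ≤ ∫ y in b..(b + h), (2 * h * (∫ t in b..(b + h), dY u (x, t) ^ 2) + 2 * IX) := by
            refine intervalIntegral.integral_mono_on (by linarith)
              (Continuous.intervalIntegrable (by fun_prop) _ _)
              (Continuous.intervalIntegrable (by fun_prop) _ _) fun y hy => hpt x hx y hy
        _ = _ := by rw [intervalIntegral.integral_const]; simp
  refine h3.trans_eq ?_
  rw [intervalIntegral.integral_const_mul, intervalIntegral.integral_add
    (Continuous.intervalIntegrable (by fun_prop) _ _)
    (Continuous.intervalIntegrable (by fun_prop) _ _), intervalIntegral.integral_const,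
    intervalIntegral.integral_const_mul, ← eY]
  simp
  ring

/-! ### Strong limits of `C¹` functions on squares -/

/-- On `K`, the `C¹` functions `u k` converge to `f` and their partial derivatives to `g₁` and `g₂`,
in `L²`. -/
structure StrongLimit (K : Set (ℝ × ℝ)) (u : ℕ → ℝ × ℝ → ℝ) (f g₁ g₂ : ℝ × ℝ → ℝ) : Prop where
  smooth : ∀ k, ContDiff ℝ 1 (u k)
  memLp : MemLp f 2 (volume.restrict K)
  memLp_fst : MemLp g₁ 2 (volume.restrict K)
  memLp_snd : MemLp g₂ 2 (volume.restrict K)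
  tendsto : Tendsto (fun k => eLpNorm (u k - f) 2 (volume.restrict K)) atTop (𝓝 0)
  tendsto_fst : Tendsto (fun k => eLpNorm (dX (u k) - g₁) 2 (volume.restrict K)) atTop (𝓝 0)
  tendsto_snd : Tendsto (fun k => eLpNorm (dY (u k) - g₂) 2 (volume.restrict K)) atTop (𝓝 0)

theorem tendsto_eLpNorm_restrict_mono {α : Type*} [MeasurableSpace α] {μ : Measure α}
    {K K' : Set α} (h : K' ⊆ K) {w : ℕ → α → ℝ}
    (hw : Tendsto (fun k => eLpNorm (w k) 2 (μ.restrict K)) atTop (𝓝 0)) :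
    Tendsto (fun k => eLpNorm (w k) 2 (μ.restrict K')) atTop (𝓝 0) :=
  tendsto_of_tendsto_of_tendsto_of_le_of_le tendsto_const_nhds hw (fun _ => zero_le)
    fun _ => eLpNorm_mono_measure _ (Measure.restrict_mono h le_rfl)

theorem StrongLimit.mono {K K' : Set (ℝ × ℝ)} {u : ℕ → ℝ × ℝ → ℝ} {f g₁ g₂ : ℝ × ℝ → ℝ}
    (H : StrongLimit K u f g₁ g₂) (h : K' ⊆ K) : StrongLimit K' u f g₁ g₂ where
  smooth := H.smooth
  memLp := H.memLp.mono_measure (Measure.restrict_mono h le_rfl)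
  memLp_fst := H.memLp_fst.mono_measure (Measure.restrict_mono h le_rfl)
  memLp_snd := H.memLp_snd.mono_measure (Measure.restrict_mono h le_rfl)
  tendsto := tendsto_eLpNorm_restrict_mono h H.tendsto
  tendsto_fst := tendsto_eLpNorm_restrict_mono h H.tendsto_fst
  tendsto_snd := tendsto_eLpNorm_restrict_mono h H.tendsto_snd

theorem memLp_restrict_of_isCompact {α : Type*} [TopologicalSpace α] [T2Space α]
    [MeasurableSpace α] [BorelSpace α] {μ : Measure α} [IsFiniteMeasureOnCompacts μ] {w : α → ℝ}
    (hw : Continuous w) {K : Set α} (hK : IsCompact K) (p : ℝ≥0∞) :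
    MemLp w p (μ.restrict K) := by
  obtain ⟨C, hC⟩ := hK.exists_bound_of_continuousOn hw.continuousOn
  have : IsFiniteMeasure (μ.restrict K) := ⟨by simpa using hK.measure_lt_top⟩
  refine MemLp.of_bound hw.aestronglyMeasurable C ?_
  filter_upwards [ae_restrict_mem hK.measurableSet] with x hx using hC x hx

theorem memLp_box {w : ℝ × ℝ → ℝ} (hw : Continuous w) (a b h : ℝ) (p : ℝ≥0∞) :
    MemLp w p (volume.restrict (box a b h)) :=
  memLp_restrict_of_isCompact hw (isCompact_box a b h) p

section Boxes

variable {a b h : ℝ} {u : ℕ → ℝ × ℝ → ℝ} {f g₁ g₂ : ℝ × ℝ → ℝ}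

theorem StrongLimit.tendsto_mul (H : StrongLimit (box a b h) u f g₁ g₂) {w : ℝ × ℝ → ℝ}
    (hw : Continuous w) :
    Tendsto (fun k => ∫ z in box a b h, u k z * w z) atTop (𝓝 (∫ z in box a b h, f z * w z)) :=
  tendsto_integral_mul_const_of_L2 (fun k => memLp_box (H.smooth k).continuous a b h 2)
    (memLp_box hw a b h 2) H.memLp H.tendsto

theorem StrongLimit.tendsto_fst_mul (H : StrongLimit (box a b h) u f g₁ g₂) {w : ℝ × ℝ → ℝ}
    (hw : Continuous w) :
    Tendsto (fun k => ∫ z in box a b h, dX (u k) z * w z) atTop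
      (𝓝 (∫ z in box a b h, g₁ z * w z)) :=
  tendsto_integral_mul_const_of_L2 (fun k => memLp_box (continuous_dX (H.smooth k)) a b h 2)
    (memLp_box hw a b h 2) H.memLp_fst H.tendsto_fst

theorem StrongLimit.tendsto_snd_mul (H : StrongLimit (box a b h) u f g₁ g₂) {w : ℝ × ℝ → ℝ}
    (hw : Continuous w) :
    Tendsto (fun k => ∫ z in box a b h, dY (u k) z * w z) atTop
      (𝓝 (∫ z in box a b h, g₂ z * w z)) :=
  tendsto_integral_mul_const_of_L2 (fun k => memLp_box (continuous_dY (H.smooth k)) a b h 2)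
    (memLp_box hw a b h 2) H.memLp_snd H.tendsto_snd

theorem integrable_mul_box {p w : ℝ × ℝ → ℝ} (hp : MemLp p 2 (volume.restrict (box a b h)))
    (hw : Continuous w) : IntegrableOn (fun z => p z * w z) (box a b h) :=
  hp.integrable_mul (memLp_box hw a b h 2)

theorem integral_edge_eq {p q w : ℝ × ℝ → ℝ} (hp : MemLp p 2 (volume.restrict (box a b h)))
    (hq : MemLp q 2 (volume.restrict (box a b h))) (hw : Continuous w) :
    ∫ z in box a b h, (p z + w z * q z) =
      (∫ z in box a b h, p z * 1) + ∫ z in box a b h, q z * w z := by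
  rw [← integral_add (integrable_mul_box hp continuous_const) (integrable_mul_box hq hw)]
  simp only [mul_one, mul_comm]

theorem StrongLimit.tendsto_edge_fst (H : StrongLimit (box a b h) u f g₁ g₂) {w : ℝ × ℝ → ℝ}
    (hw : Continuous w) (c : ℝ) :
    Tendsto (fun k => c * ∫ z in box a b h, (u k z + w z * dX (u k) z)) atTop
      (𝓝 (c * ∫ z in box a b h, (f z + w z * g₁ z))) := by
  refine Tendsto.const_mul c ?_
  rw [integral_edge_eq H.memLp H.memLp_fst hw]
  have : ∀ k, ∫ z in box a b h, (u k z + w z * dX (u k) z) = _ := fun k =>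
    integral_edge_eq (memLp_box (H.smooth k).continuous a b h 2)
      (memLp_box (continuous_dX (H.smooth k)) a b h 2) hw
  simp only [this]
  exact (H.tendsto_mul continuous_const).add (H.tendsto_fst_mul hw)

theorem StrongLimit.tendsto_edge_snd (H : StrongLimit (box a b h) u f g₁ g₂) {w : ℝ × ℝ → ℝ}
    (hw : Continuous w) (c : ℝ) :
    Tendsto (fun k => c * ∫ z in box a b h, (u k z + w z * dY (u k) z)) atTop
      (𝓝 (c * ∫ z in box a b h, (f z + w z * g₂ z))) := by
  refine Tendsto.const_mul c ?_
  rw [integral_edge_eq H.memLp H.memLp_snd hw]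
  have : ∀ k, ∫ z in box a b h, (u k z + w z * dY (u k) z) = _ := fun k =>
    integral_edge_eq (memLp_box (H.smooth k).continuous a b h 2)
      (memLp_box (continuous_dY (H.smooth k)) a b h 2) hw
  simp only [this]
  exact (H.tendsto_mul continuous_const).add (H.tendsto_snd_mul hw)

theorem StrongLimit.tendsto_edgeL (H : StrongLimit (box a b h) u f g₁ g₂) :
    Tendsto (fun k => edgeL a b h (u k) (dX (u k))) atTop (𝓝 (edgeL a b h f g₁)) := by
  simpa only [edgeL, neg_mul, ← sub_eq_add_neg] using
    H.tendsto_edge_fst (w := fun z => -(a + h - z.1)) (by fun_prop) (h ^ 2)⁻¹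

theorem StrongLimit.tendsto_edgeR (H : StrongLimit (box a b h) u f g₁ g₂) :
    Tendsto (fun k => edgeR a b h (u k) (dX (u k))) atTop (𝓝 (edgeR a b h f g₁)) :=
  H.tendsto_edge_fst (w := fun z => z.1 - a) (by fun_prop) (h ^ 2)⁻¹

theorem StrongLimit.tendsto_edgeB (H : StrongLimit (box a b h) u f g₁ g₂) :
    Tendsto (fun k => edgeB a b h (u k) (dY (u k))) atTop (𝓝 (edgeB a b h f g₂)) := by
  simpa only [edgeB, neg_mul, ← sub_eq_add_neg] using
    H.tendsto_edge_snd (w := fun z => -(b + h - z.2)) (by fun_prop) (h ^ 2)⁻¹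

theorem StrongLimit.tendsto_edgeT (H : StrongLimit (box a b h) u f g₁ g₂) :
    Tendsto (fun k => edgeT a b h (u k) (dY (u k))) atTop (𝓝 (edgeT a b h f g₂)) :=
  H.tendsto_edge_snd (w := fun z => z.2 - b) (by fun_prop) (h ^ 2)⁻¹

/-- For each C¹ approximation both sides are the average over the same segment. The two cell
integrals converge separately, so the limits agree although they are computed on different cells. -/
theorem StrongLimit.edgeR_eq_edgeL (hh : 0 < h) (H : StrongLimit (box a b h) u f g₁ g₂)
    (H' : StrongLimit (box (a + h) b h) u f g₁ g₂) :
    edgeR a b h f g₁ = edgeL (a + h) b h f g₁ := by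
  refine tendsto_nhds_unique H.tendsto_edgeR ?_
  have := H'.tendsto_edgeL
  simpa only [edgeL_eq (H.smooth _) hh, edgeR_eq (H.smooth _) hh] using this

theorem StrongLimit.edgeT_eq_edgeB (hh : 0 < h) (H : StrongLimit (box a b h) u f g₁ g₂)
    (H' : StrongLimit (box a (b + h) h) u f g₁ g₂) :
    edgeT a b h f g₂ = edgeB a (b + h) h f g₂ := by
  refine tendsto_nhds_unique H.tendsto_edgeT ?_
  have := H'.tendsto_edgeB
  simpa only [edgeB_eq (H.smooth _) hh, edgeT_eq (H.smooth _) hh] using this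

theorem StrongLimit.poincare (hh : 0 < h) (H : StrongLimit (box a b h) u f g₁ g₂) :
    ∫ z in box a b h, (f z - edgeL a b h f g₁) ^ 2 ≤
      2 * h ^ 2 * ((∫ z in box a b h, g₁ z ^ 2) + ∫ z in box a b h, g₂ z ^ 2) := by
  have t1 := tendsto_integral_sq_of_L2
    (fun k => memLp_box (continuous_dX (H.smooth k)) a b h 2) H.memLp_fst H.tendsto_fst
  have t2 := tendsto_integral_sq_of_L2
    (fun k => memLp_box (continuous_dY (H.smooth k)) a b h 2) H.memLp_snd H.tendsto_snd
  have t3 := tendsto_integral_sq_of_L2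
    (fun k => memLp_box (H.smooth k).continuous a b h 2) H.memLp H.tendsto
  have t4 := H.tendsto_mul (w := fun _ => 1) continuous_const
  -- The subtracted edge average changes with k, so the square is expanded into quantities whose
  -- limits are known one by one.
  have expand : ∀ (p : ℝ × ℝ → ℝ) (c : ℝ), MemLp p 2 (volume.restrict (box a b h)) →
      ∫ z in box a b h, (p z - c) ^ 2 = (∫ z in box a b h, p z ^ 2)
        - 2 * c * (∫ z in box a b h, p z * 1) + c ^ 2 * volume.real (box a b h) := by
    intro p c hp
    have e : ∀ z, (p z - c) ^ 2 = (p z ^ 2 - 2 * c * (p z * 1)) + c ^ 2 := fun z => by ring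
    have : IsFiniteMeasure (volume.restrict (box a b h)) :=
      ⟨by simpa using (isCompact_box a b h).measure_lt_top⟩
    have i1 : Integrable (fun z => 2 * c * (p z * 1)) (volume.restrict (box a b h)) :=
      (integrable_mul_box hp continuous_const).const_mul _
    simp only [e]
    have i2 : Integrable (fun z => p z ^ 2 - 2 * c * (p z * 1)) (volume.restrict (box a b h)) :=
      hp.integrable_sq.sub i1
    rw [integral_add i2 (integrable_const _), integral_sub hp.integrable_sq i1, integral_const_mul]
    simp [measureReal_def, mul_comm]
  have hl : Tendsto (fun k => ∫ z in box a b h, (u k z - edgeL a b h (u k) (dX (u k))) ^ 2) atTop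
      (𝓝 (∫ z in box a b h, (f z - edgeL a b h f g₁) ^ 2)) := by
    rw [expand f _ H.memLp]
    simp only [expand (u _) _ (memLp_box (H.smooth _).continuous a b h 2)]
    exact ((t3.sub ((H.tendsto_edgeL.const_mul 2).mul t4)).add
      ((H.tendsto_edgeL.pow 2).mul_const _))
  exact le_of_tendsto_of_tendsto' hl ((t1.add t2).const_mul _)
    fun k => poincare_box (H.smooth k) hh a b

theorem StrongLimit.green (hh : 0 < h) (H : StrongLimit (box a b h) u f g₁ g₂) {θ : ℝ × ℝ → ℝ}
    (hθ : ContDiff ℝ 2 θ) (hl : ∀ y, θ (a, y) = 0) (hr : ∀ y, θ (a + h, y) = 0)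
    (hb : ∀ x, θ (x, b) = 0) (ht : ∀ x, θ (x, b + h) = 0) :
    ∫ z in box a b h, (g₂ z * dX θ z - g₁ z * dY θ z) = 0 := by
  have cx : Continuous (dX θ) := (contDiff_dX hθ).continuous
  have cy : Continuous (dY θ) := (contDiff_dY hθ).continuous
  have t := (H.tendsto_snd_mul cx).sub (H.tendsto_fst_mul cy)
  rw [← integral_sub (integrable_mul_box H.memLp_snd cx) (integrable_mul_box H.memLp_fst cy)] at t
  refine tendsto_nhds_unique t ?_
  refine tendsto_const_nhds.congr fun k => ?_
  rw [← integral_sub (integrable_mul_box (memLp_box (continuous_dY (H.smooth k)) a b h 2) cx)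
    (integrable_mul_box (memLp_box (continuous_dX (H.smooth k)) a b h 2) cy)]
  exact (green_box (H.smooth k) hθ hh.le hl hr hb ht).symm

/-- If `f` is constant along the level curves of a stream function `Ψ` which vanishes exactly on the
boundary of the square, then `f` is constant on that boundary: this is the weak form. -/
theorem StrongLimit.green_of_stream (hh : 0 < h) (H : StrongLimit (box a b h) u f g₁ g₂)
    {Ψ κ : ℝ × ℝ → ℝ} (hΨ : ContDiff ℝ 2 Ψ) (hl : ∀ y, Ψ (a, y) = 0) (hr : ∀ y, Ψ (a + h, y) = 0)
    (hb : ∀ x, Ψ (x, b) = 0) (ht : ∀ x, Ψ (x, b + h) = 0)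
    (hne : ∀ᵐ z ∂volume.restrict (box a b h), Ψ z ≠ 0)
    (heq : ∀ᵐ z ∂volume.restrict (box a b h), g₂ z * dX Ψ z - g₁ z * dY Ψ z = 0)
    (hκ : ContDiff ℝ 2 κ) :
    ∫ z in box a b h, (g₂ z * dX κ z - g₁ z * dY κ z) = 0 := by
  have cx : Continuous (dX κ) := (contDiff_dX hκ).continuous
  have cy : Continuous (dY κ) := (contDiff_dY hκ).continuous
  -- A smooth function of Ψ that vanishes where Ψ does, takes values in [0, 1), and tends to 1
  -- wherever Ψ ≠ 0. Multiplying κ by it makes an admissible test function for Green's formula.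
  set s : ℕ → ℝ × ℝ → ℝ := fun N z => N * Ψ z ^ 2 / (1 + N * Ψ z ^ 2) with hs
  have hpos : ∀ (N : ℕ) (z : ℝ × ℝ), 0 < 1 + (N : ℝ) * Ψ z ^ 2 := fun N z => by positivity
  have hsd : ∀ N, ContDiff ℝ 2 (s N) := fun N =>
    (contDiff_const.mul (hΨ.pow 2)).div (contDiff_const.add (contDiff_const.mul (hΨ.pow 2)))
      fun z => (hpos N z).ne'
  -- Only the direction of the gradient matters: being parallel to that of Ψ, it contributes nothing
  -- by `heq`. No bound on c is needed, even though c is not bounded uniformly in N.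
  have hfd : ∀ N z, ∃ c : ℝ, fderiv ℝ (s N) z = c • fderiv ℝ Ψ z := by
    intro N z
    have h1 : HasDerivAt (fun t : ℝ => N * t ^ 2 / (1 + N * t ^ 2))
        (deriv (fun t : ℝ => N * t ^ 2 / (1 + N * t ^ 2)) (Ψ z)) (Ψ z) := by
      refine DifferentiableAt.hasDerivAt ?_
      exact DifferentiableAt.div (by fun_prop) (by fun_prop) (hpos N z).ne'
    have h2 := h1.comp_hasFDerivAt z (hΨ.differentiable two_ne_zero z).hasFDerivAt
    exact ⟨_, h2.fderiv⟩
  have hgreen : ∀ N, ∫ z in box a b h, s N z * (g₂ z * dX κ z - g₁ z * dY κ z) = 0 := by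
    intro N
    have := H.green hh (θ := fun z => κ z * s N z) (hκ.mul (hsd N))
      (by simp [hs, hl]) (by simp [hs, hr]) (by simp [hs, hb]) (by simp [hs, ht])
    rw [← this]
    refine integral_congr_ae ?_
    filter_upwards [heq] with z hz
    rw [dX_mul (hκ.of_le (by norm_num)) ((hsd N).of_le (by norm_num)),
      dY_mul (hκ.of_le (by norm_num)) ((hsd N).of_le (by norm_num))]
    obtain ⟨c, hc⟩ := hfd N z
    have e1 : dX (s N) z = c * dX Ψ z := by simp [dX, hc]
    have e2 : dY (s N) z = c * dY Ψ z := by simp [dY, hc]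
    rw [e1, e2]
    linear_combination (-(κ z * c)) * hz
  have hint : Integrable (fun z => g₂ z * dX κ z - g₁ z * dY κ z) (volume.restrict (box a b h)) :=
    (integrable_mul_box H.memLp_snd cx).sub (integrable_mul_box H.memLp_fst cy)
  have hlim := tendsto_integral_of_dominated_convergence
    (F := fun N z => s N z * (g₂ z * dX κ z - g₁ z * dY κ z))
    (f := fun z => g₂ z * dX κ z - g₁ z * dY κ z) (μ := volume.restrict (box a b h))
    (fun z => ‖g₂ z * dX κ z - g₁ z * dY κ z‖)
    (fun N => (hsd N).continuous.aestronglyMeasurable.mul hint.aestronglyMeasurable) hint.norm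
    (fun N => ae_of_all _ fun z => by
      rw [norm_mul]
      refine mul_le_of_le_one_left (norm_nonneg _) ?_
      rw [Real.norm_eq_abs, abs_of_nonneg (div_nonneg (by positivity) (hpos N z).le),
        div_le_one (hpos N z)]
      linarith)
    (by
      filter_upwards [hne] with z hz
      have h0 : 0 < Ψ z ^ 2 := by positivity
      have h1 : Tendsto (fun N : ℕ => (N : ℝ) * Ψ z ^ 2) atTop atTop :=
        tendsto_natCast_atTop_atTop.atTop_mul_const h0
      have h2 : Tendsto (fun N : ℕ => 1 - (1 + (N : ℝ) * Ψ z ^ 2)⁻¹) atTop (𝓝 (1 - 0)) :=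
        tendsto_const_nhds.sub (tendsto_inv_atTop_zero.comp (tendsto_atTop_add_const_left _ 1 h1))
      have h3 : Tendsto (fun N : ℕ => s N z) atTop (𝓝 1) := by
        rw [sub_zero] at h2
        refine h2.congr fun N => ?_
        have := (hpos N z).ne'
        simp only [hs]
        field_simp
        ring
      simpa using h3.mul_const _)
  simp only [hgreen] at hlim
  exact tendsto_nhds_unique hlim tendsto_const_nhds |>.symm ▸ rfl

theorem dX_mul_fun {p q : ℝ → ℝ} {p' q' : ℝ} {z : ℝ × ℝ} (hp : HasDerivAt p p' z.1)
    (hq : HasDerivAt q q' z.2) : dX (fun z => p z.1 * q z.2) z = p' * q z.2 := by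
  have h1 : HasFDerivAt (fun z : ℝ × ℝ => p z.1) _ z := 
    HasDerivAt.comp_hasFDerivAt z hp (hasFDerivAt_fst (𝕜 := ℝ))
  have h2 : HasFDerivAt (fun z : ℝ × ℝ => q z.2) _ z := 
    HasDerivAt.comp_hasFDerivAt z hq (hasFDerivAt_snd (𝕜 := ℝ))
  have := (h1.mul h2).fderiv
  unfold dX
  erw [this]
  simp [mul_comm]

theorem dY_mul_fun {p q : ℝ → ℝ} {p' q' : ℝ} {z : ℝ × ℝ} (hp : HasDerivAt p p' z.1)
    (hq : HasDerivAt q q' z.2) : dY (fun z => p z.1 * q z.2) z = p z.1 * q' := by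
  have h1 : HasFDerivAt (fun z : ℝ × ℝ => p z.1) _ z := 
    HasDerivAt.comp_hasFDerivAt z hp (hasFDerivAt_fst (𝕜 := ℝ))
  have h2 : HasFDerivAt (fun z : ℝ × ℝ => q z.2) _ z := 
    HasDerivAt.comp_hasFDerivAt z hq (hasFDerivAt_snd (𝕜 := ℝ))
  have := (h1.mul h2).fderiv
  unfold dY
  erw [this]
  simp

/-- Test with bilinear functions that vanish on two adjacent edges. Such a κ is affine along the
other two edges, with slopes of opposite sign as the boundary is traversed, so the weak identity
compares exactly those two edge averages. In terms of cell integrals this is a pointwise identity of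
integrands. -/
theorem StrongLimit.edges_eq (hh : 0 < h) (H : StrongLimit (box a b h) u f g₁ g₂)
    {Ψ : ℝ × ℝ → ℝ} (hΨ : ContDiff ℝ 2 Ψ) (hl : ∀ y, Ψ (a, y) = 0) (hr : ∀ y, Ψ (a + h, y) = 0)
    (hb : ∀ x, Ψ (x, b) = 0) (ht : ∀ x, Ψ (x, b + h) = 0)
    (hne : ∀ᵐ z ∂volume.restrict (box a b h), Ψ z ≠ 0)
    (heq : ∀ᵐ z ∂volume.restrict (box a b h), g₂ z * dX Ψ z - g₁ z * dY Ψ z = 0) :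
    edgeL a b h f g₁ = edgeT a b h f g₂ ∧ edgeT a b h f g₂ = edgeR a b h f g₁ ∧
      edgeR a b h f g₁ = edgeB a b h f g₂ := by
  have key : ∀ {κ : ℝ × ℝ → ℝ}, ContDiff ℝ 2 κ → _ := fun {κ} hκ =>
    H.green_of_stream hh hΨ hl hr hb ht hne heq hκ
  have i0 : IntegrableOn f (box a b h) := by
    simpa using integrable_mul_box H.memLp (continuous_const (y := (1 : ℝ)))
  have i1 : ∀ w : ℝ × ℝ → ℝ, Continuous w → IntegrableOn (fun z => w z * g₁ z) (box a b h) :=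
    fun w hw => by simpa only [mul_comm] using integrable_mul_box H.memLp_fst hw
  have i2 : ∀ w : ℝ × ℝ → ℝ, Continuous w → IntegrableOn (fun z => w z * g₂ z) (box a b h) :=
    fun w hw => by simpa only [mul_comm] using integrable_mul_box H.memLp_snd hw
  have iL : IntegrableOn (fun z => f z - (a + h - z.1) * g₁ z) (box a b h) := i0.sub (i1 _ (by fun_prop))
  have iR : IntegrableOn (fun z => f z + (z.1 - a) * g₁ z) (box a b h) := i0.add (i1 _ (by fun_prop))
  have iB : IntegrableOn (fun z => f z - (b + h - z.2) * g₂ z) (box a b h) := i0.sub (i2 _ (by fun_prop))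
  have iT : IntegrableOn (fun z => f z + (z.2 - b) * g₂ z) (box a b h) := i0.add (i2 _ (by fun_prop))
  have d1 : ∀ c x : ℝ, HasDerivAt (fun x : ℝ => x - c) 1 x := fun c x =>
    (hasDerivAt_id x).sub_const c
  have d2 : ∀ c x : ℝ, HasDerivAt (fun x : ℝ => c - x) (-1) x := fun c x =>
    (hasDerivAt_id x).const_sub c
  refine ⟨?_, ?_, ?_⟩
  · have := key (κ := fun z => (a + h - z.1) * (z.2 - b)) (by fun_prop)
    unfold edgeL edgeT
    congr 1
    rw [← sub_eq_zero, ← integral_sub iL iT, ← this]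
    congr 1
    funext z
    rw [dX_mul_fun (d2 (a + h) _) (d1 b _), dY_mul_fun (d2 (a + h) _) (d1 b _)]
    ring
  · have := key (κ := fun z => (z.1 - a) * (z.2 - b)) (by fun_prop)
    unfold edgeR edgeT
    congr 1
    rw [← sub_eq_zero, ← integral_sub iT iR, ← this]
    congr 1
    funext z
    rw [dX_mul_fun (d1 a _) (d1 b _), dY_mul_fun (d1 a _) (d1 b _)]
    ring
  · have := key (κ := fun z => (z.1 - a) * (b + h - z.2)) (by fun_prop)
    unfold edgeR edgeB
    congr 1
    rw [← sub_eq_zero, ← integral_sub iR iB, ← this]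
    congr 1
    funext z
    rw [dX_mul_fun (d1 a _) (d2 (b + h) _), dY_mul_fun (d1 a _) (d2 (b + h) _)]
    ring

end Boxes

/-! ### Smoothness of parametric integrals -/

theorem hasFDerivAt_parametric_integral {E F : Type} [NormedAddCommGroup E] [NormedSpace ℝ E]
    [FiniteDimensional ℝ E] [NormedAddCommGroup F] [NormedSpace ℝ F] {f : E × ℝ → F}
    (hf : ContDiff ℝ 1 f) (a b : ℝ) (x : E) :
    HasFDerivAt (fun x => ∫ t in a..b, f (x, t))
      (∫ t in a..b, (fderiv ℝ f (x, t)).comp (ContinuousLinearMap.inl ℝ E ℝ)) x := by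
  have : ProperSpace E := FiniteDimensional.proper ℝ E
  have hc : Continuous fun z : E × ℝ => (fderiv ℝ f z).comp (ContinuousLinearMap.inl ℝ E ℝ) :=
    (hf.continuous_fderiv one_ne_zero).clm_comp continuous_const
  obtain ⟨C, hC⟩ := ((isCompact_closedBall x 1).prod (isCompact_uIcc (a := a) (b := b))
    ).exists_bound_of_continuousOn hc.continuousOn
  have hcf := hf.continuous
  refine intervalIntegral.hasFDerivAt_integral_of_dominated_of_fderiv_le (𝕜 := ℝ)
    (F := fun x t => f (x, t))
    (F' := fun x t => (fderiv ℝ f (x, t)).comp (ContinuousLinearMap.inl ℝ E ℝ))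
    (bound := fun _ => C) (closedBall_mem_nhds x one_pos)
    (Eventually.of_forall fun y => (by fun_prop : Continuous fun t => f (y, t)).aestronglyMeasurable)
    ((by fun_prop : Continuous fun t => f (x, t)).intervalIntegrable _ _)
    (hc.comp (Continuous.prodMk_right x)).aestronglyMeasurable
    (ae_of_all _ fun t ht y hy => hC (y, t) ⟨hy, Set.uIoc_subset_uIcc ht⟩)
    intervalIntegrable_const (ae_of_all _ fun t _ y _ => ?_)
  have h1 : HasFDerivAt f (fderiv ℝ f (y, t)) (y, t) :=
    (hf.differentiable one_ne_zero _).hasFDerivAt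
  have h2 : HasFDerivAt (fun y : E => (y, t)) (ContinuousLinearMap.inl ℝ E ℝ) y :=
    hasFDerivAt_prodMk_left y t
  exact h1.comp y h2

/-- Induction on the order, for all target spaces at once: the derivative is again a parametric
integral, but of an integrand with values in linear maps. -/
theorem contDiff_parametric_integral_nat {E : Type} [NormedAddCommGroup E] [NormedSpace ℝ E]
    [FiniteDimensional ℝ E] (n : ℕ) {F : Type} [NormedAddCommGroup F] [NormedSpace ℝ F]
    {f : E × ℝ → F} (hf : ContDiff ℝ n f) (a b : ℝ) :
    ContDiff ℝ n (fun x => ∫ t in a..b, f (x, t)) := by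
  induction n generalizing F with
  | zero =>
    have hc : Continuous f := hf.continuous
    exact contDiff_zero.2
      (intervalIntegral.continuous_parametric_intervalIntegral_of_continuous' (by fun_prop) _ _)
  | succ n ih =>
    refine contDiff_succ_iff_hasFDerivAt.2 ⟨_, ?_, fun x =>
      hasFDerivAt_parametric_integral (hf.of_le (by exact_mod_cast Nat.le_add_left 1 n)) a b x⟩
    exact ih (f := fun z => (fderiv ℝ f z).comp (ContinuousLinearMap.inl ℝ E ℝ))
      ((hf.fderiv_right (by norm_cast)).clm_comp contDiff_const)

theorem contDiff_parametric_integral {E : Type} [NormedAddCommGroup E] [NormedSpace ℝ E]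
    [FiniteDimensional ℝ E] {n : ℕ∞} {F : Type} [NormedAddCommGroup F] [NormedSpace ℝ F]
    {f : E × ℝ → F} (hf : ContDiff ℝ n f) (a b : ℝ) :
    ContDiff ℝ n (fun x => ∫ t in a..b, f (x, t)) :=
  contDiff_iff_forall_nat_le.2 fun m hm =>
    contDiff_parametric_integral_nat m (hf.of_le (by exact_mod_cast hm)) a b

theorem contDiff_primitive {n : ℕ∞} {f : ℝ × ℝ → ℝ} (hf : ContDiff ℝ n f) :
    ContDiff ℝ n (fun z : ℝ × ℝ => ∫ s in (0 : ℝ)..z.2, f (z.1, s)) := by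
  -- The substitution s = z₂t moves the variable endpoint into the integrand, so that only integrals
  -- over a fixed interval remain.
  have h : ∀ z : ℝ × ℝ, ∫ s in (0 : ℝ)..z.2, f (z.1, s)
      = z.2 * ∫ t in (0 : ℝ)..1, f (z.1, z.2 * t) := by
    intro z
    have := intervalIntegral.smul_integral_comp_mul_left (a := 0) (b := 1)
      (fun s => f (z.1, s)) z.2
    simpa using this.symm
  simp only [h]
  exact contDiff_snd.mul (contDiff_parametric_integral
    (f := fun w : (ℝ × ℝ) × ℝ => f (w.1.1, w.1.2 * w.2)) (hf.comp (by fun_prop)) 0 1)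

/-! ### The plane as a product -/

/-- The identification of `ℝ × ℝ` with the plane. -/
def pairEquiv : (ℝ × ℝ) ≃L[ℝ] Plane :=
  LinearEquiv.toContinuousLinearEquiv
    { toFun := fun z => !₂[z.1, z.2]
      invFun := fun w => (w 0, w 1)
      map_add' := fun z w => by ext i; fin_cases i <;> simp
      map_smul' := fun c z => by ext i; fin_cases i <;> simp
      left_inv := fun z => by simp
      right_inv := fun w => by ext i; fin_cases i <;> simp }

theorem pairEquiv_apply (z : ℝ × ℝ) : pairEquiv z = !₂[z.1, z.2] := rfl

theorem contDiff_mk {E : Type*} [NormedAddCommGroup E] [NormedSpace ℝ E] {n : WithTop ℕ∞}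
    {p q : E → ℝ} (hp : ContDiff ℝ n p) (hq : ContDiff ℝ n q) :
    ContDiff ℝ n (fun z => (!₂[p z, q z] : Plane)) :=
  pairEquiv.contDiff.comp (hp.prodMk hq)

theorem contDiff_coord {n : WithTop ℕ∞} (i : Fin 2) : ContDiff ℝ n (fun z : Plane => z i) :=
  (EuclideanSpace.proj (𝕜 := ℝ) i).contDiff

theorem abs_coord_le_norm (z : Plane) (i : Fin 2) : |z i| ≤ ‖z‖ := by
  simpa using PiLp.norm_apply_le z i

theorem measurePreserving_pairEquiv : MeasurePreserving pairEquiv volume volume := by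
  have h1 := (volume_preserving_finTwoArrow ℝ).symm
  have h2 := (EuclideanSpace.volume_preserving_symm_measurableEquiv_toLp (Fin 2)).symm
  exact h2.comp h1

/-! ### The density on the torus -/

theorem wrap_eq {n : ℕ} (hn : 1 ≤ n) {t : ℝ} (k : ℤ) (h1 : -2 * n ≤ t - 4 * n * k)
    (h2 : t - 4 * n * k < 2 * n) : wrap n t = t - 4 * n * k := by
  have hn' : (0 : ℝ) < 4 * n := by positivity
  have : ⌊(t + 2 * n) / (4 * n)⌋ = k := by
    rw [Int.floor_eq_iff, le_div_iff₀ hn', div_lt_iff₀ hn']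
    constructor <;> linarith
  rw [wrap, this]

theorem wrap_eq_self {n : ℕ} (hn : 1 ≤ n) {t : ℝ} (h : |t| < 2 * n) : wrap n t = t := by
  have := abs_lt.1 h
  simpa using wrap_eq hn (t := t) 0 (by simp; linarith) (by simp; linarith)

/-- `wrap` jumps only at the seam, the points congruent to 2n modulo 4n. Away from it `wrap` is a
local translation; near it the wrapped coordinate is so large that the cutoff vanishes. -/
theorem wrap_local {n : ℕ} (hn : 1 ≤ n) (t : ℝ) :
    (∃ c : ℝ, ∀ᶠ s in 𝓝 t, wrap n s = s - c) ∨ ∀ᶠ s in 𝓝 t, 7 * (n : ℝ) / 4 ≤ |wrap n s| := by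
  have hn' : (0 : ℝ) < n := by positivity
  set k := ⌊(t + 2 * n) / (4 * n)⌋
  have h1 : -2 * n ≤ t - 4 * n * k := by
    have := Int.floor_le ((t + 2 * n) / (4 * n))
    rw [le_div_iff₀ (by positivity)] at this
    simp only [k]; linarith
  have h2 : t - 4 * n * k < 2 * n := by
    have := Int.lt_floor_add_one ((t + 2 * n) / (4 * n))
    rw [div_lt_iff₀ (by positivity)] at this
    simp only [k]; linarith
  rcases h1.eq_or_lt with h | h
  -- Here t lies on the seam. Within n/4 of it the wrapped value has modulus at least 2n - n/4 =
  -- 7n/4, which is exactly the radius beyond which the cutoff is zero.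
  · right
    filter_upwards [Ioo_mem_nhds (show t - n / 4 < t by linarith) (show t < t + n / 4 by linarith)]
      with s hs
    rcases le_or_gt t s with hts | hts
    · rw [wrap_eq hn (t := s) k (by linarith) (by linarith [hs.2]),
        abs_of_neg (by linarith [hs.2])]
      linarith [hs.2]
    -- Just to the left of the seam the integer part drops by one.
    · rw [wrap_eq hn (t := s) (k - 1) (by push_cast; linarith [hs.1]) (by push_cast; linarith)]
      push_cast
      rw [abs_of_pos (by linarith [hs.1])]
      linarith [hs.1]
  · left
    refine ⟨4 * n * k, ?_⟩
    filter_upwards [Ioo_mem_nhds (show -2 * n + 4 * n * k < t by linarith)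
      (show t < 2 * n + 4 * n * k by linarith)] with s hs
    exact wrap_eq hn k (by linarith [hs.1]) (by linarith [hs.2])

theorem isCompact_square (n : ℕ) : IsCompact (square n) := by
  have h : square n = (pairEquiv : ℝ × ℝ → Plane) ''
      (Set.Icc (-2 * n : ℝ) (2 * n) ×ˢ Set.Icc (-2 * n : ℝ) (2 * n)) := by
    ext z
    constructor
    · intro hz
      exact ⟨(z 0, z 1), ⟨hz 0, hz 1⟩, pairEquiv.apply_symm_apply z⟩
    · rintro ⟨w, ⟨h0, h1⟩, rfl⟩ i
      fin_cases i
      · exact h0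
      · exact h1
  rw [h]
  exact (isCompact_Icc.prod isCompact_Icc).image pairEquiv.continuous

theorem ball_subset_square (n : ℕ) : ball (0 : Plane) (2 * n) ⊆ square n := by
  intro z hz i
  have h1 := abs_coord_le_norm z i
  rw [mem_ball_zero_iff] at hz
  have := abs_le.1 (h1.trans hz.le)
  exact ⟨by linarith [this.1], this.2⟩

section Construction

variable {ρ χ : Plane → ℝ} {n : ℕ}

theorem floorLevel_pos (hρ : Continuous ρ) (hpos : ∀ z, 0 < ρ z) : 0 < floorLevel ρ n := by
  have hne : (square n).Nonempty := ⟨0, fun i => by simp⟩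
  obtain ⟨z, hz, hmin⟩ := (isCompact_square n).exists_sInf_image_eq hne hρ.continuousOn
  rw [floorLevel, hmin]
  have := hpos z
  positivity

theorem two_mul_floorLevel_le (hρ : Continuous ρ) {z : Plane} (hz : z ∈ square n) :
    2 * floorLevel ρ n ≤ ρ z := by
  have := csInf_le ((isCompact_square n).image hρ).bddBelow (Set.mem_image_of_mem ρ hz)
  rw [floorLevel]; linarith

/-- The factor 1/2 in `floorLevel` gives ρ ≥ 2δ on the square, hence the term multiplied by the
cutoff is nonnegative there; outside the support of the cutoff the density equals δ. -/
theorem floorLevel_le_cutDensity (hn : 1 ≤ n) (hρ : Continuous ρ) (hpos : ∀ z, 0 < ρ z)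
    (hχ : IsCutoff n χ) (z : Plane) : floorLevel ρ n ≤ cutDensity ρ χ n z := by
  have hn' : (0 : ℝ) < n := by positivity
  rw [cutDensity]
  by_cases hz : z ∈ ball (0 : Plane) (7 * n / 4)
  · have h1 := two_mul_floorLevel_le hρ
      (ball_subset_square n (ball_subset_ball (by linarith) hz))
    have := mul_nonneg (by linarith [floorLevel_pos (n := n) hρ hpos] : 0 ≤ ρ z - floorLevel ρ n)
      (hχ.nonneg z)
    linarith
  · simp [hχ.eq_zero z hz]

theorem contDiff_cutDensity {K : ℕ∞} (hρ : ContDiff ℝ K ρ) (hχ : IsCutoff n χ) :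
    ContDiff ℝ K (cutDensity ρ χ n) :=
  ((hρ.sub contDiff_const).mul (hχ.smooth.of_le (by exact_mod_cast le_top))).add contDiff_const

theorem normConst_pos (hn : 1 ≤ n) (hρ : Continuous ρ) (hpos : ∀ z, 0 < ρ z)
    (hχ : IsCutoff n χ) : 0 < normConst ρ χ n := by
  have hn' : (0 : ℝ) < n := by positivity
  have hc : Continuous (cutDensity ρ χ n) :=
    (contDiff_cutDensity (K := 0) (contDiff_zero.2 hρ) hχ).continuous
  have hp : ∀ z, 0 < cutDensity ρ χ n z := fun z =>
    (floorLevel_pos hρ hpos).trans_le (floorLevel_le_cutDensity hn hρ hpos hχ z)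
  rw [normConst, setIntegral_pos_iff_support_of_nonneg_ae (ae_of_all _ fun z => (hp z).le)
    (hc.continuousOn.integrableOn_compact (isCompact_square n))]
  have : Function.support (cutDensity ρ χ n) = Set.univ :=
    Set.eq_univ_of_forall fun z => (hp z).ne'
  rw [this, Set.univ_inter]
  exact (measure_ball_pos volume (0 : Plane) (by positivity : (0 : ℝ) < 2 * n)).trans_le
    (measure_mono (ball_subset_square n))

theorem torusDensity_pos (hn : 1 ≤ n) (hρ : Continuous ρ) (hpos : ∀ z, 0 < ρ z)
    (hχ : IsCutoff n χ) (p q : ℝ) : 0 < torusDensity ρ χ n p q :=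
  mul_pos (inv_pos.2 (normConst_pos hn hρ hpos hχ))
    ((floorLevel_pos hρ hpos).trans_le (floorLevel_le_cutDensity hn hρ hpos hχ _))

theorem le_torusDensity (hn : 1 ≤ n) (hρ : Continuous ρ) (hpos : ∀ z, 0 < ρ z)
    (hχ : IsCutoff n χ) (p q : ℝ) :
    (normConst ρ χ n)⁻¹ * floorLevel ρ n ≤ torusDensity ρ χ n p q :=
  mul_le_mul_of_nonneg_left (floorLevel_le_cutDensity hn hρ hpos hχ _)
    (inv_pos.2 (normConst_pos hn hρ hpos hχ)).le

theorem torusDensity_of_mem_ball (hn : 1 ≤ n) (hχ : IsCutoff n χ) {z : Plane}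
    (hz : z ∈ ball (0 : Plane) (3 * n / 2)) :
    torusDensity ρ χ n (z 0) (z 1) = (normConst ρ χ n)⁻¹ * ρ z := by
  have hn' : (0 : ℝ) < n := by positivity
  have h : ∀ i, wrap n (z i) = z i := fun i => by
    refine wrap_eq_self hn ((abs_coord_le_norm z i).trans_lt ?_)
    rw [mem_ball_zero_iff] at hz
    linarith
  have hz' : (!₂[z 0, z 1] : Plane) = z := pairEquiv.apply_symm_apply z
  rw [torusDensity, h, h, hz', cutDensity, hχ.eq_one z hz]
  ring

/-- Smoothness across the identified sides: if either coordinate is near the seam, the density is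
locally the constant `floorLevel`; otherwise it is locally a translate of `cutDensity`. -/
theorem contDiff_torusDensity {K : ℕ∞} (hn : 1 ≤ n) (hρ : ContDiff ℝ K ρ) (hχ : IsCutoff n χ) :
    ContDiff ℝ K (fun z : ℝ × ℝ => torusDensity ρ χ n z.1 z.2) := by
  refine contDiff_const.mul (contDiff_iff_contDiffAt.2 fun z => ?_)
  have hcut : ∀ (w : Plane) (i : Fin 2), 7 * (n : ℝ) / 4 ≤ |w i| →
      cutDensity ρ χ n w = floorLevel ρ n := by
    intro w i hw
    have : w ∉ ball (0 : Plane) (7 * n / 4) := fun h =>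
      absurd (hw.trans (abs_coord_le_norm w i)) (not_le.2 (mem_ball_zero_iff.1 h))
    simp [cutDensity, hχ.eq_zero w this]
  rcases wrap_local hn z.1 with ⟨c, hc⟩ | h0
  · rcases wrap_local hn z.2 with ⟨d, hd⟩ | h1
    · have e : (fun w : ℝ × ℝ => cutDensity ρ χ n !₂[wrap n w.1, wrap n w.2]) =ᶠ[𝓝 z]
          fun w => cutDensity ρ χ n !₂[w.1 - c, w.2 - d] := by
        filter_upwards [continuous_fst.continuousAt.eventually hc,
          continuous_snd.continuousAt.eventually hd] with w h1 h2
        rw [h1, h2]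
      refine ContDiffAt.congr_of_eventuallyEq ?_ e
      exact ((contDiff_cutDensity hρ hχ).comp
        (contDiff_mk (by fun_prop) (by fun_prop))).contDiffAt
    · have e : (fun w : ℝ × ℝ => cutDensity ρ χ n !₂[wrap n w.1, wrap n w.2]) =ᶠ[𝓝 z]
          fun _ => floorLevel ρ n := by
        filter_upwards [continuous_snd.continuousAt.eventually h1] with w h
        exact hcut _ 1 (by simpa using h)
      exact contDiffAt_const.congr_of_eventuallyEq e
  · have e : (fun w : ℝ × ℝ => cutDensity ρ χ n !₂[wrap n w.1, wrap n w.2]) =ᶠ[𝓝 z]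
        fun _ => floorLevel ρ n := by
      filter_upwards [continuous_fst.continuousAt.eventually h0] with w h
      exact hcut _ 0 (by simpa using h)
    exact contDiffAt_const.congr_of_eventuallyEq e

end Construction

/-! ### The transport map and its inverse -/

theorem bijective_primitive {w : ℝ → ℝ} (hw : Continuous w) {c : ℝ} (hc : 0 < c)
    (hcw : ∀ x, c ≤ w x) : Function.Bijective (fun p => ∫ s in (0 : ℝ)..p, w s) := by
  have hd : ∀ p, HasDerivAt (fun p => ∫ s in (0 : ℝ)..p, w s) (w p) p := fun p =>
    intervalIntegral.integral_hasDerivAt_right (hw.intervalIntegrable _ _)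
      (hw.stronglyMeasurableAtFilter _ _) hw.continuousAt
  have hi : ∀ a b : ℝ, a ≤ b → c * (b - a) ≤ ∫ s in a..b, w s := by
    intro a b hab
    have := intervalIntegral.integral_mono_on hab (f := fun _ => c) (g := w)
      (intervalIntegrable_const (μ := volume)) (hw.intervalIntegrable _ _) fun x _ => hcw x
    simpa [mul_comm] using this
  refine ⟨(strictMono_of_deriv_pos fun p => ?_).injective, ?_⟩
  · rw [(hd p).deriv]; exact hc.trans_le (hcw p)
  · refine Continuous.surjective
      (continuous_iff_continuousAt.2 fun p => (hd p).continuousAt) ?_ ?_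
    · refine tendsto_atTop_mono' atTop ?_ (tendsto_id.const_mul_atTop hc)
      filter_upwards [eventually_ge_atTop 0] with p hp
      simpa using hi 0 p hp
    · refine tendsto_atBot_mono' atBot ?_ (tendsto_id.const_mul_atBot hc)
      filter_upwards [eventually_le_atBot 0] with p hp
      have := hi p 0 hp
      rw [intervalIntegral.integral_symm] at this
      simp only [id]
      linarith

theorem det_plane (D : Plane →L[ℝ] Plane) :
    D.det = D (EuclideanSpace.single 0 1) 0 * D (EuclideanSpace.single 1 1) 1
      - D (EuclideanSpace.single 1 1) 0 * D (EuclideanSpace.single 0 1) 1 := by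
  have : D.det = LinearMap.det (D : Plane →ₗ[ℝ] Plane) := rfl
  rw [this, ← LinearMap.det_toMatrix (EuclideanSpace.basisFun (Fin 2) ℝ).toBasis,
    Matrix.det_fin_two]
  simp [LinearMap.toMatrix_apply]

theorem plane_eq_sum (v : Plane) :
    v = v 0 • EuclideanSpace.single 0 (1 : ℝ) + v 1 • EuclideanSpace.single 1 (1 : ℝ) := by
  ext i; fin_cases i <;> simp

/-- The `i`-th coordinate as a continuous linear functional. -/
def coordL (i : Fin 2) : Plane →L[ℝ] ℝ := EuclideanSpace.proj i

theorem coordL_apply (i : Fin 2) (z : Plane) : coordL i z = z i := rfl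

theorem fderiv_coord {E : Type*} [NormedAddCommGroup E] [NormedSpace ℝ E] {f : E → Plane} {z : E}
    (hf : DifferentiableAt ℝ f z) (v : E) (i : Fin 2) :
    fderiv ℝ f z v i = fderiv ℝ (fun w => f w i) z v := by
  have := ((coordL i).hasFDerivAt.comp z hf.hasFDerivAt).fderiv
  have h2 : (coordL i ∘ f) = fun w => f w i := rfl
  rw [h2] at this
  rw [this]; rfl

/-- The inverse of the transport map: the marginal and conditional distribution functions. -/
def cdfMap (ρ χ : Plane → ℝ) (n : ℕ) (z : Plane) : Plane :=
  !₂[marginalCdf ρ χ n (z 0), conditionalCdf ρ χ n (z 0) (z 1)]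

section Construction

variable {ρ χ : Plane → ℝ} {n : ℕ}

theorem continuous_torusDensity (hn : 1 ≤ n) (hρ : Continuous ρ) (hχ : IsCutoff n χ) (p : ℝ) :
    Continuous (torusDensity ρ χ n p) := by
  have := (contDiff_torusDensity (K := 0) hn (contDiff_zero.2 hρ) hχ).continuous
  exact this.comp (Continuous.prodMk_right p)

theorem contDiff_marginal {K : ℕ∞} (hn : 1 ≤ n) (hρ : ContDiff ℝ K ρ) (hχ : IsCutoff n χ) :
    ContDiff ℝ K (marginal ρ χ n) :=
  contDiff_parametric_integral (contDiff_torusDensity hn hρ hχ) _ _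

theorem continuous_marginal (hn : 1 ≤ n) (hρ : Continuous ρ) (hχ : IsCutoff n χ) :
    Continuous (marginal ρ χ n) :=
  (contDiff_marginal (K := 0) hn (contDiff_zero.2 hρ) hχ).continuous

theorem exists_le_marginal (hn : 1 ≤ n) (hρ : Continuous ρ) (hpos : ∀ z, 0 < ρ z)
    (hχ : IsCutoff n χ) : ∃ c, 0 < c ∧ ∀ p, c ≤ marginal ρ χ n p := by
  have hn' : (0 : ℝ) < n := by positivity
  refine ⟨4 * n * ((normConst ρ χ n)⁻¹ * floorLevel ρ n), mul_pos (by positivity)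
    (mul_pos (inv_pos.2 (normConst_pos hn hρ hpos hχ)) (floorLevel_pos hρ hpos)), fun p => ?_⟩
  have := intervalIntegral.integral_mono_on (a := (-2 * n : ℝ)) (b := 2 * n) (by linarith)
    (f := fun _ => (normConst ρ χ n)⁻¹ * floorLevel ρ n) (g := torusDensity ρ χ n p)
    (intervalIntegrable_const (μ := volume)) ((continuous_torusDensity hn hρ hχ p).intervalIntegrable _ _)
    fun x _ => le_torusDensity hn hρ hpos hχ p x
  rw [intervalIntegral.integral_const, smul_eq_mul] at this
  rw [marginal]
  linarith

theorem marginal_pos (hn : 1 ≤ n) (hρ : Continuous ρ) (hpos : ∀ z, 0 < ρ z)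
    (hχ : IsCutoff n χ) (p : ℝ) : 0 < marginal ρ χ n p := by
  obtain ⟨c, hc, h⟩ := exists_le_marginal hn hρ hpos hχ
  exact hc.trans_le (h p)

theorem bijective_marginalCdf (hn : 1 ≤ n) (hρ : Continuous ρ) (hpos : ∀ z, 0 < ρ z)
    (hχ : IsCutoff n χ) : Function.Bijective (marginalCdf ρ χ n) := by
  obtain ⟨c, hc, h⟩ := exists_le_marginal hn hρ hpos hχ
  exact bijective_primitive (continuous_marginal hn hρ hχ) hc h

theorem bijective_conditionalCdf (hn : 1 ≤ n) (hρ : Continuous ρ) (hpos : ∀ z, 0 < ρ z)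
    (hχ : IsCutoff n χ) (p : ℝ) : Function.Bijective (conditionalCdf ρ χ n p) := by
  have h1 := bijective_primitive (continuous_torusDensity hn hρ hχ p)
    (mul_pos (inv_pos.2 (normConst_pos hn hρ hpos hχ)) (floorLevel_pos (n := n) hρ hpos))
    (le_torusDensity hn hρ hpos hχ p)
  exact (mulLeft_bijective₀ _ (inv_ne_zero (marginal_pos hn hρ hpos hχ p).ne')).comp h1

theorem cdfMap_transport (hn : 1 ≤ n) (hρ : Continuous ρ) (hpos : ∀ z, 0 < ρ z)
    (hχ : IsCutoff n χ) (z : Plane) : cdfMap ρ χ n (transport ρ χ n z) = z := by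
  have h1 : marginalCdf ρ χ n (transportP ρ χ n (z 0)) = z 0 :=
    Function.rightInverse_invFun (bijective_marginalCdf hn hρ hpos hχ).2 (z 0)
  have h2 : conditionalCdf ρ χ n (transportP ρ χ n (z 0)) (transportQ ρ χ n (z 0) (z 1)) = z 1 :=
    Function.rightInverse_invFun (bijective_conditionalCdf hn hρ hpos hχ _).2 (z 1)
  ext i
  fin_cases i
  · simpa [cdfMap, transport] using h1
  · simpa [cdfMap, transport] using h2

theorem transport_cdfMap (hn : 1 ≤ n) (hρ : Continuous ρ) (hpos : ∀ z, 0 < ρ z)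
    (hχ : IsCutoff n χ) (z : Plane) : transport ρ χ n (cdfMap ρ χ n z) = z := by
  have h1 : transportP ρ χ n (marginalCdf ρ χ n (z 0)) = z 0 :=
    Function.leftInverse_invFun (bijective_marginalCdf hn hρ hpos hχ).1 (z 0)
  have h2 : transportQ ρ χ n (marginalCdf ρ χ n (z 0)) (conditionalCdf ρ χ n (z 0) (z 1)) = z 1 := by
    rw [transportQ, h1]
    exact Function.leftInverse_invFun (bijective_conditionalCdf hn hρ hpos hχ _).1 (z 1)
  ext i
  fin_cases i
  · simpa [cdfMap, transport] using h1
  · simpa [cdfMap, transport] using h2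

/-- The inverse of the transport map is the explicit object, given by integrals of the density. All
regularity statements are therefore made about it rather than about the transport map. -/
theorem invFun_transport (hn : 1 ≤ n) (hρ : Continuous ρ) (hpos : ∀ z, 0 < ρ z)
    (hχ : IsCutoff n χ) : Function.invFun (transport ρ χ n) = cdfMap ρ χ n := by
  funext z
  have hinj : Function.Injective (transport ρ χ n) :=
    Function.LeftInverse.injective (cdfMap_transport hn hρ hpos hχ)
  have := Function.leftInverse_invFun hinj (cdfMap ρ χ n z)
  rwa [transport_cdfMap hn hρ hpos hχ] at this

theorem contDiff_cdfMap {K : ℕ∞} (hn : 1 ≤ n) (hρ : ContDiff ℝ K ρ) (hpos : ∀ z, 0 < ρ z)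
    (hχ : IsCutoff n χ) : ContDiff ℝ K (cdfMap ρ χ n) := by
  have hm := contDiff_marginal hn hρ hχ
  refine contDiff_mk ?_ ?_
  · have h1 := contDiff_primitive (f := fun z => marginal ρ χ n z.2) (hm.comp contDiff_snd)
    exact h1.comp (g := fun z : ℝ × ℝ => ∫ s in (0 : ℝ)..z.2, marginal ρ χ n s)
      (f := fun z : Plane => ((0 : ℝ), z 0)) (contDiff_const.prodMk (contDiff_coord 0))
  · have h1 := contDiff_primitive (contDiff_torusDensity hn hρ hχ)
    have h2 := h1.comp (f := fun z : Plane => (z 0, z 1))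
      ((contDiff_coord 0).prodMk (contDiff_coord 1))
    exact (ContDiff.inv (hm.comp (contDiff_coord 0))
      fun z => (marginal_pos hn hρ.continuous hpos hχ _).ne').mul h2

theorem fderiv_cdfMap_zero (hn : 1 ≤ n) (hρ : ContDiff ℝ 1 ρ) (hpos : ∀ z, 0 < ρ z)
    (hχ : IsCutoff n χ) (z v : Plane) :
    fderiv ℝ (cdfMap ρ χ n) z v 0 = marginal ρ χ n (z 0) * v 0 := by
  have hd := (contDiff_cdfMap (K := 1) hn hρ hpos hχ).differentiable one_ne_zero z
  rw [fderiv_coord hd]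
  have hm := continuous_marginal hn hρ.continuous hχ
  have h1 : HasDerivAt (marginalCdf ρ χ n) (marginal ρ χ n (z 0)) (z 0) :=
    intervalIntegral.integral_hasDerivAt_right (hm.intervalIntegrable _ _)
      (hm.stronglyMeasurableAtFilter _ _) hm.continuousAt
  have h2 := HasDerivAt.comp_hasFDerivAt z h1
    (coordL 0).hasFDerivAt
  have h3 : (fun w => cdfMap ρ χ n w 0) = marginalCdf ρ χ n ∘
      coordL 0 := rfl
  rw [h3, h2.fderiv]
  simp [coordL_apply]

theorem fderiv_cdfMap_one (hn : 1 ≤ n) (hρ : ContDiff ℝ 1 ρ) (hpos : ∀ z, 0 < ρ z)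
    (hχ : IsCutoff n χ) (z : Plane) :
    fderiv ℝ (cdfMap ρ χ n) z (EuclideanSpace.single 1 1) 1 =
      (marginal ρ χ n (z 0))⁻¹ * torusDensity ρ χ n (z 0) (z 1) := by
  have hd := (contDiff_cdfMap (K := 1) hn hρ hpos hχ).differentiable one_ne_zero z
  rw [fderiv_coord hd]
  have hτ := continuous_torusDensity hn hρ.continuous hχ (z 0)
  have h1 : HasDerivAt (conditionalCdf ρ χ n (z 0))
      ((marginal ρ χ n (z 0))⁻¹ * torusDensity ρ χ n (z 0) (z 1)) (z 1) :=
    (intervalIntegral.integral_hasDerivAt_right (hτ.intervalIntegrable _ _)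
      (hτ.stronglyMeasurableAtFilter _ _) hτ.continuousAt).const_mul _
  have hd1 : DifferentiableAt ℝ (fun w => cdfMap ρ χ n w 1) z :=
    (coordL 1).differentiableAt.comp z hd
  have h2 : HasDerivAt (fun s : ℝ => pairEquiv (z 0, s)) (EuclideanSpace.single 1 1) (z 1) := by
    have := pairEquiv.hasFDerivAt.comp_hasDerivAt (z 1)
      ((hasDerivAt_const (z 1) (z 0)).prodMk (hasDerivAt_id (z 1)))
    have e : pairEquiv (0, 1) = EuclideanSpace.single 1 1 := by
      ext i; fin_cases i <;> simp [pairEquiv_apply]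
    exact this.congr_deriv e
  have hz : pairEquiv (z 0, z 1) = z := pairEquiv.apply_symm_apply z
  have h3 := HasFDerivAt.comp_hasDerivAt (z 1) (hz.symm ▸ hd1.hasFDerivAt :
    HasFDerivAt (fun w => cdfMap ρ χ n w 1) _ (pairEquiv (z 0, z 1))) h2
  have h4 := h3.unique h1
  rwa [hz] at h4

/-- The derivative is triangular with diagonal entries π̄ and τ/π̄, where τ is the torus density.
The remaining entry, the derivative of the conditional distribution function in p, never has to be
computed. -/
theorem det_fderiv_cdfMap (hn : 1 ≤ n) (hρ : ContDiff ℝ 1 ρ) (hpos : ∀ z, 0 < ρ z)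
    (hχ : IsCutoff n χ) (z : Plane) :
    (fderiv ℝ (cdfMap ρ χ n) z).det = torusDensity ρ χ n (z 0) (z 1) := by
  rw [det_plane, fderiv_cdfMap_zero hn hρ hpos hχ, fderiv_cdfMap_zero hn hρ hpos hχ,
    fderiv_cdfMap_one hn hρ hpos hχ]
  have := (marginal_pos hn hρ.continuous hpos hχ (z 0)).ne'
  simp
  field_simp

/-- By the inverse function theorem a C¹ map with invertible derivative is open; being also
bijective, it is a homeomorphism. The invertible derivatives are recorded because they make the
inverse C¹. -/
theorem exists_cdf_homeomorph (hn : 1 ≤ n) (hρ : ContDiff ℝ 1 ρ) (hpos : ∀ z, 0 < ρ z)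
    (hχ : IsCutoff n χ) : ∃ e : Plane ≃ₜ Plane, ⇑e = cdfMap ρ χ n ∧ ⇑e.symm = transport ρ χ n ∧
      ∃ e' : Plane → Plane ≃L[ℝ] Plane,
        ∀ z, HasFDerivAt (cdfMap ρ χ n) (e' z : Plane →L[ℝ] Plane) z := by
  have hF := contDiff_cdfMap (K := 1) hn hρ hpos hχ
  have hdet : ∀ z, (fderiv ℝ (cdfMap ρ χ n) z).det ≠ 0 := fun z => by
    rw [det_fderiv_cdfMap hn hρ hpos hχ]
    exact (torusDensity_pos hn hρ.continuous hpos hχ _ _).ne'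
  let e' : Plane → Plane ≃L[ℝ] Plane := fun z =>
    (fderiv ℝ (cdfMap ρ χ n) z).toContinuousLinearEquivOfDetNeZero (hdet z)
  have he' : ∀ z, (e' z : Plane →L[ℝ] Plane) = fderiv ℝ (cdfMap ρ χ n) z := fun z =>
    ContinuousLinearMap.coe_toContinuousLinearEquivOfDetNeZero _ _
  have hs : ∀ z, HasStrictFDerivAt (cdfMap ρ χ n) (e' z : Plane →L[ℝ] Plane) z := fun z => by
    rw [he']
    exact hF.hasStrictFDerivAt one_ne_zero
  have hopen : IsOpenMap (cdfMap ρ χ n) :=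
    IsOpenMap.of_nhds_le fun z => (hs z).map_nhds_eq_of_equiv.ge
  let eq : Plane ≃ Plane :=
    { toFun := cdfMap ρ χ n
      invFun := transport ρ χ n
      left_inv := transport_cdfMap hn hρ.continuous hpos hχ
      right_inv := cdfMap_transport hn hρ.continuous hpos hχ }
  exact ⟨eq.toHomeomorphOfContinuousOpen hF.continuous hopen, rfl, rfl, e',
    fun z => (hs z).hasFDerivAt⟩

theorem contDiff_transport (hn : 1 ≤ n) (hρ : ContDiff ℝ 1 ρ) (hpos : ∀ z, 0 < ρ z)
    (hχ : IsCutoff n χ) : ContDiff ℝ 1 (transport ρ χ n) := by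
  obtain ⟨e, he, hes, e', h⟩ := exists_cdf_homeomorph hn hρ hpos hχ
  rw [← hes]
  exact e.contDiff_symm (f₀' := e') (by simpa only [he] using h)
    (he ▸ contDiff_cdfMap (K := 1) hn hρ hpos hχ)

theorem fderiv_transport_fderiv_cdfMap (hn : 1 ≤ n) (hρ : ContDiff ℝ 1 ρ) (hpos : ∀ z, 0 < ρ z)
    (hχ : IsCutoff n χ) (z v : Plane) :
    fderiv ℝ (transport ρ χ n) (cdfMap ρ χ n z) (fderiv ℝ (cdfMap ρ χ n) z v) = v := by
  have h1 := (contDiff_cdfMap (K := 1) hn hρ hpos hχ).differentiable one_ne_zero z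
  have h2 := (contDiff_transport hn hρ hpos hχ).differentiable one_ne_zero (cdfMap ρ χ n z)
  have h3 := (h2.hasFDerivAt.comp z h1.hasFDerivAt).fderiv
  have h4 : transport ρ χ n ∘ cdfMap ρ χ n = id :=
    funext (transport_cdfMap hn hρ.continuous hpos hχ)
  rw [h4, fderiv_id] at h3
  exact (congrArg (fun D => D v) h3).symm

end Construction

/-! ### The flow: regularity, support, divergence and pushforward -/

theorem contDiff_pderiv {k : ℕ∞} {ψ : Plane → ℝ} (hψ : ContDiff ℝ (k + 1) ψ) (i : Fin 2) :
    ContDiff ℝ k (pderiv i ψ) :=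
  (hψ.fderiv_right (m := k) le_rfl).clm_apply contDiff_const

theorem contDiff_perpGrad {k : ℕ∞} {ψ : Plane → ℝ} (hψ : ContDiff ℝ (k + 1) ψ) :
    ContDiff ℝ k (perpGrad ψ) :=
  contDiff_mk (contDiff_pderiv hψ 1).neg (contDiff_pderiv hψ 0)

theorem contDiff_cellStream {k : WithTop ℕ∞} (m : ℕ) : ContDiff ℝ k (cellStream m) :=
  (Real.contDiff_sin.comp (contDiff_const.mul (contDiff_coord 0))).mul
    (Real.contDiff_cos.comp (contDiff_const.mul (contDiff_coord 1)))

theorem pderiv_comm {ψ : Plane → ℝ} (hψ : ContDiff ℝ 2 ψ) (z : Plane) (i j : Fin 2) :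
    pderiv i (pderiv j ψ) z = pderiv j (pderiv i ψ) z := by
  have hd : DifferentiableAt ℝ (fderiv ℝ ψ) z :=
    (hψ.fderiv_right (m := 1) (by norm_num)).differentiable one_ne_zero z
  have hs := (hψ.contDiffAt (x := z)).isSymmSndFDerivAt (by simp)
  have e1 : ∀ v w : Plane, fderiv ℝ (fun z => fderiv ℝ ψ z v) z w = fderiv ℝ (fderiv ℝ ψ) z w v := by
    intro v w
    rw [fderiv_clm_apply hd (by fun_prop)]
    simp
  have := hs (EuclideanSpace.single i 1) (EuclideanSpace.single j 1)
  rw [← e1, ← e1] at this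
  exact this

theorem divergence_const_smul_perpGrad {ψ : Plane → ℝ} (hψ : ContDiff ℝ 2 ψ) (c : ℝ) (z : Plane) :
    divergence (fun w => c • perpGrad ψ w) z = 0 := by
  have hd : ∀ i, DifferentiableAt ℝ (pderiv i ψ) z := fun i =>
    (contDiff_pderiv (k := 1) (by norm_num; exact hψ) i).differentiable one_ne_zero z
  have h0 : pderiv 0 (fun w => (c • perpGrad ψ w) 0) z = -(c * pderiv 0 (pderiv 1 ψ) z) := by
    have : (fun w => (c • perpGrad ψ w) 0) = fun w => (-c) * pderiv 1 ψ w := by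
      funext w; simp [perpGrad]
    rw [this, pderiv, fderiv_const_mul (hd 1)]
    simp [pderiv]
  have h1 : pderiv 1 (fun w => (c • perpGrad ψ w) 1) z = c * pderiv 1 (pderiv 0 ψ) z := by
    have : (fun w => (c • perpGrad ψ w) 1) = fun w => c * pderiv 0 ψ w := by
      funext w; simp [perpGrad]
    rw [this, pderiv, fderiv_const_mul (hd 0)]
    simp [pderiv]
  rw [divergence, Fin.sum_univ_two, h0, h1, pderiv_comm hψ]
  ring

section Construction

variable {ρ χ : Plane → ℝ} {n : ℕ}

theorem transplantedStream_eq (hn : 1 ≤ n) (hρ : Continuous ρ) (hpos : ∀ z, 0 < ρ z)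
    (hχ : IsCutoff n χ) (m : ℕ) :
    transplantedStream ρ χ n m = fun z => cellStream m (cdfMap ρ χ n z) := by
  funext z
  rw [transplantedStream, invFun_transport hn hρ hpos hχ]

theorem contDiff_cutStream {K : ℕ∞} (hn : 1 ≤ n) (hρ : ContDiff ℝ K ρ) (hpos : ∀ z, 0 < ρ z)
    (hχ : IsCutoff n χ) (m : ℕ) :
    ContDiff ℝ K (fun w => χ w * transplantedStream ρ χ n m w) := by
  rw [transplantedStream_eq hn hρ.continuous hpos hχ]
  exact (hχ.smooth.of_le (by exact_mod_cast le_top)).mul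
    ((contDiff_cellStream m).comp (contDiff_cdfMap hn hρ hpos hχ))

/-- The cut stream function is as smooth as the density, and the rotated gradient costs one
derivative. -/
theorem contDiff_planeFlow {k : ℕ∞} (hn : 1 ≤ n) (hρ : ContDiff ℝ (k + 1) ρ) (hpos : ∀ z, 0 < ρ z)
    (hχ : IsCutoff n χ) (m : ℕ) : ContDiff ℝ k (planeFlow ρ χ n m) := by
  have hρ' : ContDiff ℝ ((k + 1 : ℕ∞) : WithTop ℕ∞) ρ := by exact_mod_cast hρ
  have h1 : ContDiff ℝ k (fun z => normConst ρ χ n / ρ z) :=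
    contDiff_const.div (hρ.of_le le_self_add) fun z => (hpos z).ne'
  have h2 : ContDiff ℝ k (perpGrad fun w => χ w * transplantedStream ρ χ n m w) :=
    contDiff_perpGrad (by exact_mod_cast contDiff_cutStream hn hρ' hpos hχ m)
  exact h1.smul h2

theorem divergence_planeFlow (hn : 1 ≤ n) (hρ : ContDiff ℝ 2 ρ) (hpos : ∀ z, 0 < ρ z)
    (hχ : IsCutoff n χ) (m : ℕ) (z : Plane) :
    divergence (fun w => ρ w • planeFlow ρ χ n m w) z = 0 := by
  have h : (fun w => ρ w • planeFlow ρ χ n m w) = fun w =>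
      normConst ρ χ n • perpGrad (fun w => χ w * transplantedStream ρ χ n m w) w := by
    funext w
    rw [planeFlow, smul_smul, mul_div_cancel₀ _ (hpos w).ne']
  rw [h]
  exact divergence_const_smul_perpGrad
    (contDiff_cutStream (K := 2) hn hρ hpos hχ m) _ z

theorem tsupport_planeFlow_subset (hχ : IsCutoff n χ) (m : ℕ) :
    tsupport (planeFlow ρ χ n m) ⊆ closedBall 0 (7 * n / 4) := by
  refine closure_minimal (fun z hz => ?_) isClosed_closedBall
  by_contra hz'
  refine hz ?_
  have h0 : (fun w => χ w * transplantedStream ρ χ n m w) =ᶠ[𝓝 z] fun _ => 0 := by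
    filter_upwards [isClosed_closedBall.isOpen_compl.mem_nhds hz'] with w hw
    rw [hχ.eq_zero w fun h => hw (ball_subset_closedBall h), zero_mul]
  have h1 : perpGrad (fun w => χ w * transplantedStream ρ χ n m w) z = 0 := by
    ext i
    fin_cases i <;> simp [perpGrad, pderiv, h0.fderiv_eq]
  rw [planeFlow, h1, smul_zero]

/-- With D the derivative of `cdfMap` and J the rotation by a right angle, D J Dᵀ = (det D) J in the
plane. The stream function is Ψ∘`cdfMap` near z, so applying D to its rotated gradient gives det D
times the rotated gradient of Ψ. On this ball the determinant is ρ divided by `normConst`, the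
inverse of the prefactor of the flow. -/
theorem planeFlow_eq_pushforward (hn : 1 ≤ n) (hρ : ContDiff ℝ 1 ρ) (hpos : ∀ z, 0 < ρ z)
    (hχ : IsCutoff n χ) (m : ℕ) {z : Plane} (hz : z ∈ ball (0 : Plane) (3 * n / 2)) :
    planeFlow ρ χ n m z = fderiv ℝ (transport ρ χ n) (cdfMap ρ χ n z)
      (cellFlow m (cdfMap ρ χ n z)) := by
  suffices h : fderiv ℝ (cdfMap ρ χ n) z (planeFlow ρ χ n m z) = cellFlow m (cdfMap ρ χ n z) by
    rw [← h, fderiv_transport_fderiv_cdfMap hn hρ hpos hχ]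
  have hF := (contDiff_cdfMap (K := 1) hn hρ hpos hχ).differentiable one_ne_zero z
  have hev : (fun w => χ w * transplantedStream ρ χ n m w) =ᶠ[𝓝 z]
      fun w => cellStream m (cdfMap ρ χ n w) := by
    filter_upwards [isOpen_ball.mem_nhds hz] with w hw
    rw [hχ.eq_one w hw, one_mul, transplantedStream_eq hn hρ.continuous hpos hχ]
  set w := cdfMap ρ χ n z with hw
  have hchain : ∀ i, pderiv i (fun w => χ w * transplantedStream ρ χ n m w) z =
      fderiv ℝ (cellStream m) w (fderiv ℝ (cdfMap ρ χ n) z (EuclideanSpace.single i 1)) := by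
    intro i
    rw [pderiv, hev.fderiv_eq]
    have h1 := ((contDiff_cellStream (k := 1) m).differentiable one_ne_zero w).hasFDerivAt
    exact congrArg (fun D => D (EuclideanSpace.single i 1)) (h1.comp z hF.hasFDerivAt).fderiv
  set D := fderiv ℝ (cdfMap ρ χ n) z with hD
  have a0 : D (EuclideanSpace.single 0 1) 0 = marginal ρ χ n (z 0) := by
    rw [hD, fderiv_cdfMap_zero hn hρ hpos hχ]; simp
  have a1 : D (EuclideanSpace.single 1 1) 0 = 0 := by
    rw [hD, fderiv_cdfMap_zero hn hρ hpos hχ]; simp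
  have a2 : D (EuclideanSpace.single 1 1) 1 =
      (marginal ρ χ n (z 0))⁻¹ * ((normConst ρ χ n)⁻¹ * ρ z) := by
    rw [hD, fderiv_cdfMap_one hn hρ hpos hχ, torusDensity_of_mem_ball hn hχ hz]
  have hm := (marginal_pos hn hρ.continuous hpos hχ (z 0)).ne'
  have hM := (normConst_pos hn hρ.continuous hpos hχ).ne'
  have hr := (hpos z).ne'
  have lin : ∀ (T : Plane →L[ℝ] ℝ) (v : Plane), T v =
      v 0 * T (EuclideanSpace.single 0 1) + v 1 * T (EuclideanSpace.single 1 1) := by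
    intro T v
    conv_lhs => rw [plane_eq_sum v]
    simp
  have linD : ∀ v : Plane, D v =
      v 0 • D (EuclideanSpace.single 0 1) + v 1 • D (EuclideanSpace.single 1 1) := by
    intro v
    conv_lhs => rw [plane_eq_sum v]
    simp
  have v0 : planeFlow ρ χ n m z 0 = -(normConst ρ χ n / ρ z) *
      (D (EuclideanSpace.single 1 1) 1 * pderiv 1 (cellStream m) w) := by
    rw [planeFlow]
    simp only [perpGrad, hchain, PiLp.smul_apply, smul_eq_mul]
    rw [lin _ (D (EuclideanSpace.single 1 1)), a1]
    simp [pderiv]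
  have v1 : planeFlow ρ χ n m z 1 = (normConst ρ χ n / ρ z) *
      (D (EuclideanSpace.single 0 1) 0 * pderiv 0 (cellStream m) w
        + D (EuclideanSpace.single 0 1) 1 * pderiv 1 (cellStream m) w) := by
    rw [planeFlow]
    simp only [perpGrad, hchain, PiLp.smul_apply, smul_eq_mul]
    rw [lin _ (D (EuclideanSpace.single 0 1))]
    simp [pderiv]
  rw [linD, v0, v1]
  ext i
  fin_cases i
  · simp only [Fin.zero_eta, PiLp.add_apply, PiLp.smul_apply, smul_eq_mul, a0, a1, a2, cellFlow,
      perpGrad]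
    simp
    field_simp
  · simp only [Fin.mk_one, PiLp.add_apply, PiLp.smul_apply, smul_eq_mul, a0, a2, cellFlow,
      perpGrad]
    simp
    field_simp
    ring

/-! ### The cells -/

theorem exists_mem_cell {m : ℕ} (hm : 1 ≤ m) (z : Plane) : ∃ i j : ℤ, z ∈ cell m i j := by
  have hm' : (0 : ℝ) < m := by positivity
  refine ⟨⌊z 0 * (2 * m)⌋, ⌊z 1 * (2 * m) + 1 / 2⌋, ⟨?_, ?_⟩, ⟨?_, ?_⟩⟩
  · rw [div_le_iff₀ (by positivity)]
    exact Int.floor_le _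
  · rw [le_div_iff₀ (by positivity)]
    exact (Int.lt_floor_add_one _).le
  · rw [div_le_iff₀ (by positivity)]
    linarith [Int.floor_le (z 1 * (2 * m) + 1 / 2)]
  · rw [le_div_iff₀ (by positivity)]
    linarith [Int.lt_floor_add_one (z 1 * (2 * m) + 1 / 2)]

theorem dist_le_of_mem_cell {m : ℕ} (hm : 1 ≤ m) {i j : ℤ} {z w : Plane} (hz : z ∈ cell m i j)
    (hw : w ∈ cell m i j) : dist z w ≤ 1 / m := by
  have hm' : (0 : ℝ) < m := by positivity
  obtain ⟨⟨a1, a2⟩, a3, a4⟩ := hz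
  obtain ⟨⟨b1, b2⟩, b3, b4⟩ := hw
  have e1 : ((i : ℝ) + 1) / (2 * m) = i / (2 * m) + 1 / m / 2 := by field_simp
  have e2 : (2 * (j : ℝ) + 1) / (4 * m) = (2 * j - 1) / (4 * m) + 1 / m / 2 := by field_simp; ring
  have h0 : |z 0 - w 0| ≤ 1 / m / 2 := by rw [abs_le]; constructor <;> linarith
  have h1 : |z 1 - w 1| ≤ 1 / m / 2 := by rw [abs_le]; constructor <;> linarith
  rw [EuclideanSpace.dist_eq, Fin.sum_univ_two, Real.dist_eq, Real.dist_eq]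
  refine Real.sqrt_le_iff.2 ⟨by positivity, ?_⟩
  have := pow_le_pow_left₀ (abs_nonneg _) h0 2
  have := pow_le_pow_left₀ (abs_nonneg _) h1 2
  nlinarith [sq_nonneg (1 / (m : ℝ))]

/-- In the coordinates of the unit torus, the closed ball of radius n is a compact subset of the
open set that is mapped into the larger ball. It has a δ-neighbourhood inside that set, and a cell
of diameter less than δ meeting the compact set stays in it. -/
theorem exists_threshold (hn : 1 ≤ n) (hρ : ContDiff ℝ 1 ρ) (hpos : ∀ z, 0 < ρ z)
    (hχ : IsCutoff n χ) :
    ∃ m₀ : ℕ, ∀ m, m₀ ≤ m → ball (0 : Plane) n ⊆ cellRegion ρ χ n m := by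
  have hn' : (0 : ℝ) < n := by positivity
  have hF := (contDiff_cdfMap (K := 1) hn hρ hpos hχ).continuous
  have hZ := (contDiff_transport hn hρ hpos hχ).continuous
  obtain ⟨δ, hδ, hsub⟩ := ((isCompact_closedBall (0 : Plane) n).image hF
    ).exists_thickening_subset_open (isOpen_ball.preimage hZ) (t := transport ρ χ n ⁻¹' ball 0 (3 * n / 2))
    (by
      rintro _ ⟨z, hz, rfl⟩
      rw [Set.mem_preimage, transport_cdfMap hn hρ.continuous hpos hχ]
      exact closedBall_subset_ball (by linarith) hz)
  obtain ⟨N, hN⟩ := exists_nat_gt (1 / δ)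
  refine ⟨max N 1, fun m hm z hz => ?_⟩
  have hm1 : 1 ≤ m := (le_max_right _ _).trans hm
  have hm' : (0 : ℝ) < m := by positivity
  have hNm : (N : ℝ) ≤ m := by exact_mod_cast (le_max_left _ _).trans hm
  have hsmall : 1 / (m : ℝ) < δ := by
    rw [div_lt_iff₀ hm']
    rw [div_lt_iff₀ hδ] at hN
    nlinarith
  obtain ⟨i, j, hc⟩ := exists_mem_cell hm1 (cdfMap ρ χ n z)
  simp only [cellRegion, Set.mem_iUnion]
  refine ⟨i, j, ?_, ⟨_, hc, transport_cdfMap hn hρ.continuous hpos hχ z⟩⟩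
  rintro _ ⟨w, hw, rfl⟩
  refine hsub (mem_thickening_iff.2 ⟨cdfMap ρ χ n z, ⟨z, ball_subset_closedBall hz, rfl⟩, ?_⟩)
  exact (dist_le_of_mem_cell hm1 hw hc).trans_lt hsmall

end Construction

/-! ### Mollification in `L²` -/

/-- The convolution of `f` with a normalized bump function. -/
def mollify (φ : ContDiffBump (0 : Plane)) (f : Plane → ℝ) : Plane → ℝ :=
  convolution (φ.normed volume) f (ContinuousLinearMap.lsmul ℝ ℝ) volume

theorem mollify_apply (φ : ContDiffBump (0 : Plane)) (f : Plane → ℝ) (x : Plane) :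
    mollify φ f x = ∫ t, φ.normed volume t * f (x - t) := by
  simp [mollify, convolution_def]

theorem mollify_sub (φ : ContDiffBump (0 : Plane)) {f g : Plane → ℝ}
    (hf : LocallyIntegrable f volume) (hg : LocallyIntegrable g volume) :
    mollify φ (f - g) = mollify φ f - mollify φ g := by
  have hex : ∀ w : Plane → ℝ, LocallyIntegrable w volume →
      ConvolutionExists (φ.normed volume) w (ContinuousLinearMap.lsmul ℝ ℝ) volume := fun w hw =>
    φ.hasCompactSupport_normed.convolutionExists_left _ (φ.contDiff_normed (n := 0)).continuous hw
  funext x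
  have h1 := hex f hf x
  have h2 := hex g hg x
  simp only [ConvolutionExistsAt, ContinuousLinearMap.lsmul_apply, smul_eq_mul] at h1 h2
  simp only [Pi.sub_apply, mollify_apply, mul_sub]
  exact integral_sub h1 h2

/-- Jensen's inequality for the square, here Hölder against the constant 1, followed by Tonelli and
translation invariance. -/
theorem lintegral_convolution_sq_le {ν : Measure Plane} [IsProbabilityMeasure ν]
    {g : Plane → ℝ≥0∞} (hg : Measurable g) :
    ∫⁻ x, (∫⁻ t, g (x - t) ∂ν) ^ (2 : ℝ) ≤ ∫⁻ x, g x ^ (2 : ℝ) := by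
  have hm : Measurable fun z : Plane × Plane => g (z.1 - z.2) :=
    hg.comp (measurable_fst.sub measurable_snd)
  calc ∫⁻ x, (∫⁻ t, g (x - t) ∂ν) ^ (2 : ℝ) ≤ ∫⁻ x, ∫⁻ t, g (x - t) ^ (2 : ℝ) ∂ν := by
        refine lintegral_mono fun x => ?_
        have h := ENNReal.lintegral_mul_le_Lp_mul_Lq ν Real.HolderConjugate.two_two
          (f := fun t => g (x - t)) (g := fun _ => 1)
          (hg.comp (measurable_const.sub measurable_id)).aemeasurable aemeasurable_const
        simp only [Pi.mul_apply, mul_one, ENNReal.one_rpow, lintegral_const, measure_univ] at h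
        calc (∫⁻ t, g (x - t) ∂ν) ^ (2 : ℝ)
            ≤ ((∫⁻ t, g (x - t) ^ (2 : ℝ) ∂ν) ^ (1 / 2 : ℝ)) ^ (2 : ℝ) :=
              ENNReal.rpow_le_rpow h (by norm_num)
          _ = _ := by rw [← ENNReal.rpow_mul]; norm_num
    _ = ∫⁻ t, (∫⁻ x, g (x - t) ^ (2 : ℝ)) ∂ν :=
        lintegral_lintegral_swap (hm.pow_const 2).aemeasurable
    _ = ∫⁻ x, g x ^ (2 : ℝ) := by
        simp_rw [lintegral_sub_right_eq_self (fun x => g x ^ (2 : ℝ))]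
        simp

theorem eLpNorm_mollify_le (φ : ContDiffBump (0 : Plane)) {f : Plane → ℝ}
    (hf : AEStronglyMeasurable f volume) :
    eLpNorm (mollify φ f) 2 volume ≤ eLpNorm f 2 volume := by
  -- Convolution does not see null sets, so f may be taken Borel measurable, as Tonelli requires.
  have e1 : mollify φ f = mollify φ (hf.mk f) :=
    convolution_congr _ EventuallyEq.rfl hf.ae_eq_mk
  rw [e1, eLpNorm_congr_ae hf.ae_eq_mk]
  set f' := hf.mk f
  have hf' : Measurable f' := hf.stronglyMeasurable_mk.measurable
  have hφm : Measurable fun t => ENNReal.ofReal (φ.normed volume t) :=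
    ((φ.contDiff_normed (μ := volume) (n := 0)).continuous.measurable).ennreal_ofReal
  have hprob : IsProbabilityMeasure
      (volume.withDensity fun t => ENNReal.ofReal (φ.normed volume t)) := by
    refine ⟨?_⟩
    rw [withDensity_apply _ MeasurableSet.univ, Measure.restrict_univ,
      ← ofReal_integral_eq_lintegral_ofReal φ.integrable_normed
        (ae_of_all _ fun x => φ.nonneg_normed x), φ.integral_normed, ENNReal.ofReal_one]
  rw [eLpNorm_eq_lintegral_rpow_enorm_toReal two_ne_zero ENNReal.ofNat_ne_top,
    eLpNorm_eq_lintegral_rpow_enorm_toReal two_ne_zero ENNReal.ofNat_ne_top]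
  refine ENNReal.rpow_le_rpow ?_ (by simp)
  simp only [ENNReal.toReal_ofNat]
  refine le_trans (lintegral_mono fun x => ENNReal.rpow_le_rpow ?_ (by norm_num))
    (lintegral_convolution_sq_le
      (ν := volume.withDensity fun t => ENNReal.ofReal (φ.normed volume t)) hf'.enorm)
  have hfx : Measurable fun t => ‖f' (x - t)‖ₑ := (hf'.comp (measurable_id.const_sub x)).enorm
  rw [mollify_apply, lintegral_withDensity_eq_lintegral_mul _ hφm hfx]
  refine (enorm_integral_le_lintegral_enorm _).trans_eq (lintegral_congr fun t => ?_)
  simp only [Pi.mul_apply, enorm_mul]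
  rw [Real.enorm_of_nonneg (φ.nonneg_normed t)]

/-- A sequence of bump functions with supports shrinking to the origin. -/
def shrinkingBump (k : ℕ) : ContDiffBump (0 : Plane) where
  rIn := 1 / (2 * (k + 1))
  rOut := 1 / (k + 1)
  rIn_pos := by positivity
  rIn_lt_rOut := by
    apply one_div_lt_one_div_of_lt
    · positivity
    · linarith [(Nat.cast_nonneg k : (0 : ℝ) ≤ k)]

theorem shrinkingBump_rOut_le_one (k : ℕ) : (shrinkingBump k).rOut ≤ 1 := by
  change 1 / ((k : ℝ) + 1) ≤ 1
  rw [div_le_one (by positivity)]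
  linarith [(Nat.cast_nonneg k : (0 : ℝ) ≤ k)]

theorem tendsto_shrinkingBump : Tendsto (fun k => (shrinkingBump k).rOut) atTop (𝓝 0) :=
  tendsto_one_div_add_atTop_nhds_zero_nat

theorem mollify_congr_ball {φ : ContDiffBump (0 : Plane)} {f g : Plane → ℝ} {x : Plane}
    (h : ∀ y ∈ ball x φ.rOut, f y = g y) : mollify φ f x = mollify φ g x := by
  rw [mollify_apply, mollify_apply]
  refine integral_congr_ae (ae_of_all _ fun t => ?_)
  by_cases ht : t ∈ Function.support (φ.normed volume)
  · rw [φ.support_normed_eq, mem_ball_zero_iff] at ht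
    have : x - t ∈ ball x φ.rOut := by simpa [mem_ball, dist_eq_norm] using ht
    simp only [h _ this]
  · rw [Function.notMem_support] at ht
    simp [ht]

/-- Uniform continuity gives uniform convergence, and all supports lie in one ball because the bump
radii are at most 1. -/
theorem tendsto_mollify_of_continuous {g : Plane → ℝ} (hg : Continuous g)
    (hc : HasCompactSupport g) :
    Tendsto (fun k => eLpNorm (mollify (shrinkingBump k) g - g) 2 volume) atTop (𝓝 0) := by
  obtain ⟨R, hR⟩ := hc.isCompact.isBounded.subset_ball (0 : Plane)
  have hsupp : ∀ k, Function.support (mollify (shrinkingBump k) g - g) ⊆ ball 0 (R + 1) := by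
    intro k x hx
    by_contra hx'
    refine hx ?_
    have hzero : ∀ y ∈ ball x (shrinkingBump k).rOut, g y = 0 := by
      intro y hy
      refine image_eq_zero_of_notMem_tsupport fun hy' => hx' ?_
      have h1 := mem_ball_zero_iff.1 (hR hy')
      have h2 : dist y x < 1 := (mem_ball.1 hy).trans_le (shrinkingBump_rOut_le_one k)
      rw [mem_ball_zero_iff]
      have := norm_sub_norm_le x y
      rw [dist_comm, dist_eq_norm] at h2
      linarith
    have h0 := mollify_congr_ball (φ := shrinkingBump k) (f := g) (g := fun _ => 0) hzero
    simp only [mollify_apply, mul_zero, integral_zero] at h0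
    simp [mollify_apply, h0, hzero x (mem_ball_self (shrinkingBump k).rOut_pos)]
  set V : ℝ≥0∞ := volume (ball (0 : Plane) (R + 1)) ^ (2 : ℝ≥0∞).toReal⁻¹
  have hV : V ≠ ⊤ := ENNReal.rpow_ne_top_of_nonneg (by simp) measure_ball_lt_top.ne
  have huc := hc.uniformContinuous_of_continuous hg
  refine ENNReal.tendsto_nhds_zero.2 fun ε hε => ?_
  obtain ⟨η, hη, hηε⟩ : ∃ η : ℝ, 0 < η ∧ V * ENNReal.ofReal η ≤ ε := by
    have ht : Tendsto (fun η : ℝ => V * ENNReal.ofReal η) (𝓝[>] 0) (𝓝 0) := by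
      have h1 : Tendsto (fun η : ℝ => ENNReal.ofReal η) (𝓝[>] 0) (𝓝 0) := by
        simpa using (ENNReal.continuous_ofReal.tendsto 0).mono_left nhdsWithin_le_nhds
      simpa using ENNReal.Tendsto.const_mul h1 (Or.inr hV)
    obtain ⟨η, h1, h2⟩ := ((ENNReal.tendsto_nhds_zero.1 ht ε hε).and self_mem_nhdsWithin).exists
    exact ⟨η, h2, h1⟩
  obtain ⟨δ, hδ, hδη⟩ := Metric.uniformContinuous_iff.1 huc η hη
  filter_upwards [(tendsto_order.1 tendsto_shrinkingBump).2 δ hδ] with k hk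
  rw [← eLpNorm_restrict_eq_of_support_subset (hsupp k)]
  refine (eLpNorm_le_of_ae_bound (C := η) (ae_of_all _ fun x => ?_)).trans ?_
  · have := (shrinkingBump k).dist_normed_convolution_le (μ := volume) (x₀ := x) (ε := η)
      hg.aestronglyMeasurable fun y hy => (hδη ((mem_ball.1 hy).trans hk)).le
    rw [dist_eq_norm] at this
    exact this
  · rwa [Measure.restrict_apply_univ]

/-- An ε/3 argument: continuous compactly supported functions are dense and mollification is an L²
contraction. -/
theorem tendsto_mollify {f : Plane → ℝ} (hf : MemLp f 2 volume) :
    Tendsto (fun k => eLpNorm (mollify (shrinkingBump k) f - f) 2 volume) atTop (𝓝 0) := by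
  refine ENNReal.tendsto_nhds_zero.2 fun ε hε => ?_
  have hε3 : ε / 3 ≠ 0 := (ENNReal.div_pos hε.ne' (by simp)).ne'
  obtain ⟨g, hgc, hfg, hg, hgL⟩ := hf.exists_hasCompactSupport_eLpNorm_sub_le (by simp) hε3
  filter_upwards [ENNReal.tendsto_nhds_zero.1 (tendsto_mollify_of_continuous hg hgc) (ε / 3)
    (pos_iff_ne_zero.2 hε3)] with k hk
  have hfl : LocallyIntegrable f volume := hf.locallyIntegrable (by norm_num)
  have hgl : LocallyIntegrable g volume := hg.locallyIntegrable
  have hmc : ∀ w : Plane → ℝ, LocallyIntegrable w volume →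
      AEStronglyMeasurable (mollify (shrinkingBump k) w) volume := fun w hw =>
    ((shrinkingBump k).hasCompactSupport_normed.continuous_convolution_left _
      ((shrinkingBump k).contDiff_normed (n := 0)).continuous hw).aestronglyMeasurable
  have e : mollify (shrinkingBump k) f - f = (mollify (shrinkingBump k) (f - g)
      + (mollify (shrinkingBump k) g - g)) - (f - g) := by
    rw [mollify_sub _ hfl hgl]; abel
  have m1 := hmc (f - g) (hfl.sub hgl)
  have m2 := (hmc g hgl).sub hg.aestronglyMeasurable
  rw [e]
  calc _ ≤ eLpNorm (mollify (shrinkingBump k) (f - g)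
          + (mollify (shrinkingBump k) g - g)) 2 volume + eLpNorm (f - g) 2 volume :=
        eLpNorm_sub_le (m1.add m2) (hf.1.sub hgL.1) (by norm_num)
    _ ≤ (eLpNorm (mollify (shrinkingBump k) (f - g)) 2 volume
          + eLpNorm (mollify (shrinkingBump k) g - g) 2 volume) + eLpNorm (f - g) 2 volume := by
        gcongr
        exact eLpNorm_add_le m1 m2 (by norm_num)
    _ ≤ (ε / 3 + ε / 3) + ε / 3 := by
        gcongr
        exact (eLpNorm_mollify_le _ (hf.1.sub hgL.1)).trans hfg
    _ = ε := ENNReal.add_thirds ε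

/-- On a ball of radius R the mollification sees only values on the ball of radius R + 1, so f can
be truncated there and the global statement applies. -/
theorem tendsto_mollify_local {f : Plane → ℝ} (hf : ∀ R, MemLp f 2 (volume.restrict (ball 0 R)))
    (R : ℝ) :
    Tendsto (fun k => eLpNorm (mollify (shrinkingBump k) f - f) 2 (volume.restrict (ball 0 R)))
      atTop (𝓝 0) := by
  set f' : Plane → ℝ := (ball (0 : Plane) (R + 1)).indicator f
  have hf' : MemLp f' 2 volume := (memLp_indicator_iff_restrict measurableSet_ball).2 (hf (R + 1))
  refine tendsto_of_tendsto_of_tendsto_of_le_of_le tendsto_const_nhds (tendsto_mollify hf')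
    (fun _ => zero_le) fun k => ?_
  have e : eLpNorm (mollify (shrinkingBump k) f - f) 2 (volume.restrict (ball 0 R)) =
      eLpNorm (mollify (shrinkingBump k) f' - f') 2 (volume.restrict (ball 0 R)) := by
    refine eLpNorm_congr_ae ?_
    filter_upwards [ae_restrict_mem measurableSet_ball] with x hx
    have hev : ∀ y ∈ ball x (shrinkingBump k).rOut, f y = f' y := by
      intro y hy
      refine (Set.indicator_of_mem ?_ f).symm
      have h2 : dist y x < 1 := (mem_ball.1 hy).trans_le (shrinkingBump_rOut_le_one k)
      rw [mem_ball_zero_iff] at hx ⊢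
      have := norm_sub_norm_le y x
      rw [dist_eq_norm] at h2
      linarith
    rw [Pi.sub_apply, Pi.sub_apply, mollify_congr_ball hev,
      hev x (mem_ball_self (shrinkingBump k).rOut_pos)]
  simp only [e]
  exact eLpNorm_mono_measure _ Measure.restrict_le_self

/-! ### Weak gradients -/

/-- `G` is the weak gradient of the real function `f`. -/
structure RealWeakGradient (f : Plane → ℝ) (G : Fin 2 → Plane → ℝ) : Prop where
  locallyIntegrable : LocallyIntegrable f volume
  locallyIntegrable_grad : ∀ i, LocallyIntegrable (G i) volume
  test : ∀ ψ : Plane → ℝ, ContDiff ℝ ∞ ψ → HasCompactSupport ψ → ∀ i : Fin 2,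
    ∫ z, f z * pderiv i ψ z = -∫ z, G i z * ψ z

theorem contDiff_mollify (φ : ContDiffBump (0 : Plane)) {f : Plane → ℝ}
    (hf : LocallyIntegrable f volume) : ContDiff ℝ ∞ (mollify φ f) :=
  (φ.hasCompactSupport_normed (μ := volume)).contDiff_convolution_left (n := ⊤) _
    φ.contDiff_normed hf

/-- Differentiate the kernel under the convolution and use s ↦ φ(x - s) as test function. The sign
in the definition of the weak gradient cancels that of the reflection. -/
theorem RealWeakGradient.pderiv_mollify {f : Plane → ℝ} {G : Fin 2 → Plane → ℝ}
    (h : RealWeakGradient f G) (φ : ContDiffBump (0 : Plane)) (i : Fin 2) :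
    pderiv i (mollify φ f) = mollify φ (G i) := by
  funext x
  have hd := (φ.hasCompactSupport_normed (μ := volume)).hasFDerivAt_convolution_left
    (ContinuousLinearMap.lsmul ℝ ℝ) (φ.contDiff_normed (n := 1)) h.locallyIntegrable x
  have hcf : HasCompactSupport (fderiv ℝ (φ.normed volume)) :=
    φ.hasCompactSupport_normed.fderiv ℝ
  have hcc : Continuous (fderiv ℝ (φ.normed volume)) :=
    (φ.contDiff_normed (n := 1)).continuous_fderiv one_ne_zero
  have h1 : pderiv i (mollify φ f) x =
      ∫ t, fderiv ℝ (φ.normed volume) t (EuclideanSpace.single i 1) * f (x - t) := by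
    have hex : Integrable _ volume := hcf.convolutionExists_left
      ((ContinuousLinearMap.lsmul ℝ ℝ).precompL Plane) hcc h.locallyIntegrable x
    rw [pderiv, mollify, hd.fderiv, convolution_def, ContinuousLinearMap.integral_apply hex]
    simp
  have e1 : ∫ t, fderiv ℝ (φ.normed volume) t (EuclideanSpace.single i 1) * f (x - t) =
      ∫ s, fderiv ℝ (φ.normed volume) (x - s) (EuclideanSpace.single i 1) * f s := by
    rw [← integral_sub_left_eq_self _ volume x]
    simp
  have e2 : mollify φ (G i) x = ∫ s, φ.normed volume (x - s) * G i s := by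
    rw [mollify_apply, ← integral_sub_left_eq_self _ volume x]
    simp
  set ψ : Plane → ℝ := fun s => φ.normed volume (x - s)
  have hψ : ContDiff ℝ ∞ ψ := (φ.contDiff_normed (n := ⊤)).comp (contDiff_const.sub contDiff_id)
  have hψc : HasCompactSupport ψ :=
    φ.hasCompactSupport_normed.comp_homeomorph (Homeomorph.subLeft x)
  have hψd : ∀ s, pderiv i ψ s = -fderiv ℝ (φ.normed volume) (x - s) (EuclideanSpace.single i 1) := by
    intro s
    have a1 : HasFDerivAt (φ.normed volume) _ (x - s) :=
      ((φ.contDiff_normed (n := 1)).differentiable one_ne_zero (x - s)).hasFDerivAt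
    have a2 : HasFDerivAt (fun s : Plane => x - s) (-ContinuousLinearMap.id ℝ Plane) s :=
      (hasFDerivAt_id s).const_sub x
    have a3 : fderiv ℝ ψ s = _ := (a1.comp s a2).fderiv
    rw [pderiv, a3]
    simp
  have ht := h.test ψ hψ hψc i
  simp only [hψd, mul_neg, integral_neg, neg_inj] at ht
  rw [h1, e1, e2]
  simpa only [mul_comm] using ht

theorem RealWeakGradient.exists_approx {f : Plane → ℝ} {G : Fin 2 → Plane → ℝ}
    (h : RealWeakGradient f G) (hf : ∀ R, MemLp f 2 (volume.restrict (ball 0 R)))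
    (hG : ∀ i R, MemLp (G i) 2 (volume.restrict (ball 0 R))) :
    ∃ u : ℕ → Plane → ℝ, (∀ k, ContDiff ℝ ∞ (u k)) ∧ ∀ R,
      Tendsto (fun k => eLpNorm (u k - f) 2 (volume.restrict (ball 0 R))) atTop (𝓝 0) ∧
      ∀ i, Tendsto (fun k => eLpNorm (pderiv i (u k) - G i) 2 (volume.restrict (ball 0 R)))
        atTop (𝓝 0) := by
  refine ⟨fun k => mollify (shrinkingBump k) f,
    fun k => contDiff_mollify _ h.locallyIntegrable, fun R => ⟨tendsto_mollify_local hf R, fun i => ?_⟩⟩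
  simp only [h.pderiv_mollify]
  exact tendsto_mollify_local (hG i) R

/-! ### The Gibbs density and the Lyapunov inequality -/

theorem partition_pos {U : Plane → ℝ} (hint : Integrable (fun z => Real.exp (-U z)) volume) :
    0 < ∫ z, Real.exp (-U z) := integral_exp_pos hint

theorem gibbsDensity_pos {U : Plane → ℝ} (hint : Integrable (fun z => Real.exp (-U z)) volume)
    (z : Plane) : 0 < gibbsDensity U z :=
  div_pos (Real.exp_pos _) (partition_pos hint)

theorem contDiff_gibbsDensity {U : Plane → ℝ} {k : WithTop ℕ∞} (hU : ContDiff ℝ k U) :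
    ContDiff ℝ k (gibbsDensity U) :=
  (Real.contDiff_exp.comp hU.neg).div_const _

theorem integral_gibbsDensity {U : Plane → ℝ}
    (hint : Integrable (fun z => Real.exp (-U z)) volume) : ∫ z, gibbsDensity U z = 1 := by
  simp only [gibbsDensity]
  rw [integral_div, div_self (partition_pos hint).ne']

theorem pderiv_gibbsDensity {U : Plane → ℝ} (hU : ContDiff ℝ 1 U) (i : Fin 2) (z : Plane) :
    pderiv i (gibbsDensity U) z = -(gibbsDensity U z * pderiv i U z) := by
  have h1 := ((hU.differentiable one_ne_zero z).hasFDerivAt.fun_neg.exp).mul_const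
    (∫ w, Real.exp (-U w))⁻¹
  have h2 : fderiv ℝ (gibbsDensity U) z = _ := h1.fderiv
  rw [pderiv, h2]
  simp [gibbsDensity, pderiv]
  ring

theorem pderiv_mul {u w : Plane → ℝ} {z : Plane} (hu : DifferentiableAt ℝ u z)
    (hw : DifferentiableAt ℝ w z) (i : Fin 2) :
    pderiv i (fun z => u z * w z) z = u z * pderiv i w z + w z * pderiv i u z := by
  rw [pderiv, fderiv_fun_mul hu hw]
  simp [pderiv]

theorem generator_eq {U W : Plane → ℝ} (hW : ContDiff ℝ 2 W) (z : Plane) :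
    generator U W z = ∑ i, (pderiv i (pderiv i W) z - pderiv i U z * pderiv i W z) := by
  have hd : DifferentiableAt ℝ (fderiv ℝ W) z :=
    (hW.fderiv_right (m := 1) (by norm_num)).differentiable one_ne_zero z
  have hlap : Laplacian.laplacian W z = ∑ i, pderiv i (pderiv i W) z := by
    rw [InnerProductSpace.laplacian_eq_iteratedFDeriv_orthonormalBasis W
      (EuclideanSpace.basisFun (Fin 2) ℝ)]
    refine Finset.sum_congr rfl fun i _ => ?_
    rw [iteratedFDeriv_two_apply]
    have : pderiv i (pderiv i W) z = fderiv ℝ (fun w => fderiv ℝ W w (EuclideanSpace.single i 1)) z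
      (EuclideanSpace.single i 1) := rfl
    rw [this, fderiv_clm_apply hd (by fun_prop)]
    simp
  have hgrad : ∀ i, gradient W z i = pderiv i W z := fun i => by
    have h1 : inner ℝ (gradient W z) (EuclideanSpace.single i (1 : ℝ)) = pderiv i W z :=
      inner_gradient_left
    rw [← h1, EuclideanSpace.inner_single_right]
    simp
  have hin : inner ℝ (gradient U z) (gradient W z) = ∑ i, pderiv i U z * pderiv i W z := by
    rw [inner_gradient_left, plane_eq_sum (gradient W z)]
    simp [Fin.sum_univ_two, hgrad, pderiv]
    ring
  rw [generator, hlap, hin, Finset.sum_sub_distrib]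
  ring

/-- Test the Lyapunov inequality with u²/W against the weight ρ. Since ρ·`generator U W` is the
divergence of ρ∇W, integration by parts turns the left side into -∫∇(u²/W)·∇W ρ, which is at least
-∫|∇u|²ρ by completing a square. -/
theorem lyapunov_smooth {U W u : Plane → ℝ} (hU : ContDiff ℝ 2 U)
    (hint : Integrable (fun z => Real.exp (-U z)) volume)
    (hW : ContDiff ℝ 2 W) (hW1 : ∀ z, 1 ≤ W z) {lam b r : ℝ} (hb : 0 ≤ b)
    (hL : ∀ z, generator U W z ≤
      -lam * W z + b * (ball (0 : Plane) r).indicator (fun _ => (1 : ℝ)) z)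
    (hu : ContDiff ℝ 1 u) (hc : HasCompactSupport u) :
    lam * ∫ z, u z ^ 2 * gibbsDensity U z ≤
      (∑ i, ∫ z, pderiv i u z ^ 2 * gibbsDensity U z)
        + b * ∫ z in ball 0 r, u z ^ 2 * gibbsDensity U z := by
  set ρ := gibbsDensity U with hρdef
  have hρ2 : ContDiff ℝ 2 ρ := contDiff_gibbsDensity hU
  have hρ1 : ContDiff ℝ 1 ρ := hρ2.of_le (by norm_num)
  have hρc := hρ1.continuous
  have hW1' : ContDiff ℝ 1 W := hW.of_le (by norm_num)
  have hWpos : ∀ z, 0 < W z := fun z => one_pos.trans_le (hW1 z)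
  have hρpos : ∀ z, 0 < ρ z := gibbsDensity_pos hint
  have hpu : ∀ i, Continuous (pderiv i u) := fun i =>
    (contDiff_pderiv (k := 0) (by simpa using hu) i).continuous
  have hpuc : ∀ i, HasCompactSupport (pderiv i u) := fun i => hc.fderiv_apply ℝ _
  have hpW : ∀ i, ContDiff ℝ 1 (pderiv i W) := fun i =>
    contDiff_pderiv (k := 1) (by norm_num; exact hW) i
  set A : Plane → ℝ := fun z => u z ^ 2 / W z with hA
  have hA1 : ContDiff ℝ 1 A := (hu.pow 2).div hW1' fun z => (hWpos z).ne'
  have hAc : HasCompactSupport A := by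
    refine hc.mono fun z hz hz' => hz ?_
    simp [hA, hz']
  set B : Fin 2 → Plane → ℝ := fun i z => ρ z * pderiv i W z with hB
  have hB1 : ∀ i, ContDiff ℝ 1 (B i) := fun i => hρ1.mul (hpW i)
  have hpA : ∀ i, Continuous (pderiv i A) := fun i =>
    (contDiff_pderiv (k := 0) (by simpa using hA1) i).continuous
  have hpAc : ∀ i, HasCompactSupport (pderiv i A) := fun i => hAc.fderiv_apply ℝ _
  have hpB : ∀ i, Continuous (pderiv i (B i)) := fun i =>
    (contDiff_pderiv (k := 0) (by simpa using hB1 i) i).continuous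
  have i1 : ∀ i, Integrable (fun z => pderiv i A z * B i z) volume := fun i =>
    ((hpA i).mul (hB1 i).continuous).integrable_of_hasCompactSupport (hpAc i).mul_right
  have i2 : ∀ i, Integrable (fun z => A z * pderiv i (B i) z) volume := fun i =>
    (hA1.continuous.mul (hpB i)).integrable_of_hasCompactSupport hAc.mul_right
  have ibp : ∀ i, ∫ z, A z * pderiv i (B i) z = -∫ z, pderiv i A z * B i z := fun i =>
    integral_mul_fderiv_eq_neg_fderiv_mul_of_integrable (i1 i) (i2 i)
      ((hA1.continuous.mul (hB1 i).continuous).integrable_of_hasCompactSupport hAc.mul_right)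
      (fun z _ => hA1.differentiable one_ne_zero z)
      (fun z _ => (hB1 i).differentiable one_ne_zero z)
  have hdivB : ∀ z, ∑ i, pderiv i (B i) z = ρ z * generator U W z := by
    intro z
    rw [generator_eq hW, Finset.mul_sum]
    refine Finset.sum_congr rfl fun i _ => ?_
    rw [hB, pderiv_mul (hρ1.differentiable one_ne_zero z)
      ((hpW i).differentiable one_ne_zero z),
      pderiv_gibbsDensity (hU.of_le (by norm_num))]
    ring
  have hdA : ∀ i z, pderiv i A z =
      2 * u z * pderiv i u z / W z - u z ^ 2 * pderiv i W z / W z ^ 2 := by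
    intro i z
    have hAW : (fun z => A z * W z) = fun z => u z * u z := by
      funext z
      simp only [hA]
      rw [div_mul_cancel₀ _ (hWpos z).ne', pow_two]
    have h1 := pderiv_mul (hA1.differentiable one_ne_zero z)
      (hW1'.differentiable one_ne_zero z) i
    rw [hAW, pderiv_mul (hu.differentiable one_ne_zero z) (hu.differentiable one_ne_zero z)] at h1
    have hne := (hWpos z).ne'
    have h2 : pderiv i A z = (2 * u z * pderiv i u z - A z * pderiv i W z) / W z := by
      rw [eq_div_iff hne]; linarith
    rw [h2]
    simp only [hA]
    field_simp
  have hlow : ∀ i, -∫ z, pderiv i u z ^ 2 * ρ z ≤ ∫ z, A z * pderiv i (B i) z := by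
    intro i
    rw [ibp i, neg_le_neg_iff]
    refine integral_mono (i1 i)
      (((hpu i).pow 2).mul hρc |>.integrable_of_hasCompactSupport ?_) fun z => ?_
    · refine (hpuc i).mono fun z hz hz' => hz ?_
      simp [hz']
    · simp only [hdA, hB]
      have hne := (hWpos z).ne'
      -- The square that is completed: (∂u)² - ∂(u²/W)·∂W = (∂u - u ∂W/W)².
      have e : pderiv i u z ^ 2 * ρ z - (2 * u z * pderiv i u z / W z
          - u z ^ 2 * pderiv i W z / W z ^ 2) * (ρ z * pderiv i W z)
          = ρ z * (pderiv i u z - u z * pderiv i W z / W z) ^ 2 := by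
        field_simp
        ring
      have := mul_nonneg (hρpos z).le (sq_nonneg (pderiv i u z - u z * pderiv i W z / W z))
      linarith
  have hsum : ∑ i, ∫ z, A z * pderiv i (B i) z = ∫ z, A z * (ρ z * generator U W z) := by
    rw [← integral_finsetSum _ fun i _ => i2 i]
    simp only [← Finset.mul_sum, hdivB]
  have iu : Integrable (fun z => u z ^ 2 * ρ z) volume :=
    ((hu.continuous.pow 2).mul hρc).integrable_of_hasCompactSupport
      (hc.mono fun z hz hz' => hz (by simp [hz']))
  have ig : Integrable (fun z => A z * (ρ z * generator U W z)) volume := by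
    have := integrable_finsetSum Finset.univ fun i _ => i2 i
    simpa only [← Finset.mul_sum, hdivB] using this
  have iB : Integrable (fun z => b * (ball (0 : Plane) r).indicator (fun z => u z ^ 2 * ρ z) z)
      volume := (iu.indicator measurableSet_ball).const_mul b
  have hup : ∫ z, A z * (ρ z * generator U W z) ≤
      ∫ z, (-lam * (u z ^ 2 * ρ z)
        + b * (ball (0 : Plane) r).indicator (fun z => u z ^ 2 * ρ z) z) := by
    refine integral_mono ig ((iu.const_mul _).add iB) fun z => ?_
    simp only [hA]
    have hne := (hWpos z).ne'
    have h0 : 0 ≤ u z ^ 2 / W z * ρ z :=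
      mul_nonneg (div_nonneg (sq_nonneg _) (hWpos z).le) (hρpos z).le
    have h1 := mul_le_mul_of_nonneg_left (hL z) h0
    have h2 : u z ^ 2 / W z * ρ z * (-lam * W z) = -lam * (u z ^ 2 * ρ z) := by field_simp
    have h3 : u z ^ 2 / W z * ρ z * (b * (ball (0 : Plane) r).indicator (fun _ => (1 : ℝ)) z) ≤
        b * (ball (0 : Plane) r).indicator (fun z => u z ^ 2 * ρ z) z := by
      by_cases hz : z ∈ ball (0 : Plane) r
      · simp only [Set.indicator_of_mem hz, mul_one]
        -- This is where the normalization W ≥ 1 enters: the ball term no longer contains W.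
        have : u z ^ 2 / W z ≤ u z ^ 2 := div_le_self (sq_nonneg _) (hW1 z)
        have := mul_le_mul_of_nonneg_right (mul_le_mul_of_nonneg_right this (hρpos z).le) hb
        linarith
      · simp [Set.indicator_of_notMem hz]
    linarith
  rw [integral_add (iu.const_mul _) iB, integral_const_mul, integral_const_mul,
    integral_indicator measurableSet_ball] at hup
  have := Finset.sum_le_sum fun i (_ : i ∈ Finset.univ) => hlow i
  rw [hsum, Finset.sum_neg_distrib] at this
  linarith

/-- The integral is the L² pairing on a ball of f with ηf, and multiplication by a bounded weight is
continuous in L². -/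
theorem tendsto_integral_weight_sq {u : ℕ → Plane → ℝ} {f η : Plane → ℝ} {R C : ℝ}
    (hu : ∀ k, Continuous (u k)) (hf : MemLp f 2 (volume.restrict (ball 0 R)))
    (huf : Tendsto (fun k => eLpNorm (u k - f) 2 (volume.restrict (ball 0 R))) atTop (𝓝 0))
    (hη : Measurable η) (hηC : ∀ z, |η z| ≤ C) (hη0 : ∀ z ∉ ball (0 : Plane) R, η z = 0) :
    Tendsto (fun k => ∫ z, u k z ^ 2 * η z) atTop (𝓝 (∫ z, f z ^ 2 * η z)) := by
  have e : ∀ w : Plane → ℝ, ∫ z, w z ^ 2 * η z = ∫ z in ball 0 R, w z * (η z * w z) := by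
    intro w
    rw [setIntegral_eq_integral_of_forall_compl_eq_zero fun z hz => by simp [hη0 z hz]]
    congr 1
    funext z
    ring
  have hmem : ∀ w : Plane → ℝ, MemLp w 2 (volume.restrict (ball 0 R)) →
      MemLp (fun z => η z * w z) 2 (volume.restrict (ball 0 R)) := by
    intro w hw
    refine hw.of_le_mul (c := C) (hη.aestronglyMeasurable.mul hw.1) (ae_of_all _ fun z => ?_)
    rw [norm_mul]
    exact mul_le_mul_of_nonneg_right (hηC z) (norm_nonneg _)
  have huL : ∀ k, MemLp (u k) 2 (volume.restrict (ball 0 R)) := fun k =>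
    (memLp_restrict_of_isCompact (hu k) (isCompact_closedBall 0 R) 2).mono_measure
      (Measure.restrict_mono ball_subset_closedBall le_rfl)
  simp only [e]
  refine tendsto_integral_mul_of_L2 huL (fun k => hmem _ (huL k)) hf (hmem f hf) huf ?_
  have ht : Tendsto (fun k => ENNReal.ofReal C *
      eLpNorm (u k - f) 2 (volume.restrict (ball 0 R))) atTop (𝓝 0) := by
    simpa using ENNReal.Tendsto.const_mul huf (Or.inr ENNReal.ofReal_ne_top)
  refine tendsto_of_tendsto_of_tendsto_of_le_of_le tendsto_const_nhds ht (fun _ => zero_le)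
    fun k => ?_
  refine eLpNorm_le_mul_eLpNorm_of_ae_le_mul (ae_of_all _ fun z => ?_) 2
  simp only [Pi.sub_apply, ← mul_sub, norm_mul]
  exact mul_le_mul_of_nonneg_right (hηC z) (norm_nonneg _)

/-- A sequence of cutoff functions exhausting the plane. -/
theorem exists_exhausting_cutoffs : ∃ (ζ : ℕ → Plane → ℝ) (C : ℝ),
    (∀ j, ContDiff ℝ ∞ (ζ j)) ∧ (∀ j, ∃ R, ∀ z ∉ ball (0 : Plane) R, ζ j z = 0) ∧
    (∀ j z, 0 ≤ ζ j z ∧ ζ j z ≤ 1) ∧ (∀ j i z, |pderiv i (ζ j) z| ≤ C) ∧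
    (∀ z, ∀ᶠ j in atTop, ζ j z = 1) ∧ ∀ i z, ∀ᶠ j in atTop, pderiv i (ζ j) z = 0 := by
  let β : ContDiffBump (0 : Plane) := ⟨1, 2, one_pos, one_lt_two⟩
  obtain ⟨C, hC⟩ := (β.hasCompactSupport.fderiv ℝ).exists_bound_of_continuous
    ((β.contDiff (n := 1)).continuous_fderiv one_ne_zero)
  let ζ : ℕ → Plane → ℝ := fun j z => β (((j : ℝ) + 1)⁻¹ • z)
  have hone : ∀ z, ∀ᶠ j : ℕ in atTop, z ∈ ball (0 : Plane) (j + 1) := by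
    intro z
    obtain ⟨N, hN⟩ := exists_nat_gt ‖z‖
    filter_upwards [eventually_ge_atTop N] with j hj
    rw [mem_ball_zero_iff]
    have : (N : ℝ) ≤ j := by exact_mod_cast hj
    linarith
  have hζ1 : ∀ (j : ℕ), ∀ z ∈ ball (0 : Plane) (j + 1), ζ j z = 1 := by
    intro j z hz
    refine β.one_of_mem_closedBall ?_
    rw [mem_closedBall_zero_iff, norm_smul, norm_inv, Real.norm_of_nonneg (by positivity),
      inv_mul_le_iff₀ (by positivity)]
    rw [mem_ball_zero_iff] at hz
    change ‖z‖ ≤ (j + 1) * 1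
    linarith
  refine ⟨ζ, C, fun j => ?_, fun j => ⟨2 * (j + 1), fun z hz => ?_⟩, fun j z => ⟨?_, ?_⟩,
    fun j i z => ?_, fun z => ?_, fun i z => ?_⟩
  · exact β.contDiff.comp (contDiff_const_smul _)
  · refine β.zero_of_le_dist ?_
    rw [dist_zero_right, norm_smul, norm_inv, Real.norm_of_nonneg (by positivity)]
    rw [mem_ball_zero_iff, not_lt] at hz
    rw [le_inv_mul_iff₀ (by positivity)]
    change (j + 1) * 2 ≤ ‖z‖
    linarith
  · exact β.nonneg
  · exact β.le_one
  · have h1 : HasFDerivAt (ζ j) _ z :=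
      (((β.contDiff (n := 1)).differentiable one_ne_zero _).hasFDerivAt).comp z
        ((hasFDerivAt_id z).const_smul ((j : ℝ) + 1)⁻¹)
    rw [pderiv, h1.fderiv]
    simp only [ContinuousLinearMap.comp_apply, smul_apply,
      ContinuousLinearMap.id_apply, map_smul, smul_eq_mul, abs_mul]
    rw [abs_of_nonneg (by positivity : (0 : ℝ) ≤ ((j : ℝ) + 1)⁻¹)]
    refine (mul_le_of_le_one_left (abs_nonneg _) ?_).trans ?_
    · exact inv_le_one_of_one_le₀ (by linarith [(Nat.cast_nonneg j : (0 : ℝ) ≤ j)])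
    · have h2 := (fderiv ℝ β (((j : ℝ) + 1)⁻¹ • z)).le_opNorm (EuclideanSpace.single i 1)
      simp only [PiLp.norm_single, norm_one, mul_one] at h2
      exact h2.trans (hC _)
  · filter_upwards [hone z] with j hj using hζ1 j z hj
  · filter_upwards [hone z] with j hj
    have : ζ j =ᶠ[𝓝 z] fun _ => 1 := by
      filter_upwards [isOpen_ball.mem_nhds hj] with w hw using hζ1 j w hw
    rw [pderiv, this.fderiv_eq]
    simp

/-- The smooth inequality is applied to ζ_j u_k. First k → ∞ with the cutoff fixed, where only local
convergence is needed, then j → ∞. The factor 2 is the price of separating ζ∇u from u∇ζ. -/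
theorem lyapunov_weak {U W f : Plane → ℝ} {G : Fin 2 → Plane → ℝ} (hU : ContDiff ℝ 2 U)
    (hint : Integrable (fun z => Real.exp (-U z)) volume)
    (hW : ContDiff ℝ 2 W) (hW1 : ∀ z, 1 ≤ W z) {lam b r : ℝ} (hb : 0 ≤ b)
    (hL : ∀ z, generator U W z ≤
      -lam * W z + b * (ball (0 : Plane) r).indicator (fun _ => (1 : ℝ)) z)
    (h : RealWeakGradient f G) (hf : ∀ R, MemLp f 2 (volume.restrict (ball 0 R)))
    (hG : ∀ i R, MemLp (G i) 2 (volume.restrict (ball 0 R)))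
    (hfi : Integrable (fun z => f z ^ 2 * gibbsDensity U z) volume)
    (hGi : ∀ i, Integrable (fun z => G i z ^ 2 * gibbsDensity U z) volume) :
    lam * ∫ z, f z ^ 2 * gibbsDensity U z ≤
      2 * (∑ i, ∫ z, G i z ^ 2 * gibbsDensity U z)
        + b * ∫ z in ball 0 r, f z ^ 2 * gibbsDensity U z := by
  obtain ⟨u, hu, hconv⟩ := h.exists_approx hf hG
  obtain ⟨ζ, C, hζ, hζsupp, hζ01, hζC, hζ1, hζ0⟩ := exists_exhausting_cutoffs
  set ρ := gibbsDensity U with hρdef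
  have hρc : Continuous ρ := (contDiff_gibbsDensity hU).continuous
  have hρpos : ∀ z, 0 < ρ z := gibbsDensity_pos hint
  have hpζ : ∀ j i, Continuous (pderiv i (ζ j)) := fun j i =>
    (contDiff_pderiv (k := 0) ((hζ j).of_le (by simp)) i).continuous
  have hpu : ∀ k i, Continuous (pderiv i (u k)) := fun k i =>
    (contDiff_pderiv (k := 0) ((hu k).of_le (by simp)) i).continuous
  -- the inequality for the truncated function
  have hcut : ∀ j, lam * ∫ z, f z ^ 2 * (ζ j z ^ 2 * ρ z) ≤
      (∑ i, (2 * (∫ z, G i z ^ 2 * (ζ j z ^ 2 * ρ z))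
          + 2 * ∫ z, f z ^ 2 * (pderiv i (ζ j) z ^ 2 * ρ z)))
        + b * ∫ z, f z ^ 2 * (ball (0 : Plane) r).indicator (fun z => ζ j z ^ 2 * ρ z) z := by
    intro j
    obtain ⟨R, hR⟩ := hζsupp j
    have hcz : HasCompactSupport (ζ j) :=
      HasCompactSupport.intro (isCompact_closedBall (0 : Plane) R)
        fun z hz => hR z fun hz' => hz (ball_subset_closedBall hz')
    have hζc := (hζ j).continuous
    have hR' : ∀ z ∉ ball (0 : Plane) (R + 1), ζ j z = 0 := fun z hz =>
      hR z fun hz' => hz (ball_subset_ball (by linarith) hz')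
    have hpR : ∀ i, ∀ z ∉ ball (0 : Plane) (R + 1), pderiv i (ζ j) z = 0 := by
      intro i z hz
      have : ζ j =ᶠ[𝓝 z] fun _ => 0 := by
        have hz' : z ∉ closedBall (0 : Plane) R := fun hz' =>
          hz (closedBall_subset_ball (by linarith) hz')
        filter_upwards [isClosed_closedBall.isOpen_compl.mem_nhds hz'] with w hw
        exact hR w fun h => hw (ball_subset_closedBall h)
      rw [pderiv, this.fderiv_eq]
      simp
    have bound : ∀ η : Plane → ℝ, Continuous η → (∀ z ∉ ball (0 : Plane) (R + 1), η z = 0) →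
        ∃ C, ∀ z, |η z| ≤ C := fun η hη h0 =>
      (HasCompactSupport.intro (isCompact_closedBall (0 : Plane) (R + 1))
        fun z hz => h0 z fun hz' => hz (ball_subset_closedBall hz')).exists_bound_of_continuous hη
    have hη1 : Continuous fun z => ζ j z ^ 2 * ρ z := by fun_prop
    have hη1' : ∀ z ∉ ball (0 : Plane) (R + 1), ζ j z ^ 2 * ρ z = 0 := fun z hz => by
      simp [hR' z hz]
    have hη2 : ∀ i, Continuous fun z => pderiv i (ζ j) z ^ 2 * ρ z := fun i =>
      ((hpζ j i).pow 2).mul hρc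
    have hη2' : ∀ i, ∀ z ∉ ball (0 : Plane) (R + 1), pderiv i (ζ j) z ^ 2 * ρ z = 0 :=
      fun i z hz => by simp [hpR i z hz]
    obtain ⟨C1, hC1⟩ := bound _ hη1 hη1'
    have t1 := tendsto_integral_weight_sq (fun k => (hu k).continuous) (hf (R + 1))
      (hconv (R + 1)).1 hη1.measurable hC1 hη1'
    have t2 : ∀ i, _ := fun i => tendsto_integral_weight_sq (fun k => hpu k i) (hG i (R + 1))
      ((hconv (R + 1)).2 i) hη1.measurable hC1 hη1'
    have t3 : ∀ i, Tendsto (fun k => ∫ z, u k z ^ 2 * (pderiv i (ζ j) z ^ 2 * ρ z)) atTop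
        (𝓝 (∫ z, f z ^ 2 * (pderiv i (ζ j) z ^ 2 * ρ z))) := fun i => by
      obtain ⟨C2, hC2⟩ := bound _ (hη2 i) (hη2' i)
      exact tendsto_integral_weight_sq (fun k => (hu k).continuous) (hf (R + 1))
        (hconv (R + 1)).1 (hη2 i).measurable hC2 (hη2' i)
    have t4 := tendsto_integral_weight_sq (fun k => (hu k).continuous) (hf (R + 1))
      (hconv (R + 1)).1 (hη1.measurable.indicator (measurableSet_ball (x := (0 : Plane)) (ε := r)))
      (C := C1) (fun z => by
        by_cases hz : z ∈ ball (0 : Plane) r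
        · rw [Set.indicator_of_mem hz]; exact hC1 z
        · rw [Set.indicator_of_notMem hz, abs_zero]; exact (abs_nonneg _).trans (hC1 z))
      (fun z hz => by simp [hη1' z hz])
    refine le_of_tendsto_of_tendsto' (t1.const_mul lam)
      ((tendsto_finsetSum Finset.univ fun i _ =>
        ((t2 i).const_mul 2).add ((t3 i).const_mul 2)).add (t4.const_mul b)) fun k => ?_
    have huk : ContDiff ℝ 1 (u k) := (hu k).of_le (by simp)
    have hζk : ContDiff ℝ 1 (ζ j) := (hζ j).of_le (by simp)
    have hs := lyapunov_smooth hU hint hW hW1 hb hL (u := fun z => ζ j z * u k z)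
      (hζk.mul huk) hcz.mul_right
    have integ : ∀ η w : Plane → ℝ, Continuous η → Continuous w →
        (∀ z ∉ ball (0 : Plane) (R + 1), η z = 0) → Integrable (fun z => w z ^ 2 * η z) volume := by
      intro η w hη hw h0
      refine ((hw.pow 2).mul hη).integrable_of_hasCompactSupport ?_
      exact HasCompactSupport.intro (isCompact_closedBall (0 : Plane) (R + 1))
        fun z hz => by simp [h0 z fun hz' => hz (ball_subset_closedBall hz')]
    have e1 : ∫ z, (ζ j z * u k z) ^ 2 * ρ z = ∫ z, u k z ^ 2 * (ζ j z ^ 2 * ρ z) := by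
      congr 1; funext z; ring
    have e2 : ∫ z in ball 0 r, (ζ j z * u k z) ^ 2 * ρ z =
        ∫ z, u k z ^ 2 * (ball (0 : Plane) r).indicator (fun z => ζ j z ^ 2 * ρ z) z := by
      rw [← integral_indicator measurableSet_ball]
      congr 1; funext z
      by_cases hz : z ∈ ball (0 : Plane) r
      · simp only [Set.indicator_of_mem hz]; ring
      · simp [Set.indicator_of_notMem hz]
    have e3 : ∀ i, ∫ z, pderiv i (fun z => ζ j z * u k z) z ^ 2 * ρ z ≤
        2 * (∫ z, pderiv i (u k) z ^ 2 * (ζ j z ^ 2 * ρ z))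
          + 2 * ∫ z, u k z ^ 2 * (pderiv i (ζ j) z ^ 2 * ρ z) := by
      intro i
      have a1 := integ _ _ hη1 (hpu k i) hη1'
      have a2 := integ _ _ (hη2 i) huk.continuous (hη2' i)
      rw [← integral_const_mul, ← integral_const_mul,
        ← integral_add (a1.const_mul 2) (a2.const_mul 2)]
      refine integral_mono_of_nonneg (ae_of_all _ fun z => mul_nonneg (sq_nonneg _) (hρpos z).le)
        ((a1.const_mul 2).add (a2.const_mul 2)) (ae_of_all _ fun z => ?_)
      simp only [pderiv_mul (hζk.differentiable one_ne_zero z) (huk.differentiable one_ne_zero z)]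
      nlinarith [mul_nonneg (hρpos z).le
        (sq_nonneg (ζ j z * pderiv i (u k) z - u k z * pderiv i (ζ j) z))]
    rw [e1, e2] at hs
    exact hs.trans (add_le_add_left (Finset.sum_le_sum fun i _ => e3 i) _)
  -- removing the truncation
  have hsq : ∀ j z, 0 ≤ ζ j z ^ 2 ∧ ζ j z ^ 2 ≤ 1 := fun j z =>
    ⟨sq_nonneg _, pow_le_one₀ (hζ01 j z).1 (hζ01 j z).2⟩
  have s1 : Tendsto (fun j => ∫ z, f z ^ 2 * (ζ j z ^ 2 * ρ z)) atTop
      (𝓝 (∫ z, f z ^ 2 * ρ z)) := by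
    refine tendsto_integral_of_dominated_convergence (fun z => f z ^ 2 * ρ z) (fun j => ?_) hfi
      (fun j => ae_of_all _ fun z => ?_) (ae_of_all _ fun z => ?_)
    · have := (((hζ j).continuous.pow 2).aestronglyMeasurable (μ := volume)).mul hfi.1
      refine this.congr (ae_of_all _ fun z => ?_)
      simp only [Pi.mul_apply, Pi.pow_apply]
      ring
    · rw [Real.norm_of_nonneg (mul_nonneg (sq_nonneg _)
        (mul_nonneg (sq_nonneg _) (hρpos z).le))]
      exact mul_le_mul_of_nonneg_left (mul_le_of_le_one_left (hρpos z).le (hsq j z).2)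
        (sq_nonneg _)
    · refine tendsto_const_nhds.congr' ?_
      filter_upwards [hζ1 z] with j hj
      simp [hj]
  have s2 : ∀ i, Tendsto (fun j => ∫ z, f z ^ 2 * (pderiv i (ζ j) z ^ 2 * ρ z)) atTop
      (𝓝 0) := by
    intro i
    -- The derivatives of the cutoffs are bounded uniformly in j and vanish eventually at each
    -- point, so dominated convergence removes the error term.
    rw [← integral_zero Plane ℝ]
    refine tendsto_integral_of_dominated_convergence (fun z => C ^ 2 * (f z ^ 2 * ρ z))
      (fun j => ?_) (hfi.const_mul _) (fun j => ae_of_all _ fun z => ?_)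
      (ae_of_all _ fun z => ?_)
    · have := (((hpζ j i).pow 2).aestronglyMeasurable (μ := volume)).mul hfi.1
      refine this.congr (ae_of_all _ fun z => ?_)
      simp only [Pi.mul_apply, Pi.pow_apply]
      ring
    · rw [Real.norm_of_nonneg (mul_nonneg (sq_nonneg _)
        (mul_nonneg (sq_nonneg _) (hρpos z).le))]
      have h1 : pderiv i (ζ j) z ^ 2 ≤ C ^ 2 := by
        rw [← sq_abs]; exact pow_le_pow_left₀ (abs_nonneg _) (hζC j i z) 2
      have h2 : 0 ≤ f z ^ 2 * ρ z := mul_nonneg (sq_nonneg _) (hρpos z).le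
      nlinarith
    · refine tendsto_const_nhds.congr' ?_
      filter_upwards [hζ0 i z] with j hj
      simp [hj]
  refine le_of_tendsto_of_tendsto' (s1.const_mul lam) (b := atTop)
    (g := fun j => 2 * (∑ i, ∫ z, G i z ^ 2 * ρ z)
      + (2 * ∑ i, ∫ z, f z ^ 2 * (pderiv i (ζ j) z ^ 2 * ρ z))
      + b * ∫ z in ball 0 r, f z ^ 2 * ρ z) ?_ fun j => ?_
  · have := (((tendsto_finsetSum Finset.univ fun i _ => s2 i).const_mul 2).const_add
      (2 * (∑ i, ∫ z, G i z ^ 2 * ρ z))).add_const (b * ∫ z in ball 0 r, f z ^ 2 * ρ z)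
    simpa using this
  · refine (hcut j).trans ?_
    rw [Finset.sum_add_distrib, ← Finset.mul_sum, ← Finset.mul_sum]
    refine add_le_add (add_le_add_left (mul_le_mul_of_nonneg_left
      (Finset.sum_le_sum fun i _ => ?_) (by norm_num)) _) (mul_le_mul_of_nonneg_left ?_ hb)
    · refine integral_mono_of_nonneg (ae_of_all _ fun z => mul_nonneg (sq_nonneg _)
        (mul_nonneg (sq_nonneg _) (hρpos z).le)) (hGi i) (ae_of_all _ fun z => ?_)
      exact mul_le_mul_of_nonneg_left (mul_le_of_le_one_left (hρpos z).le (hsq j z).2)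
        (sq_nonneg _)
    · rw [← integral_indicator measurableSet_ball]
      refine integral_mono_of_nonneg (ae_of_all _ fun z => mul_nonneg (sq_nonneg _)
        (Set.indicator_nonneg (fun z _ => mul_nonneg (sq_nonneg _) (hρpos z).le) z))
        (hfi.indicator measurableSet_ball) (ae_of_all _ fun z => ?_)
      by_cases hz : z ∈ ball (0 : Plane) r
      · simp only [Set.indicator_of_mem hz]
        exact mul_le_mul_of_nonneg_left (mul_le_of_le_one_left (hρpos z).le (hsq j z).2)
          (sq_nonneg _)
      · simp [Set.indicator_of_notMem hz]

/-! ### Transfer to the unit torus -/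

/-- The transport map in product coordinates. -/
def liftMap (ρ χ : Plane → ℝ) (n : ℕ) (w : ℝ × ℝ) : Plane := transport ρ χ n (pairEquiv w)

/-- The derivative in the direction `v` of a function composed with `liftMap`, in terms of the
gradient `G` of the function. -/
def liftGrad (ρ χ : Plane → ℝ) (n : ℕ) (G : Fin 2 → Plane → ℝ) (v w : ℝ × ℝ) : ℝ :=
  ∑ i, G i (liftMap ρ χ n w) * fderiv ℝ (liftMap ρ χ n) w v i

theorem fderiv_apply_eq_sum (u : Plane → ℝ) (z v : Plane) :
    fderiv ℝ u z v = ∑ i, pderiv i u z * v i := by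
  conv_lhs => rw [plane_eq_sum v]
  simp [Fin.sum_univ_two, pderiv]
  ring

section Construction

variable {ρ χ : Plane → ℝ} {n : ℕ}

theorem contDiff_liftMap (hn : 1 ≤ n) (hρ : ContDiff ℝ 1 ρ) (hpos : ∀ z, 0 < ρ z)
    (hχ : IsCutoff n χ) : ContDiff ℝ 1 (liftMap ρ χ n) :=
  (contDiff_transport hn hρ hpos hχ).comp pairEquiv.contDiff

theorem cdfMap_liftMap (hn : 1 ≤ n) (hρ : ContDiff ℝ 1 ρ) (hpos : ∀ z, 0 < ρ z)
    (hχ : IsCutoff n χ) (w : ℝ × ℝ) : cdfMap ρ χ n (liftMap ρ χ n w) = pairEquiv w :=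
  cdfMap_transport hn hρ.continuous hpos hχ _

theorem fderiv_liftMap (hn : 1 ≤ n) (hρ : ContDiff ℝ 1 ρ) (hpos : ∀ z, 0 < ρ z)
    (hχ : IsCutoff n χ) (w v : ℝ × ℝ) :
    fderiv ℝ (liftMap ρ χ n) w v = fderiv ℝ (transport ρ χ n) (pairEquiv w) (pairEquiv v) := by
  have h1 := ((contDiff_transport hn hρ hpos hχ).differentiable one_ne_zero
    (pairEquiv w)).hasFDerivAt
  have h2 : fderiv ℝ (liftMap ρ χ n) w = _ := (h1.comp w pairEquiv.hasFDerivAt).fderiv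
  rw [h2]
  rfl

theorem fderiv_comp_liftMap (hn : 1 ≤ n) (hρ : ContDiff ℝ 1 ρ) (hpos : ∀ z, 0 < ρ z)
    (hχ : IsCutoff n χ) {u : Plane → ℝ} (hu : ContDiff ℝ 1 u) (v w : ℝ × ℝ) :
    fderiv ℝ (fun w => u (liftMap ρ χ n w)) w v =
      liftGrad ρ χ n (fun i => pderiv i u) v w := by
  have h1 := (hu.differentiable one_ne_zero (liftMap ρ χ n w)).hasFDerivAt
  have h2 := ((contDiff_liftMap hn hρ hpos hχ).differentiable one_ne_zero w).hasFDerivAt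
  have h3 : fderiv ℝ (fun w => u (liftMap ρ χ n w)) w = _ := (h1.comp w h2).fderiv
  rw [h3, liftGrad]
  exact fderiv_apply_eq_sum _ _ _

/-- The change of variables formula for `cdfMap` pushes its Jacobian density to Lebesgue measure;
composing with the inverse map reverses this. Working with lifts to the whole plane avoids any
choice of fundamental domain. -/
theorem measurePreserving_liftMap (hn : 1 ≤ n) (hρ : ContDiff ℝ 1 ρ) (hpos : ∀ z, 0 < ρ z)
    (hχ : IsCutoff n χ) : MeasurePreserving (liftMap ρ χ n) volume
      (volume.withDensity fun z => ENNReal.ofReal (torusDensity ρ χ n (z 0) (z 1))) := by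
  have hF := contDiff_cdfMap (K := 1) hn hρ hpos hχ
  have hZ := contDiff_transport hn hρ hpos hχ
  have hinj : Function.Injective (cdfMap ρ χ n) :=
    Function.LeftInverse.injective (transport_cdfMap hn hρ.continuous hpos hχ)
  have hsurj : Function.Surjective (cdfMap ρ χ n) :=
    Function.RightInverse.surjective (cdfMap_transport hn hρ.continuous hpos hχ)
  have h1 := map_withDensity_abs_det_fderiv_eq_addHaar volume (s := Set.univ)
    MeasurableSet.univ.nullMeasurableSet (f := cdfMap ρ χ n) (f' := fderiv ℝ (cdfMap ρ χ n))
    (fun x _ => (hF.differentiable one_ne_zero x).hasFDerivAt.hasFDerivWithinAt) hinj.injOn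
  simp only [det_fderiv_cdfMap hn hρ hpos hχ, Measure.restrict_univ, Set.image_univ,
    hsurj.range_eq, abs_of_pos (torusDensity_pos hn hρ.continuous hpos hχ _ _)] at h1
  have h2 : MeasurePreserving (transport ρ χ n) volume
      (volume.withDensity fun z => ENNReal.ofReal (torusDensity ρ χ n (z 0) (z 1))) := by
    refine ⟨hZ.continuous.measurable, ?_⟩
    conv_lhs => rw [← h1]
    rw [Measure.map_map hZ.continuous.measurable hF.continuous.measurable]
    have : transport ρ χ n ∘ cdfMap ρ χ n = id :=
      funext (transport_cdfMap hn hρ.continuous hpos hχ)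
    rw [this, Measure.map_id]
  exact h2.comp measurePreserving_pairEquiv

theorem measurePreserving_liftMap_restrict (hn : 1 ≤ n) (hρ : ContDiff ℝ 1 ρ)
    (hpos : ∀ z, 0 < ρ z) (hχ : IsCutoff n χ) {S : Set Plane} (hS : MeasurableSet S)
    (hSb : S ⊆ ball 0 (3 * n / 2)) :
    MeasurePreserving (liftMap ρ χ n) (volume.restrict (liftMap ρ χ n ⁻¹' S))
      ((volume.restrict S).withDensity fun z => ENNReal.ofReal ((normConst ρ χ n)⁻¹ * ρ z)) := by
  have h := (measurePreserving_liftMap hn hρ hpos hχ).restrict_preimage hS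
  rw [restrict_withDensity hS] at h
  convert h using 1
  refine withDensity_congr_ae ?_
  filter_upwards [ae_restrict_mem hS] with z hz
  rw [torusDensity_of_mem_ball hn hχ (hSb hz)]

theorem isCompact_preimage_liftMap (hn : 1 ≤ n) (hρ : ContDiff ℝ 1 ρ) (hpos : ∀ z, 0 < ρ z)
    (hχ : IsCutoff n χ) {S : Set Plane} (hS : IsCompact S) :
    IsCompact (liftMap ρ χ n ⁻¹' S) := by
  obtain ⟨e, -, he, -⟩ := exists_cdf_homeomorph hn hρ hpos hχ
  have : liftMap ρ χ n = pairEquiv.toHomeomorph.trans e.symm := by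
    funext w
    rw [liftMap, ← he]
    rfl
  rw [this]
  exact (Homeomorph.isCompact_preimage _).2 hS

theorem exists_bound_fderiv_liftMap (hn : 1 ≤ n) (hρ : ContDiff ℝ 1 ρ) (hpos : ∀ z, 0 < ρ z)
    (hχ : IsCutoff n χ) : ∃ L : ℝ, 0 ≤ L ∧ ∀ w, liftMap ρ χ n w ∈ ball (0 : Plane) (3 * n / 2) →
      ∀ v : ℝ × ℝ, ‖v‖ ≤ 1 → ∀ i, |fderiv ℝ (liftMap ρ χ n) w v i| ≤ L := by
  obtain ⟨L, hL⟩ := (isCompact_preimage_liftMap hn hρ hpos hχ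
    (isCompact_closedBall (0 : Plane) (3 * n / 2))).exists_bound_of_continuousOn
    ((contDiff_liftMap hn hρ hpos hχ).continuous_fderiv one_ne_zero).continuousOn
  refine ⟨max L 0, le_max_right _ _, fun w hw v hv i => ?_⟩
  calc |fderiv ℝ (liftMap ρ χ n) w v i| ≤ ‖fderiv ℝ (liftMap ρ χ n) w v‖ := abs_coord_le_norm _ i
    _ ≤ ‖fderiv ℝ (liftMap ρ χ n) w‖ * ‖v‖ := ContinuousLinearMap.le_opNorm _ _
    _ ≤ max L 0 * 1 := mul_le_mul ((hL w (ball_subset_closedBall hw)).trans (le_max_left _ _)) hv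
        (norm_nonneg _) (le_max_right _ _)
    _ = max L 0 := mul_one _

theorem exists_measure_bound (hρ : Continuous ρ) (R c : ℝ) :
    ∃ C : ℝ≥0∞, C ≠ ⊤ ∧ (volume.restrict (ball (0 : Plane) R)).withDensity
      (fun z => ENNReal.ofReal (c * ρ z)) ≤ C • volume.restrict (ball (0 : Plane) R) := by
  obtain ⟨C, hC⟩ := (isCompact_closedBall (0 : Plane) R).exists_bound_of_continuousOn
    (f := fun z => c * ρ z) (by fun_prop)
  refine ⟨ENNReal.ofReal C, ENNReal.ofReal_ne_top, ?_⟩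
  rw [← withDensity_const]
  refine withDensity_mono ?_
  filter_upwards [ae_restrict_mem measurableSet_ball] with z hz
  exact ENNReal.ofReal_le_ofReal ((le_abs_self _).trans (hC z (ball_subset_closedBall hz)))

theorem memLp_comp_liftMap (hn : 1 ≤ n) (hρ : ContDiff ℝ 1 ρ) (hpos : ∀ z, 0 < ρ z)
    (hχ : IsCutoff n χ) {f : Plane → ℝ} (hf : MemLp f 2 (volume.restrict (ball 0 (3 * n / 2)))) :
    MemLp (fun w => f (liftMap ρ χ n w)) 2
      (volume.restrict (liftMap ρ χ n ⁻¹' ball 0 (3 * n / 2))) := by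
  obtain ⟨C, hC, hle⟩ := exists_measure_bound hρ.continuous (3 * n / 2) (normConst ρ χ n)⁻¹
  exact (hf.of_measure_le_smul hC hle).comp_measurePreserving
    (measurePreserving_liftMap_restrict hn hρ hpos hχ measurableSet_ball le_rfl)

/-- The image measure has bounded density on the ball, so pulling back changes L² norms by at most a
constant factor. -/
theorem tendsto_comp_liftMap (hn : 1 ≤ n) (hρ : ContDiff ℝ 1 ρ) (hpos : ∀ z, 0 < ρ z)
    (hχ : IsCutoff n χ) {w : ℕ → Plane → ℝ}
    (hw : ∀ k, AEStronglyMeasurable (w k) (volume.restrict (ball 0 (3 * n / 2))))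
    (ht : Tendsto (fun k => eLpNorm (w k) 2 (volume.restrict (ball 0 (3 * n / 2)))) atTop (𝓝 0)) :
    Tendsto (fun k => eLpNorm (fun y => w k (liftMap ρ χ n y)) 2
      (volume.restrict (liftMap ρ χ n ⁻¹' ball 0 (3 * n / 2)))) atTop (𝓝 0) := by
  obtain ⟨C, hC, hle⟩ := exists_measure_bound hρ.continuous (3 * n / 2) (normConst ρ χ n)⁻¹
  have hmp := measurePreserving_liftMap_restrict hn hρ hpos hχ
    (measurableSet_ball (x := (0 : Plane)) (ε := 3 * n / 2)) le_rfl
  have hac := (Measure.absolutelyContinuous_of_le hle).trans (Measure.smul_absolutelyContinuous)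
  have hlim : Tendsto (fun k => C ^ (1 / (2 : ℝ≥0∞)).toReal •
      eLpNorm (w k) 2 (volume.restrict (ball 0 (3 * n / 2)))) atTop (𝓝 0) := by
    simpa using ENNReal.Tendsto.const_mul ht (Or.inr (ENNReal.rpow_ne_top_of_nonneg (by simp) hC))
  refine tendsto_of_tendsto_of_tendsto_of_le_of_le tendsto_const_nhds hlim (fun _ => zero_le)
    fun k => ?_
  have e := eLpNorm_comp_measurePreserving (p := 2) ((hw k).mono_ac hac) hmp
  have e' : eLpNorm (fun y => w k (liftMap ρ χ n y)) 2
      (volume.restrict (liftMap ρ χ n ⁻¹' ball 0 (3 * n / 2))) = _ := e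
  rw [e']
  refine (eLpNorm_mono_measure _ hle).trans_eq ?_
  rw [eLpNorm_smul_measure_of_ne_top (by simp)]

theorem memLp_liftGrad (hn : 1 ≤ n) (hρ : ContDiff ℝ 1 ρ) (hpos : ∀ z, 0 < ρ z)
    (hχ : IsCutoff n χ) {G : Fin 2 → Plane → ℝ}
    (hG : ∀ i, MemLp (G i) 2 (volume.restrict (ball 0 (3 * n / 2)))) {v : ℝ × ℝ} (hv : ‖v‖ ≤ 1) :
    MemLp (liftGrad ρ χ n G v) 2 (volume.restrict (liftMap ρ χ n ⁻¹' ball 0 (3 * n / 2))) := by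
  obtain ⟨L, hL0, hL⟩ := exists_bound_fderiv_liftMap hn hρ hpos hχ
  have hc := contDiff_liftMap hn hρ hpos hχ
  refine memLp_finsetSum _ fun i _ => ?_
  have h1 := memLp_comp_liftMap hn hρ hpos hχ (hG i)
  have hcont : Continuous fun w => fderiv ℝ (liftMap ρ χ n) w v i :=
    (coordL i).continuous.comp ((hc.continuous_fderiv one_ne_zero).clm_apply continuous_const)
  refine h1.of_le_mul (c := L) (h1.1.mul hcont.aestronglyMeasurable) ?_
  filter_upwards [ae_restrict_mem (measurableSet_ball.preimage hc.continuous.measurable)] with w hw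
  rw [norm_mul, mul_comm]
  exact mul_le_mul_of_nonneg_right (hL w hw v hv i) (norm_nonneg _)

theorem tendsto_liftGrad (hn : 1 ≤ n) (hρ : ContDiff ℝ 1 ρ) (hpos : ∀ z, 0 < ρ z)
    (hχ : IsCutoff n χ) {G : ℕ → Fin 2 → Plane → ℝ}
    (hG : ∀ k i, MemLp (G k i) 2 (volume.restrict (ball 0 (3 * n / 2))))
    (ht : ∀ i, Tendsto (fun k => eLpNorm (G k i) 2 (volume.restrict (ball 0 (3 * n / 2))))
      atTop (𝓝 0)) {v : ℝ × ℝ} (hv : ‖v‖ ≤ 1) :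
    Tendsto (fun k => eLpNorm (liftGrad ρ χ n (G k) v) 2
      (volume.restrict (liftMap ρ χ n ⁻¹' ball 0 (3 * n / 2)))) atTop (𝓝 0) := by
  obtain ⟨L, hL0, hL⟩ := exists_bound_fderiv_liftMap hn hρ hpos hχ
  have hc := contDiff_liftMap hn hρ hpos hχ
  have hcont : ∀ i, Continuous fun w => fderiv ℝ (liftMap ρ χ n) w v i := fun i =>
    (coordL i).continuous.comp ((hc.continuous_fderiv one_ne_zero).clm_apply continuous_const)
  have hlim : Tendsto (fun k => ∑ i : Fin 2, ENNReal.ofReal L *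
      eLpNorm (fun y => G k i (liftMap ρ χ n y)) 2
        (volume.restrict (liftMap ρ χ n ⁻¹' ball 0 (3 * n / 2)))) atTop (𝓝 0) := by
    have := tendsto_finsetSum (Finset.univ : Finset (Fin 2)) fun i _ =>
      ENNReal.Tendsto.const_mul (a := ENNReal.ofReal L)
        (tendsto_comp_liftMap hn hρ hpos hχ (fun k => (hG k i).1) (ht i))
        (Or.inr ENNReal.ofReal_ne_top)
    simpa using this
  refine tendsto_of_tendsto_of_tendsto_of_le_of_le tendsto_const_nhds hlim (fun _ => zero_le)
    fun k => ?_
  have e : liftGrad ρ χ n (G k) v = ∑ i, fun w => G k i (liftMap ρ χ n w) *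
      fderiv ℝ (liftMap ρ χ n) w v i := by
    funext w
    simp [liftGrad]
  rw [e]
  refine (eLpNorm_sum_le (fun i _ => ((memLp_comp_liftMap hn hρ hpos hχ (hG k i)).1.mul
    (hcont i).aestronglyMeasurable)) (by norm_num)).trans (Finset.sum_le_sum fun i _ => ?_)
  refine eLpNorm_le_mul_eLpNorm_of_ae_le_mul ?_ 2
  filter_upwards [ae_restrict_mem (measurableSet_ball.preimage hc.continuous.measurable)] with w hw
  simp only [norm_mul, Pi.mul_apply]
  rw [mul_comm]
  exact mul_le_mul_of_nonneg_right (hL w hw v hv i) (norm_nonneg _)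

theorem tendsto_fderiv_comp_liftMap (hn : 1 ≤ n) (hρ : ContDiff ℝ 1 ρ) (hpos : ∀ z, 0 < ρ z)
    (hχ : IsCutoff n χ) {u : ℕ → Plane → ℝ} (hu : ∀ k, ContDiff ℝ 1 (u k))
    {G : Fin 2 → Plane → ℝ}
    (hm : ∀ k i, MemLp (pderiv i (u k) - G i) 2 (volume.restrict (ball 0 (3 * n / 2))))
    (ht : ∀ i, Tendsto (fun k => eLpNorm (pderiv i (u k) - G i) 2
      (volume.restrict (ball 0 (3 * n / 2)))) atTop (𝓝 0)) {v : ℝ × ℝ} (hv : ‖v‖ ≤ 1) :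
    Tendsto (fun k => eLpNorm ((fun w => fderiv ℝ (fun w => u k (liftMap ρ χ n w)) w v)
      - liftGrad ρ χ n G v) 2 (volume.restrict (liftMap ρ χ n ⁻¹' ball 0 (3 * n / 2))))
      atTop (𝓝 0) := by
  refine (tendsto_liftGrad hn hρ hpos hχ hm ht hv).congr fun k => ?_
  congr 1
  funext w
  rw [Pi.sub_apply, fderiv_comp_liftMap hn hρ hpos hχ (hu k)]
  simp only [liftGrad, Pi.sub_apply, sub_mul, Finset.sum_sub_distrib]

/-- Mollify in the plane, then compose with the transport map. The chain rule holds for the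
mollifications, and the derivative of the transport map is bounded on the preimage of the ball, so
it passes to the limit. -/
theorem exists_strongLimit (hn : 1 ≤ n) (hρ : ContDiff ℝ 1 ρ) (hpos : ∀ z, 0 < ρ z)
    (hχ : IsCutoff n χ) {f : Plane → ℝ} {G : Fin 2 → Plane → ℝ} (h : RealWeakGradient f G)
    (hf : ∀ R, MemLp f 2 (volume.restrict (ball 0 R)))
    (hG : ∀ i R, MemLp (G i) 2 (volume.restrict (ball 0 R))) :
    ∃ u, StrongLimit (liftMap ρ χ n ⁻¹' ball 0 (3 * n / 2)) u (fun w => f (liftMap ρ χ n w))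
      (liftGrad ρ χ n G (1, 0)) (liftGrad ρ χ n G (0, 1)) := by
  obtain ⟨u, hu, hconv⟩ := h.exists_approx hf hG
  have hu1 : ∀ k, ContDiff ℝ 1 (u k) := fun k => (hu k).of_le (by exact_mod_cast le_top)
  have hpu : ∀ k i, Continuous (pderiv i (u k)) := fun k i =>
    (contDiff_pderiv (k := 0) (by simpa using hu1 k) i).continuous
  have hL : ∀ w : Plane → ℝ, Continuous w → MemLp w 2 (volume.restrict (ball 0 (3 * n / 2))) :=
    fun w hw => (memLp_restrict_of_isCompact hw (isCompact_closedBall 0 (3 * n / 2)) 2).mono_measure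
      (Measure.restrict_mono ball_subset_closedBall le_rfl)
  have hv1 : ‖((1, 0) : ℝ × ℝ)‖ ≤ 1 := by simp [Prod.norm_def]
  have hv2 : ‖((0, 1) : ℝ × ℝ)‖ ≤ 1 := by simp [Prod.norm_def]
  have hf' := hf (3 * n / 2)
  have hG' := fun i => hG i (3 * n / 2)
  obtain ⟨hc, hcG⟩ := hconv (3 * n / 2)
  have hm : ∀ k i, MemLp (pderiv i (u k) - G i) 2 (volume.restrict (ball 0 (3 * n / 2))) :=
    fun k i => (hL _ (hpu k i)).sub (hG' i)
  have ht : Tendsto (fun k => eLpNorm (fun y => (u k - f) (liftMap ρ χ n y)) 2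
      (volume.restrict (liftMap ρ χ n ⁻¹' ball 0 (3 * n / 2)))) atTop (𝓝 0) :=
    tendsto_comp_liftMap hn hρ hpos hχ (fun k => ((hL _ (hu k).continuous).sub hf').1) hc
  have h1 := tendsto_fderiv_comp_liftMap hn hρ hpos hχ hu1 hm hcG hv1
  have h2 := tendsto_fderiv_comp_liftMap hn hρ hpos hχ hu1 hm hcG hv2
  exact ⟨fun k w => u k (liftMap ρ χ n w),
    fun k => (hu1 k).comp (contDiff_liftMap hn hρ hpos hχ),
    memLp_comp_liftMap hn hρ hpos hχ hf', memLp_liftGrad hn hρ hpos hχ hG' hv1,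
    memLp_liftGrad hn hρ hpos hχ hG' hv2, ht, h1, h2⟩

end Construction

/-! ### Grids of cells -/

/-- The cells of side `h` in product coordinates. -/
def gridBox (h : ℝ) (i j : ℤ) : Set (ℝ × ℝ) := box (i * h) ((j - 1 / 2) * h) h

/-- The open cells of side `h` in product coordinates. -/
def openGridBox (h : ℝ) (i j : ℤ) : Set (ℝ × ℝ) :=
  Set.Ioo (i * h) (i * h + h) ×ˢ Set.Ioo ((j - 1 / 2) * h) ((j - 1 / 2) * h + h)

theorem openGridBox_subset (h : ℝ) (i j : ℤ) : openGridBox h i j ⊆ gridBox h i j :=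
  Set.prod_mono Set.Ioo_subset_Icc_self Set.Ioo_subset_Icc_self

theorem openGridBox_ae_eq (h : ℝ) (i j : ℤ) : openGridBox h i j =ᵐ[volume] gridBox h i j :=
  Measure.set_prod_ae_eq Ioo_ae_eq_Icc Ioo_ae_eq_Icc

theorem measurableSet_openGridBox (h : ℝ) (i j : ℤ) : MeasurableSet (openGridBox h i j) :=
  measurableSet_Ioo.prod measurableSet_Ioo

theorem eq_of_mem_openGridBox {h : ℝ} (hh : 0 < h) {i j i' j' : ℤ} {w : ℝ × ℝ}
    (hw : w ∈ openGridBox h i j) (hw' : w ∈ gridBox h i' j') : i = i' ∧ j = j' := by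
  obtain ⟨⟨h1, h2⟩, h3, h4⟩ := hw
  obtain ⟨⟨h1', h2'⟩, h3', h4'⟩ := hw'
  have key : ∀ a b : ℝ, a * h < b * h → a < b := fun a b hab => lt_of_mul_lt_mul_right hab hh.le
  have e1 : (i : ℝ) < i' + 1 := key _ _ (by linarith)
  have e2 : (i' : ℝ) < i + 1 := key _ _ (by linarith)
  have e3 : (j : ℝ) - 1 / 2 < j' - 1 / 2 + 1 := key _ _ (by linarith)
  have e4 : (j' : ℝ) - 1 / 2 < j - 1 / 2 + 1 := key _ _ (by linarith)
  have e1' : i < i' + 1 := by exact_mod_cast e1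
  have e2' : i' < i + 1 := by exact_mod_cast e2
  have e3' : j < j' + 1 := by
    have : (j : ℝ) < j' + 1 := by linarith
    exact_mod_cast this
  have e4' : j' < j + 1 := by
    have : (j' : ℝ) < j + 1 := by linarith
    exact_mod_cast this
  constructor <;> omega

theorem ae_mem_openGridBox {h : ℝ} :
    ∀ᵐ w : ℝ × ℝ, ∀ i j, w ∈ gridBox h i j → w ∈ openGridBox h i j := by
  refine ae_all_iff.2 fun i => ae_all_iff.2 fun j => ?_
  filter_upwards [(openGridBox_ae_eq h i j).mem_iff] with w hw using hw.2

/-- A region which is star-shaped along the axes meets a connected set of cells: a quantity which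
agrees on adjacent cells meeting the region is the same on all of them. -/
theorem const_on_cells {h : ℝ} (hh : 0 < h) {Ω : Set (ℝ × ℝ)} (hΩ : IsOpen Ω) (h0 : (0, 0) ∈ Ω)
    (hv : ∀ x y y', (x, y) ∈ Ω → (0 ≤ y' ∧ y' ≤ y) ∨ (y ≤ y' ∧ y' ≤ 0) → (x, y') ∈ Ω)
    (hx : ∀ x y x', (x, y) ∈ Ω → (0 ≤ x' ∧ x' ≤ x) ∨ (x ≤ x' ∧ x' ≤ 0) → (x', 0) ∈ Ω)
    {t : ℤ → ℤ → ℝ}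
    (t1 : ∀ i j, (openGridBox h i j ∩ Ω).Nonempty → (openGridBox h (i + 1) j ∩ Ω).Nonempty →
      t i j = t (i + 1) j)
    (t2 : ∀ i j, (openGridBox h i j ∩ Ω).Nonempty → (openGridBox h i (j + 1) ∩ Ω).Nonempty →
      t i j = t i (j + 1))
    {i j : ℤ} (hij : (openGridBox h i j ∩ Ω).Nonempty) : t i j = t 0 0 := by
  -- Rows are shifted by half a cell, so row j has midline y = jh and row 0 is centred on the
  -- horizontal axis. The moves below go to such midlines.
  have hcen : ∀ i j : ℤ, ∀ x, x ∈ Set.Ioo (i * h) (i * h + h) → (x, j * h) ∈ openGridBox h i j :=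
    fun i j x hx => ⟨hx, by constructor <;> simp only <;> linarith⟩
  have hJ0 : (openGridBox h 0 0 ∩ Ω).Nonempty := by
    have hc : Tendsto (fun ε : ℝ => (ε, (0 : ℝ))) (𝓝[>] 0) (𝓝 (0, 0)) :=
      (Continuous.tendsto (by fun_prop) _).mono_left nhdsWithin_le_nhds
    obtain ⟨ε, hε, hε'⟩ := ((hc.eventually (hΩ.mem_nhds h0)).and
      (Ioo_mem_nhdsGT hh)).exists
    refine ⟨(ε, 0), ?_, hε⟩
    have := hcen 0 0 ε (by simpa using hε')
    simpa using this
  have down : ∀ i j : ℤ, 1 ≤ j → (openGridBox h i j ∩ Ω).Nonempty →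
      (openGridBox h i (j - 1) ∩ Ω).Nonempty := by
    rintro i j hj ⟨⟨x, y⟩, ⟨hx1, hy1⟩, hΩ'⟩
    refine ⟨(x, ((j - 1 : ℤ) : ℝ) * h), hcen _ _ _ hx1, hv x y _ hΩ' (Or.inl ⟨?_, ?_⟩)⟩
    · have : (0 : ℝ) ≤ (j - 1 : ℤ) := by exact_mod_cast Int.sub_nonneg.2 hj
      positivity
    · push_cast
      have := hy1.1
      simp only at this
      linarith
  have up : ∀ i j : ℤ, j ≤ -1 → (openGridBox h i j ∩ Ω).Nonempty →
      (openGridBox h i (j + 1) ∩ Ω).Nonempty := by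
    rintro i j hj ⟨⟨x, y⟩, ⟨hx1, hy1⟩, hΩ'⟩
    refine ⟨(x, ((j + 1 : ℤ) : ℝ) * h), hcen _ _ _ hx1, hv x y _ hΩ' (Or.inr ⟨?_, ?_⟩)⟩
    · push_cast
      have := hy1.2
      simp only at this
      linarith
    · have : ((j + 1 : ℤ) : ℝ) ≤ 0 := by exact_mod_cast (by omega : j + 1 ≤ 0)
      exact mul_nonpos_of_nonpos_of_nonneg this hh.le
  have left : ∀ i : ℤ, 1 ≤ i → (openGridBox h i 0 ∩ Ω).Nonempty →
      (openGridBox h (i - 1) 0 ∩ Ω).Nonempty := by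
    rintro i hi ⟨⟨x, y⟩, ⟨hx1, -⟩, hΩ'⟩
    have h1 : (1 : ℝ) ≤ i := by exact_mod_cast hi
    have h2 := hx1.1
    simp only at h2
    refine ⟨((i - 1 / 2) * h, 0), ?_, hx x y _ hΩ' (Or.inl ⟨?_, ?_⟩)⟩
    · have := hcen (i - 1) 0 ((i - 1 / 2) * h) (by push_cast; constructor <;> linarith)
      simpa using this
    · exact mul_nonneg (by linarith) hh.le
    · linarith
  have right : ∀ i : ℤ, i ≤ -1 → (openGridBox h i 0 ∩ Ω).Nonempty →
      (openGridBox h (i + 1) 0 ∩ Ω).Nonempty := by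
    rintro i hi ⟨⟨x, y⟩, ⟨hx1, -⟩, hΩ'⟩
    -- From column -1 the next column lies on the positive side, where the star-shape hypothesis
    -- gives nothing; a point of the cell (0, 0) close to the origin is used instead.
    rcases eq_or_lt_of_le hi with rfl | hi'
    · exact hJ0
    have h1 : (i : ℝ) ≤ -2 := by exact_mod_cast (by omega : i ≤ -2)
    have h2 := hx1.2
    simp only at h2
    refine ⟨((i + 3 / 2) * h, 0), ?_, hx x y _ hΩ' (Or.inr ⟨?_, ?_⟩)⟩
    · have := hcen (i + 1) 0 ((i + 3 / 2) * h) (by push_cast; constructor <;> linarith)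
      simpa using this
    · linarith
    · exact mul_nonpos_of_nonpos_of_nonneg (by linarith) hh.le
  -- Each cell is connected to row 0 within its column, and then to the cell (0, 0) along that row.
  have col : ∀ (N : ℕ) (i j : ℤ), j.natAbs ≤ N → (openGridBox h i j ∩ Ω).Nonempty →
      (openGridBox h i 0 ∩ Ω).Nonempty ∧ t i j = t i 0 := by
    intro N
    induction N with
    | zero =>
      intro i j hj hJ
      obtain rfl : j = 0 := by omega
      exact ⟨hJ, rfl⟩
    | succ N ih =>
      intro i j hj hJ
      rcases lt_trichotomy j 0 with hlt | rfl | hgt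
      · have hJ' := up i j (by omega) hJ
        obtain ⟨a, b⟩ := ih i (j + 1) (by omega) hJ'
        exact ⟨a, (t2 i j hJ hJ').trans b⟩
      · exact ⟨hJ, rfl⟩
      · have hJ' := down i j (by omega) hJ
        obtain ⟨a, b⟩ := ih i (j - 1) (by omega) hJ'
        have := t2 i (j - 1) hJ' (by simpa using hJ)
        rw [sub_add_cancel] at this
        exact ⟨a, this.symm.trans b⟩
  have row : ∀ (N : ℕ) (i : ℤ), i.natAbs ≤ N → (openGridBox h i 0 ∩ Ω).Nonempty →
      t i 0 = t 0 0 := by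
    intro N
    induction N with
    | zero =>
      intro i hi hJ
      obtain rfl : i = 0 := by omega
      rfl
    | succ N ih =>
      intro i hi hJ
      rcases lt_trichotomy i 0 with hlt | rfl | hgt
      · have hJ' := right i (by omega) hJ
        exact (t1 i 0 hJ hJ').trans (ih (i + 1) (by omega) hJ')
      · rfl
      · have hJ' := left i (by omega) hJ
        have := t1 (i - 1) 0 hJ' (by simpa using hJ)
        rw [sub_add_cancel] at this
        exact this.symm.trans (ih (i - 1) (by omega) hJ')
  obtain ⟨a, b⟩ := col _ i j le_rfl hij
  exact b.trans (row _ i le_rfl a)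

/-- An estimate on each cell meeting a region sums to an estimate on the region. -/
theorem setIntegral_le_of_cells {h : ℝ} (hh : 0 < h) {Ω K : Set (ℝ × ℝ)}
    (hcov : ∀ w ∈ Ω, ∃ i j, w ∈ gridBox h i j ∧ gridBox h i j ⊆ K)
    {p q : ℝ × ℝ → ℝ} {C : ℝ} (hC : 0 ≤ C) (hp : IntegrableOn p K) (hq : IntegrableOn q K)
    (hp0 : ∀ w, 0 ≤ p w) (hq0 : ∀ w, 0 ≤ q w)
    (hcell : ∀ i j, (openGridBox h i j ∩ Ω).Nonempty → gridBox h i j ⊆ K →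
      ∫ w in gridBox h i j, p w ≤ C * ∫ w in gridBox h i j, q w) :
    ∫ w in Ω, p w ≤ C * ∫ w in K, q w := by
  set J : Set (ℤ × ℤ) := {k | (openGridBox h k.1 k.2 ∩ Ω).Nonempty} with hJ
  have hJK : ∀ k ∈ J, gridBox h k.1 k.2 ⊆ K := by
    rintro k ⟨w, hw, hwΩ⟩
    obtain ⟨i, j, hij, hsub⟩ := hcov w hwΩ
    obtain ⟨e1, e2⟩ := eq_of_mem_openGridBox hh hw hij
    rwa [e1, e2]
  set s : J → Set (ℝ × ℝ) := fun k => openGridBox h k.1.1 k.1.2 with hs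
  have hsm : ∀ k, MeasurableSet (s k) := fun k => measurableSet_openGridBox _ _ _
  have hsd : Pairwise (Function.onFun Disjoint s) := by
    intro k l hkl
    refine Set.disjoint_left.2 fun w hw hw' => hkl ?_
    obtain ⟨e1, e2⟩ := eq_of_mem_openGridBox hh hw (openGridBox_subset _ _ _ hw')
    exact Subtype.ext (Prod.ext e1 e2)
  have hsK : ⋃ k, s k ⊆ K := Set.iUnion_subset fun k =>
    (openGridBox_subset _ _ _).trans (hJK k.1 k.2)
  -- Open cells are disjoint, so their integrals add up, and they miss only null sets of grid lines.
  have hΩs : Ω ≤ᵐ[volume] ⋃ k, s k := by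
    filter_upwards [ae_mem_openGridBox (h := h)] with w hw hwΩ
    obtain ⟨i, j, hij, -⟩ := hcov w hwΩ
    exact Set.mem_iUnion.2 ⟨⟨(i, j), ⟨w, hw i j hij, hwΩ⟩⟩, hw i j hij⟩
  have h1 := hasSum_integral_iUnion hsm hsd (hp.mono_set hsK)
  have h2 := (hasSum_integral_iUnion hsm hsd (hq.mono_set hsK)).mul_left C
  calc ∫ w in Ω, p w ≤ ∫ w in ⋃ k, s k, p w :=
        setIntegral_mono_set (hp.mono_set hsK) (ae_of_all _ hp0) hΩs
    _ ≤ C * ∫ w in ⋃ k, s k, q w := by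
        refine hasSum_le (fun k => ?_) h1 h2
        have := hcell k.1.1 k.1.2 k.2 (hJK k.1 k.2)
        rwa [← setIntegral_congr_set (openGridBox_ae_eq h k.1.1 k.1.2),
          ← setIntegral_congr_set (openGridBox_ae_eq h k.1.1 k.1.2)] at this
    _ ≤ C * ∫ w in K, q w := mul_le_mul_of_nonneg_left
        (setIntegral_mono_set hq (ae_of_all _ hq0) hsK.eventuallyLE) hC

/-! ### The cellular stream function in product coordinates -/

/-- The stream function of the cellular flow in product coordinates. -/
def pairStream (m : ℕ) (w : ℝ × ℝ) : ℝ := cellStream m (pairEquiv w)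

theorem pairStream_apply (m : ℕ) (w : ℝ × ℝ) : pairStream m w =
    Real.sin (2 * Real.pi * m * w.1) * Real.cos (2 * Real.pi * m * w.2) := by
  simp [pairStream, cellStream, pairEquiv_apply]

theorem contDiff_pairStream (m : ℕ) : ContDiff ℝ 2 (pairStream m) :=
  (contDiff_cellStream m).comp pairEquiv.contDiff

theorem fderiv_pairStream (m : ℕ) (w v : ℝ × ℝ) :
    fderiv ℝ (pairStream m) w v = fderiv ℝ (cellStream m) (pairEquiv w) (pairEquiv v) := by
  have h1 := ((contDiff_cellStream (k := 1) m).differentiable one_ne_zero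
    (pairEquiv w)).hasFDerivAt
  have h2 : fderiv ℝ (pairStream m) w = _ := (h1.comp w pairEquiv.hasFDerivAt).fderiv
  rw [h2]
  rfl

theorem pairEquiv_one_zero : pairEquiv (1, 0) = EuclideanSpace.single (0 : Fin 2) (1 : ℝ) := by
  ext i; fin_cases i <;> simp [pairEquiv_apply]

theorem pairEquiv_zero_one : pairEquiv (0, 1) = EuclideanSpace.single (1 : Fin 2) (1 : ℝ) := by
  ext i; fin_cases i <;> simp [pairEquiv_apply]

theorem dX_pairStream (m : ℕ) (w : ℝ × ℝ) :
    dX (pairStream m) w = pderiv 0 (cellStream m) (pairEquiv w) := by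
  rw [dX, fderiv_pairStream, pairEquiv_one_zero, pderiv]

theorem dY_pairStream (m : ℕ) (w : ℝ × ℝ) :
    dY (pairStream m) w = pderiv 1 (cellStream m) (pairEquiv w) := by
  rw [dY, fderiv_pairStream, pairEquiv_zero_one, pderiv]

theorem sin_grid {m : ℕ} (hm : 1 ≤ m) (i : ℤ) :
    Real.sin (2 * Real.pi * m * (i * (1 / (2 * m)))) = 0 := by
  have hm' : (m : ℝ) ≠ 0 := by positivity
  rw [show 2 * Real.pi * m * (i * (1 / (2 * m))) = i * Real.pi by field_simp]
  exact Real.sin_int_mul_pi i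

theorem cos_grid {m : ℕ} (hm : 1 ≤ m) (j : ℤ) :
    Real.cos (2 * Real.pi * m * ((j - 1 / 2) * (1 / (2 * m)))) = 0 := by
  have hm' : (m : ℝ) ≠ 0 := by positivity
  rw [Real.cos_eq_zero_iff]
  exact ⟨j - 1, by push_cast; field_simp; ring⟩

theorem pairStream_left {m : ℕ} (hm : 1 ≤ m) (i : ℤ) (y : ℝ) :
    pairStream m (i * (1 / (2 * m)), y) = 0 := by
  rw [pairStream_apply, sin_grid hm, zero_mul]

theorem pairStream_right {m : ℕ} (hm : 1 ≤ m) (i : ℤ) (y : ℝ) :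
    pairStream m (i * (1 / (2 * m)) + 1 / (2 * m), y) = 0 := by
  have := pairStream_left hm (i + 1) y
  rwa [Int.cast_add, Int.cast_one, add_mul, one_mul] at this

theorem pairStream_bottom {m : ℕ} (hm : 1 ≤ m) (j : ℤ) (x : ℝ) :
    pairStream m (x, (j - 1 / 2) * (1 / (2 * m))) = 0 := by
  rw [pairStream_apply, cos_grid hm, mul_zero]

theorem pairStream_top {m : ℕ} (hm : 1 ≤ m) (j : ℤ) (x : ℝ) :
    pairStream m (x, (j - 1 / 2) * (1 / (2 * m)) + 1 / (2 * m)) = 0 := by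
  have := pairStream_bottom hm (j + 1) x
  rwa [show ((j + 1 : ℤ) - 1 / 2 : ℝ) * (1 / (2 * m)) =
    (j - 1 / 2) * (1 / (2 * m)) + 1 / (2 * m) by push_cast; ring] at this

/-- The sine vanishes only at integer multiples of 1/(2m) and the cosine only at half-odd ones,
which are the coordinates of the cell edges; no such number lies strictly between two consecutive
ones. -/
theorem pairStream_ne_zero {m : ℕ} (hm : 1 ≤ m) {i j : ℤ} {w : ℝ × ℝ}
    (hw : w ∈ openGridBox (1 / (2 * m)) i j) : pairStream m w ≠ 0 := by
  have hm' : (0 : ℝ) < m := by positivity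
  have hh : (0 : ℝ) < 1 / (2 * m) := by positivity
  have hmw : ∀ x : ℝ, x = (2 * m * x) * (1 / (2 * m)) := fun x => by field_simp
  rw [pairStream_apply]
  refine mul_ne_zero (fun h0 => ?_) fun h0 => ?_
  · obtain ⟨k, hk⟩ := Real.sin_eq_zero_iff.1 h0
    have e : w.1 = k * (1 / (2 * m)) := by
      have : (k : ℝ) = 2 * m * w.1 := by
        refine mul_right_cancel₀ Real.pi_ne_zero ?_
        rw [hk]; ring
      rw [this]; exact hmw _
    have h1 := hw.1.1
    have h2 := hw.1.2
    rw [e] at h1 h2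
    have a := lt_of_mul_lt_mul_right h1 hh.le
    have b : (k : ℝ) < i + 1 := lt_of_mul_lt_mul_right (h2.trans_eq (by ring)) hh.le
    have a' : i < k := by exact_mod_cast a
    have b' : k < i + 1 := by exact_mod_cast b
    omega
  · obtain ⟨k, hk⟩ := Real.cos_eq_zero_iff.1 h0
    have e : w.2 = (k + 1 / 2) * (1 / (2 * m)) := by
      have : (k + 1 / 2 : ℝ) = 2 * m * w.2 := by
        refine mul_right_cancel₀ Real.pi_ne_zero ?_
        linear_combination -hk
      rw [this]; exact hmw _
    have h1 := hw.2.1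
    have h2 := hw.2.2
    rw [e] at h1 h2
    have a := lt_of_mul_lt_mul_right h1 hh.le
    have b : (k + 1 / 2 : ℝ) < j + 1 / 2 := lt_of_mul_lt_mul_right (h2.trans_eq (by ring)) hh.le
    have a' : j < k + 1 := by
      have : (j : ℝ) < k + 1 := by linarith
      exact_mod_cast this
    have b' : k < j := by
      have : (k : ℝ) < j := by linarith
      exact_mod_cast this
    omega

theorem ae_pairStream_ne_zero {m : ℕ} (hm : 1 ≤ m) (i j : ℤ) :
    ∀ᵐ w ∂volume.restrict (gridBox (1 / (2 * m)) i j), pairStream m w ≠ 0 := by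
  rw [← Measure.restrict_congr_set (openGridBox_ae_eq _ i j)]
  filter_upwards [ae_restrict_mem (measurableSet_openGridBox _ _ _)] with w hw
  exact pairStream_ne_zero hm hw

theorem pairEquiv_mem_cell {m : ℕ} (hm : 1 ≤ m) (i j : ℤ) (w : ℝ × ℝ) :
    pairEquiv w ∈ cell m i j ↔ w ∈ gridBox (1 / (2 * m)) i j := by
  have hm' : (m : ℝ) ≠ 0 := by positivity
  have e1 : (i : ℝ) / (2 * m) = i * (1 / (2 * m)) := by ring
  have e2 : (i + 1 : ℝ) / (2 * m) = i * (1 / (2 * m)) + 1 / (2 * m) := by ring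
  have e3 : (2 * j - 1 : ℝ) / (4 * m) = (j - 1 / 2) * (1 / (2 * m)) := by field_simp; ring
  have e4 : (2 * j + 1 : ℝ) / (4 * m) = (j - 1 / 2) * (1 / (2 * m)) + 1 / (2 * m) := by
    field_simp; ring
  simp only [cell, gridBox, box, Set.mem_ofPred_eq, Set.mem_prod, pairEquiv_apply, e1, e2, e3, e4]
  simp

/-! ### Estimates on the cells -/

theorem strictMono_primitive {w : ℝ → ℝ} (hw : Continuous w) (hpos : ∀ x, 0 < w x) :
    StrictMono (fun p => ∫ s in (0 : ℝ)..p, w s) := by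
  refine strictMono_of_deriv_pos fun p => ?_
  have h : HasDerivAt (fun p => ∫ s in (0 : ℝ)..p, w s) (w p) p :=
    intervalIntegral.integral_hasDerivAt_right (hw.intervalIntegrable _ _)
      (hw.stronglyMeasurableAtFilter _ _) hw.continuousAt
  rw [h.deriv]
  exact hpos p

theorem abs_le_abs_of_strictMono {g : ℝ → ℝ} (hg : StrictMono g) (h0 : g 0 = 0) {s t : ℝ}
    (h : (0 ≤ g s ∧ g s ≤ g t) ∨ (g t ≤ g s ∧ g s ≤ 0)) : |s| ≤ |t| := by
  rcases h with ⟨h1, h2⟩ | ⟨h1, h2⟩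
  · rw [← h0, hg.le_iff_le] at h1
    rw [hg.le_iff_le] at h2
    rwa [abs_of_nonneg h1, abs_of_nonneg (h1.trans h2)]
  · rw [← h0, hg.le_iff_le] at h2
    rw [hg.le_iff_le] at h1
    rw [abs_of_nonpos h2, abs_of_nonpos (h1.trans h2)]
    linarith

theorem integral_sub_const_sq {α : Type*} [MeasurableSpace α] {μ : Measure α} [IsFiniteMeasure μ]
    {f : α → ℝ} (hf : MemLp f 2 μ) (c : ℝ) :
    ∫ z, (f z - c) ^ 2 ∂μ = (∫ z, f z ^ 2 ∂μ) - 2 * c * (∫ z, f z ∂μ) + c ^ 2 * μ.real Set.univ := by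
  have h1 : Integrable f μ := hf.integrable (by norm_num)
  have e : ∀ z, (f z - c) ^ 2 = (f z ^ 2 - 2 * c * f z) + c ^ 2 := fun z => by ring
  simp only [e]
  have h2 : Integrable (fun z => f z ^ 2 - 2 * c * f z) μ := hf.integrable_sq.sub (h1.const_mul _)
  rw [integral_add h2 (integrable_const _),
    integral_sub hf.integrable_sq (h1.const_mul _), integral_const_mul, integral_const,
    smul_eq_mul, mul_comm (c ^ 2)]

section Construction

variable {ρ χ : Plane → ℝ} {n : ℕ}

theorem strictMono_marginalCdf (hn : 1 ≤ n) (hρ : Continuous ρ) (hpos : ∀ z, 0 < ρ z)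
    (hχ : IsCutoff n χ) : StrictMono (marginalCdf ρ χ n) :=
  strictMono_primitive (continuous_marginal hn hρ hχ) (marginal_pos hn hρ hpos hχ)

theorem strictMono_conditionalCdf (hn : 1 ≤ n) (hρ : Continuous ρ) (hpos : ∀ z, 0 < ρ z)
    (hχ : IsCutoff n χ) (p : ℝ) : StrictMono (conditionalCdf ρ χ n p) :=
  (strictMono_primitive (continuous_torusDensity hn hρ hχ p)
    (fun q => torusDensity_pos hn hρ hpos hχ p q)).const_mul (inv_pos.2 (marginal_pos hn hρ hpos hχ p))

theorem norm_liftMap_sq (w : ℝ × ℝ) : ‖liftMap ρ χ n w‖ ^ 2 =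
    |transportP ρ χ n w.1| ^ 2 + |transportQ ρ χ n w.1 w.2| ^ 2 := by
  rw [EuclideanSpace.norm_sq_eq, Fin.sum_univ_two]
  simp [liftMap, transport, pairEquiv_apply]

theorem marginalCdf_transportP (hn : 1 ≤ n) (hρ : Continuous ρ) (hpos : ∀ z, 0 < ρ z)
    (hχ : IsCutoff n χ) (x : ℝ) : marginalCdf ρ χ n (transportP ρ χ n x) = x :=
  Function.rightInverse_invFun (bijective_marginalCdf hn hρ hpos hχ).2 x

theorem conditionalCdf_transportQ (hn : 1 ≤ n) (hρ : Continuous ρ) (hpos : ∀ z, 0 < ρ z)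
    (hχ : IsCutoff n χ) (x y : ℝ) :
    conditionalCdf ρ χ n (transportP ρ χ n x) (transportQ ρ χ n x y) = y :=
  Function.rightInverse_invFun (bijective_conditionalCdf hn hρ hpos hχ _).2 y

theorem marginalCdf_zero : marginalCdf ρ χ n 0 = 0 := by simp [marginalCdf]

theorem conditionalCdf_zero (p : ℝ) : conditionalCdf ρ χ n p 0 = 0 := by simp [conditionalCdf]

theorem transportQ_zero (hn : 1 ≤ n) (hρ : Continuous ρ) (hpos : ∀ z, 0 < ρ z)
    (hχ : IsCutoff n χ) (x : ℝ) : transportQ ρ χ n x 0 = 0 :=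
  (strictMono_conditionalCdf hn hρ hpos hχ (transportP ρ χ n x)).injective
    (by rw [conditionalCdf_transportQ hn hρ hpos hχ, conditionalCdf_zero])

theorem abs_transportP_le (hn : 1 ≤ n) (hρ : Continuous ρ) (hpos : ∀ z, 0 < ρ z)
    (hχ : IsCutoff n χ) {x x' : ℝ} (h : (0 ≤ x' ∧ x' ≤ x) ∨ (x ≤ x' ∧ x' ≤ 0)) :
    |transportP ρ χ n x'| ≤ |transportP ρ χ n x| :=
  abs_le_abs_of_strictMono (strictMono_marginalCdf hn hρ hpos hχ) marginalCdf_zero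
    (by simpa only [marginalCdf_transportP hn hρ hpos hχ] using h)

theorem abs_transportQ_le (hn : 1 ≤ n) (hρ : Continuous ρ) (hpos : ∀ z, 0 < ρ z)
    (hχ : IsCutoff n χ) (x : ℝ) {y y' : ℝ} (h : (0 ≤ y' ∧ y' ≤ y) ∨ (y ≤ y' ∧ y' ≤ 0)) :
    |transportQ ρ χ n x y'| ≤ |transportQ ρ χ n x y| :=
  abs_le_abs_of_strictMono (strictMono_conditionalCdf hn hρ hpos hχ (transportP ρ χ n x))
    (conditionalCdf_zero _) (by simpa only [conditionalCdf_transportQ hn hρ hpos hχ] using h)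

/-- The first coordinate of the image depends on x alone, while the second is increasing in y and
vanishes at y = 0. So vertical moves towards the axis keep the point in the preimage of a centred
ball. -/
theorem norm_liftMap_le_vertical (hn : 1 ≤ n) (hρ : Continuous ρ) (hpos : ∀ z, 0 < ρ z)
    (hχ : IsCutoff n χ) (x : ℝ) {y y' : ℝ} (h : (0 ≤ y' ∧ y' ≤ y) ∨ (y ≤ y' ∧ y' ≤ 0)) :
    ‖liftMap ρ χ n (x, y')‖ ≤ ‖liftMap ρ χ n (x, y)‖ := by
  refine le_of_sq_le_sq ?_ (norm_nonneg _)
  rw [norm_liftMap_sq, norm_liftMap_sq]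
  have := abs_transportQ_le hn hρ hpos hχ x h
  gcongr

/-- The new point is taken on the axis y = 0, where the second coordinate of the image is zero. At
another height that coordinate varies with x and could grow. -/
theorem norm_liftMap_le_horizontal (hn : 1 ≤ n) (hρ : Continuous ρ) (hpos : ∀ z, 0 < ρ z)
    (hχ : IsCutoff n χ) {x x' : ℝ} (y : ℝ) (h : (0 ≤ x' ∧ x' ≤ x) ∨ (x ≤ x' ∧ x' ≤ 0)) :
    ‖liftMap ρ χ n (x', 0)‖ ≤ ‖liftMap ρ χ n (x, y)‖ := by
  refine le_of_sq_le_sq ?_ (norm_nonneg _)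
  rw [norm_liftMap_sq, norm_liftMap_sq]
  have := abs_transportP_le hn hρ hpos hχ h
  simp only [transportQ_zero hn hρ hpos hχ, abs_zero]
  have h2 := sq_nonneg |transportQ ρ χ n x y|
  have h3 : |transportP ρ χ n x'| ^ 2 ≤ |transportP ρ χ n x| ^ 2 := by gcongr
  linarith

theorem liftMap_zero (hn : 1 ≤ n) (hρ : Continuous ρ) (hpos : ∀ z, 0 < ρ z)
    (hχ : IsCutoff n χ) : liftMap ρ χ n (0, 0) = 0 := by
  have h0 : transportP ρ χ n 0 = 0 := (strictMono_marginalCdf hn hρ hpos hχ).injective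
    (by rw [marginalCdf_transportP hn hρ hpos hχ, marginalCdf_zero])
  have := norm_liftMap_sq (ρ := ρ) (χ := χ) (n := n) (0, 0)
  rw [h0, transportQ_zero hn hρ hpos hχ] at this
  simpa using this

theorem measurableEmbedding_liftMap (hn : 1 ≤ n) (hρ : ContDiff ℝ 1 ρ) (hpos : ∀ z, 0 < ρ z)
    (hχ : IsCutoff n χ) : MeasurableEmbedding (liftMap ρ χ n) := by
  obtain ⟨e, -, he, -⟩ := exists_cdf_homeomorph hn hρ hpos hχ
  have : liftMap ρ χ n = pairEquiv.toHomeomorph.trans e.symm := by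
    funext w
    rw [liftMap, ← he]
    rfl
  rw [this]
  exact (Homeomorph.measurableEmbedding _)

theorem integral_comp_liftMap (hn : 1 ≤ n) (hρ : ContDiff ℝ 1 ρ) (hpos : ∀ z, 0 < ρ z)
    (hχ : IsCutoff n χ) {S : Set Plane} (hS : MeasurableSet S) (hSb : S ⊆ ball 0 (3 * n / 2))
    (p : Plane → ℝ) : ∫ w in liftMap ρ χ n ⁻¹' S, p (liftMap ρ χ n w) =
      (normConst ρ χ n)⁻¹ * ∫ z in S, p z * ρ z := by
  have hM := normConst_pos hn hρ.continuous hpos hχ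
  have hmeas : Measurable fun z => ENNReal.ofReal ((normConst ρ χ n)⁻¹ * ρ z) :=
    (hρ.continuous.measurable.const_mul _).ennreal_ofReal
  rw [(measurePreserving_liftMap_restrict hn hρ hpos hχ hS hSb).integral_comp
    (measurableEmbedding_liftMap hn hρ hpos hχ) p,
    integral_withDensity_eq_integral_toReal_smul hmeas (ae_of_all _ fun _ => ENNReal.ofReal_lt_top),
    ← integral_const_mul]
  refine integral_congr_ae (ae_of_all _ fun z => ?_)
  simp only [smul_eq_mul]
  rw [ENNReal.toReal_ofReal (mul_nonneg (inv_nonneg.2 hM.le) (hpos z).le)]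
  ring

theorem ae_comp_liftMap (hn : 1 ≤ n) (hρ : ContDiff ℝ 1 ρ) (hpos : ∀ z, 0 < ρ z)
    (hχ : IsCutoff n χ) {P : Plane → Prop}
    (hP : ∀ᵐ z ∂volume.restrict (ball (0 : Plane) (3 * n / 2)), P z) :
    ∀ᵐ w ∂volume.restrict (liftMap ρ χ n ⁻¹' ball 0 (3 * n / 2)), P (liftMap ρ χ n w) :=
  (measurePreserving_liftMap_restrict hn hρ hpos hχ measurableSet_ball
    le_rfl).quasiMeasurePreserving.ae (withDensity_absolutelyContinuous _ _ hP)

/-- On this ball the flow is the pushforward of the cellular flow, so v·∇f pulls back to the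
Jacobian expression of Green's formula on the cells. -/
theorem liftGrad_stream (hn : 1 ≤ n) (hρ : ContDiff ℝ 1 ρ) (hpos : ∀ z, 0 < ρ z)
    (hχ : IsCutoff n χ) (m : ℕ) (G : Fin 2 → Plane → ℝ) {w : ℝ × ℝ}
    (hw : liftMap ρ χ n w ∈ ball (0 : Plane) (3 * n / 2)) :
    liftGrad ρ χ n G (0, 1) w * dX (pairStream m) w - liftGrad ρ χ n G (1, 0) w *
      dY (pairStream m) w = ∑ i, G i (liftMap ρ χ n w) * planeFlow ρ χ n m (liftMap ρ χ n w) i := by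
  have h1 : cellFlow m (pairEquiv w) =
      pairEquiv (dX (pairStream m) w • (0, 1) - dY (pairStream m) w • (1, 0)) := by
    rw [dX_pairStream, dY_pairStream, cellFlow, perpGrad]
    simp [pairEquiv_apply]
  have h2 : planeFlow ρ χ n m (liftMap ρ χ n w) = dX (pairStream m) w •
      fderiv ℝ (liftMap ρ χ n) w (0, 1) - dY (pairStream m) w •
      fderiv ℝ (liftMap ρ χ n) w (1, 0) := by
    rw [planeFlow_eq_pushforward hn hρ hpos hχ m hw, cdfMap_liftMap hn hρ hpos hχ, h1,
      ← fderiv_liftMap hn hρ hpos hχ, map_sub, map_smul, map_smul]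
  rw [h2]
  simp only [liftGrad, Fin.sum_univ_two, PiLp.sub_apply, PiLp.smul_apply, smul_eq_mul]
  ring

theorem liftGrad_sq_le {L : ℝ} {w v : ℝ × ℝ} {G : Fin 2 → Plane → ℝ}
    (hL : ∀ i, |fderiv ℝ (liftMap ρ χ n) w v i| ≤ L) :
    liftGrad ρ χ n G v w ^ 2 ≤ 2 * L ^ 2 * ∑ i, G i (liftMap ρ χ n w) ^ 2 := by
  have h : ∀ i, (fderiv ℝ (liftMap ρ χ n) w v i) ^ 2 ≤ L ^ 2 := fun i => by
    rw [← sq_abs]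
    exact pow_le_pow_left₀ (abs_nonneg _) (hL i) 2
  have h0 := h 0
  have h1 := h 1
  simp only [liftGrad, Fin.sum_univ_two]
  set a := G 0 (liftMap ρ χ n w)
  set b := G 1 (liftMap ρ χ n w)
  set c := fderiv ℝ (liftMap ρ χ n) w v 0
  set d := fderiv ℝ (liftMap ρ χ n) w v 1
  calc (a * c + b * d) ^ 2 ≤ (c ^ 2 + d ^ 2) * (a ^ 2 + b ^ 2) := by
        nlinarith [sq_nonneg (a * d - b * c)]
    _ ≤ 2 * L ^ 2 * (a ^ 2 + b ^ 2) := by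
        refine mul_le_mul_of_nonneg_right (by linarith) (by positivity)

theorem gridBox_subset_iff {m : ℕ} (hm : 1 ≤ m) (i j : ℤ) (S : Set Plane) :
    transport ρ χ n '' cell m i j ⊆ S ↔ gridBox (1 / (2 * m)) i j ⊆ liftMap ρ χ n ⁻¹' S := by
  constructor
  · intro h w hw
    exact h ⟨pairEquiv w, (pairEquiv_mem_cell hm i j w).2 hw, rfl⟩
  · rintro h _ ⟨z, hz, rfl⟩
    have hz' : pairEquiv (pairEquiv.symm z) = z := pairEquiv.apply_symm_apply z
    rw [← hz'] at hz ⊢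
    exact h ((pairEquiv_mem_cell hm i j _).1 hz)

theorem exists_gridBox (hn : 1 ≤ n) (hρ : ContDiff ℝ 1 ρ) (hpos : ∀ z, 0 < ρ z)
    (hχ : IsCutoff n χ) {m : ℕ} (hm : 1 ≤ m) (hcov : ball (0 : Plane) n ⊆ cellRegion ρ χ n m)
    (w : ℝ × ℝ) (hw : w ∈ liftMap ρ χ n ⁻¹' ball 0 n) :
    ∃ i j, w ∈ gridBox (1 / (2 * m)) i j ∧
      gridBox (1 / (2 * m)) i j ⊆ liftMap ρ χ n ⁻¹' ball 0 (3 * n / 2) := by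
  have := hcov hw
  simp only [cellRegion, Set.mem_iUnion] at this
  obtain ⟨i, j, hsub, z, hz, hzw⟩ := this
  refine ⟨i, j, ?_, (gridBox_subset_iff hm i j _).1 hsub⟩
  rw [← pairEquiv_mem_cell hm]
  have : z = pairEquiv w := by
    rw [← cdfMap_transport hn hρ.continuous hpos hχ z, hzw, cdfMap_liftMap hn hρ hpos hχ]
  rwa [← this]

/-- The part common to both cases of the eigenvalue. Hypothesis `ht` asks that on each cell t do no
worse than the left edge average: with zero eigenvalue t is that average, and otherwise t = 0 is the
cell mean. Poincaré on the cells is then summed and transferred back to the plane. -/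
theorem setIntegral_sub_sq_le (hn : 1 ≤ n) (hρ : ContDiff ℝ 1 ρ) (hpos : ∀ z, 0 < ρ z)
    (hχ : IsCutoff n χ) {L : ℝ} (hL : ∀ w, liftMap ρ χ n w ∈ ball (0 : Plane) (3 * n / 2) →
      ∀ v : ℝ × ℝ, ‖v‖ ≤ 1 → ∀ i, |fderiv ℝ (liftMap ρ χ n) w v i| ≤ L) {m : ℕ} (hm : 1 ≤ m)
    (hcov : ball (0 : Plane) n ⊆ cellRegion ρ χ n m) {f : Plane → ℝ} {G : Fin 2 → Plane → ℝ}
    {u : ℕ → ℝ × ℝ → ℝ}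
    (H : StrongLimit (liftMap ρ χ n ⁻¹' ball 0 (3 * n / 2)) u (fun w => f (liftMap ρ χ n w))
      (liftGrad ρ χ n G (1, 0)) (liftGrad ρ χ n G (0, 1)))
    (hG : ∀ i, MemLp (G i) 2 (volume.restrict (ball 0 (3 * n / 2)))) (t : ℝ)
    (ht : ∀ i j : ℤ, (openGridBox (1 / (2 * m)) i j ∩ liftMap ρ χ n ⁻¹' ball 0 n).Nonempty →
      gridBox (1 / (2 * m)) i j ⊆ liftMap ρ χ n ⁻¹' ball 0 (3 * n / 2) →
      ∫ w in gridBox (1 / (2 * m)) i j, (f (liftMap ρ χ n w) - t) ^ 2 ≤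
        ∫ w in gridBox (1 / (2 * m)) i j, (f (liftMap ρ χ n w) -
          edgeL (i * (1 / (2 * m))) ((j - 1 / 2) * (1 / (2 * m))) (1 / (2 * m))
            (fun w => f (liftMap ρ χ n w)) (liftGrad ρ χ n G (1, 0))) ^ 2) :
    ∫ z in ball 0 n, (f z - t) ^ 2 * ρ z ≤
      2 * L ^ 2 / m ^ 2 * ∫ z in ball 0 (3 * n / 2), (∑ i, G i z ^ 2) * ρ z := by
  have hm' : (0 : ℝ) < m := by positivity
  have hh : (0 : ℝ) < 1 / (2 * m) := by positivity
  have hM := normConst_pos hn hρ.continuous hpos hχ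
  have hnn : ball (0 : Plane) n ⊆ ball 0 (3 * n / 2) := by
    refine ball_subset_ball ?_
    have : (0 : ℝ) ≤ n := by positivity
    linarith
  set K := liftMap ρ χ n ⁻¹' ball 0 (3 * n / 2) with hK
  have hKfin : volume K < ⊤ := (measure_mono (Set.preimage_mono ball_subset_closedBall)).trans_lt
    (isCompact_preimage_liftMap hn hρ hpos hχ (isCompact_closedBall 0 (3 * n / 2))).measure_lt_top
  have : IsFiniteMeasure (volume.restrict K) := ⟨by simpa using hKfin⟩
  have hp : IntegrableOn (fun w => (f (liftMap ρ χ n w) - t) ^ 2) K :=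
    (H.memLp.sub (memLp_const t)).integrable_sq
  have hq : IntegrableOn (fun w => ∑ i, G i (liftMap ρ χ n w) ^ 2) K :=
    integrable_finsetSum _ fun i _ => (memLp_comp_liftMap hn hρ hpos hχ (hG i)).integrable_sq
  have hv1 : ‖((1, 0) : ℝ × ℝ)‖ ≤ 1 := by simp [Prod.norm_def]
  have hv2 : ‖((0, 1) : ℝ × ℝ)‖ ≤ 1 := by simp [Prod.norm_def]
  have key := setIntegral_le_of_cells hh (Ω := liftMap ρ χ n ⁻¹' ball 0 n) (K := K)
    (exists_gridBox hn hρ hpos hχ hm hcov) (C := 2 * L ^ 2 / m ^ 2) (by positivity) hp hq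
    (fun w => sq_nonneg _) (fun w => Finset.sum_nonneg fun i _ => sq_nonneg _)
    (fun i j hne hsub => by
      have Hb := H.mono hsub
      refine (ht i j hne hsub).trans ((Hb.poincare hh).trans ?_)
      have hqb := hq.mono_set hsub
      have hle : ∀ v : ℝ × ℝ, ‖v‖ ≤ 1 → MemLp (liftGrad ρ χ n G v) 2 (volume.restrict
          (gridBox (1 / (2 * m)) i j)) →
          ∫ w in gridBox (1 / (2 * m)) i j, liftGrad ρ χ n G v w ^ 2 ≤
          2 * L ^ 2 * ∫ w in gridBox (1 / (2 * m)) i j, ∑ i, G i (liftMap ρ χ n w) ^ 2 := by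
        intro v hv hmem
        rw [← integral_const_mul]
        refine integral_mono_ae hmem.integrable_sq (hqb.const_mul _) ?_
        filter_upwards [ae_restrict_mem (measurableSet_box _ _ _)] with w hw
        exact liftGrad_sq_le (hL w (hsub hw) v hv)
      have e1 := hle _ hv1 Hb.memLp_fst
      have e2 := hle _ hv2 Hb.memLp_snd
      set X := ∫ w in gridBox (1 / (2 * m)) i j, ∑ i, G i (liftMap ρ χ n w) ^ 2
      -- Poincaré constant 2h² with h = 1/(2m); each of the two partial derivatives contributes at
      -- most 2L² times the energy.
      calc _ ≤ 2 * (1 / (2 * m)) ^ 2 * (2 * L ^ 2 * X + 2 * L ^ 2 * X) :=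
            mul_le_mul_of_nonneg_left (add_le_add e1 e2) (by positivity)
        _ = 2 * L ^ 2 / m ^ 2 * X := by field_simp; ring)
  rw [integral_comp_liftMap hn hρ hpos hχ measurableSet_ball hnn (fun z => (f z - t) ^ 2),
    integral_comp_liftMap hn hρ hpos hχ measurableSet_ball le_rfl (fun z => ∑ i, G i z ^ 2),
    mul_left_comm] at key
  exact le_of_mul_le_mul_left key (inv_pos.2 hM)

/-- If `v · ∇f = 0` on the cells, then `f` is within the Poincaré constant of the cells of a single
constant. -/
theorem exists_setIntegral_sub_sq_le (hn : 1 ≤ n) (hρ : ContDiff ℝ 1 ρ) (hpos : ∀ z, 0 < ρ z)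
    (hχ : IsCutoff n χ) {L : ℝ} (hL : ∀ w, liftMap ρ χ n w ∈ ball (0 : Plane) (3 * n / 2) →
      ∀ v : ℝ × ℝ, ‖v‖ ≤ 1 → ∀ i, |fderiv ℝ (liftMap ρ χ n) w v i| ≤ L) {m : ℕ} (hm : 1 ≤ m)
    (hcov : ball (0 : Plane) n ⊆ cellRegion ρ χ n m) {f : Plane → ℝ} {G : Fin 2 → Plane → ℝ}
    (h : RealWeakGradient f G) (hf : ∀ R, MemLp f 2 (volume.restrict (ball 0 R)))
    (hG : ∀ i R, MemLp (G i) 2 (volume.restrict (ball 0 R)))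
    (heq : ∀ᵐ z ∂volume.restrict (ball (0 : Plane) (3 * n / 2)),
      ∑ i, G i z * planeFlow ρ χ n m z i = 0) :
    ∃ t, ∫ z in ball 0 n, (f z - t) ^ 2 * ρ z ≤
      2 * L ^ 2 / m ^ 2 * ∫ z in ball 0 (3 * n / 2), (∑ i, G i z ^ 2) * ρ z := by
  have hm' : (0 : ℝ) < m := by positivity
  have hh : (0 : ℝ) < 1 / (2 * m) := by positivity
  obtain ⟨u, H⟩ := exists_strongLimit hn hρ hpos hχ h hf hG
  set K := liftMap ρ χ n ⁻¹' ball 0 (3 * n / 2) with hK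
  set Ω := liftMap ρ χ n ⁻¹' ball 0 n with hΩ
  have hcont := (contDiff_liftMap hn hρ hpos hχ).continuous
  have hKm : MeasurableSet K := measurableSet_ball.preimage hcont.measurable
  have hJK : ∀ i j : ℤ, (openGridBox (1 / (2 * m)) i j ∩ Ω).Nonempty →
      gridBox (1 / (2 * m)) i j ⊆ K := by
    rintro i j ⟨w, hw, hwΩ⟩
    obtain ⟨i', j', hij, hsub⟩ := exists_gridBox hn hρ hpos hχ hm hcov w hwΩ
    obtain ⟨e1, e2⟩ := eq_of_mem_openGridBox hh hw hij
    rwa [e1, e2]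
  have hstream : ∀ᵐ w ∂volume.restrict K, liftGrad ρ χ n G (0, 1) w * dX (pairStream m) w -
      liftGrad ρ χ n G (1, 0) w * dY (pairStream m) w = 0 := by
    filter_upwards [ae_comp_liftMap hn hρ hpos hχ heq, ae_restrict_mem hKm] with w hw hwK
    rw [liftGrad_stream hn hρ hpos hχ m G hwK, hw]
  set f' : ℝ × ℝ → ℝ := fun w => f (liftMap ρ χ n w) with hf'
  set g₁ := liftGrad ρ χ n G (1, 0) with hg₁
  set g₂ := liftGrad ρ χ n G (0, 1) with hg₂
  have edges : ∀ i j : ℤ, (openGridBox (1 / (2 * m)) i j ∩ Ω).Nonempty → _ := fun i j hij =>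
    StrongLimit.edges_eq hh (H.mono (hJK i j hij)) (contDiff_pairStream m)
      (pairStream_left hm i) (pairStream_right hm i) (pairStream_bottom hm j)
      (pairStream_top hm j) (ae_pairStream_ne_zero hm i j)
      (ae_restrict_of_ae_restrict_of_subset (hJK i j hij) hstream)
  -- The quantity propagated is the left edge average. Sideways it goes from left to top to right
  -- edge and across the shared edge; upwards across the shared edge and then from bottom through
  -- right and top to left edge of the next cell.
  have hconst := fun i j (hij : (openGridBox (1 / (2 * m)) i j ∩ Ω).Nonempty) => const_on_cells hh
    (isOpen_ball.preimage hcont)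
    (by simpa [hΩ, liftMap_zero hn hρ.continuous hpos hχ] using Nat.pos_of_ne_zero (by omega))
    (fun x y y' hxy hy => by
      rw [Set.mem_preimage, mem_ball_zero_iff] at hxy ⊢
      exact (norm_liftMap_le_vertical hn hρ.continuous hpos hχ x hy).trans_lt hxy)
    (fun x y x' hxy hx => by
      rw [Set.mem_preimage, mem_ball_zero_iff] at hxy ⊢
      exact (norm_liftMap_le_horizontal hn hρ.continuous hpos hχ y hx).trans_lt hxy)
    (t := fun i j => edgeL (i * (1 / (2 * m))) ((j - 1 / 2) * (1 / (2 * m))) (1 / (2 * m)) f' g₁)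
    (fun i j h1 h2 => by
      obtain ⟨a1, a2, -⟩ := edges i j h1
      have H' := H.mono (hJK _ _ h2)
      have e : ((i + 1 : ℤ) : ℝ) * (1 / (2 * m)) = i * (1 / (2 * m)) + 1 / (2 * m) := by
        push_cast; ring
      rw [gridBox, e] at H'
      have := StrongLimit.edgeR_eq_edgeL hh (H.mono (hJK _ _ h1)) H'
      simp only [e]
      rw [← this, a1, a2])
    (fun i j h1 h2 => by
      obtain ⟨a1, -, -⟩ := edges i j h1
      obtain ⟨b1, b2, b3⟩ := edges i (j + 1) h2
      have H' := H.mono (hJK _ _ h2)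
      have e : (((j + 1 : ℤ) : ℝ) - 1 / 2) * (1 / (2 * m)) =
          (j - 1 / 2) * (1 / (2 * m)) + 1 / (2 * m) := by
        push_cast; ring
      rw [gridBox, e] at H'
      have := StrongLimit.edgeT_eq_edgeB hh (H.mono (hJK _ _ h1)) H'
      rw [e] at b1 b2 b3
      simp only [e]
      rw [a1, this, b1, b2, b3])
    hij
  exact ⟨_, setIntegral_sub_sq_le hn hρ hpos hχ hL hm hcov H (fun i => hG i _)
    (edgeL ((0 : ℤ) * (1 / (2 * m))) (((0 : ℤ) - 1 / 2) * (1 / (2 * m))) (1 / (2 * m)) f' g₁)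
    fun i j hij _ => by rw [hconst i j hij]⟩

/-- If `c f = v · ∇f'` on the cells for some `c ≠ 0`, then `f` has mean zero on the cells. -/
theorem setIntegral_sq_le_of_eigen (hn : 1 ≤ n) (hρ : ContDiff ℝ 1 ρ) (hpos : ∀ z, 0 < ρ z)
    (hχ : IsCutoff n χ) {L : ℝ} (hL : ∀ w, liftMap ρ χ n w ∈ ball (0 : Plane) (3 * n / 2) →
      ∀ v : ℝ × ℝ, ‖v‖ ≤ 1 → ∀ i, |fderiv ℝ (liftMap ρ χ n) w v i| ≤ L) {m : ℕ} (hm : 1 ≤ m)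
    (hcov : ball (0 : Plane) n ⊆ cellRegion ρ χ n m) {f f' : Plane → ℝ} {G G' : Fin 2 → Plane → ℝ}
    (h : RealWeakGradient f G) (hf : ∀ R, MemLp f 2 (volume.restrict (ball 0 R)))
    (hG : ∀ i R, MemLp (G i) 2 (volume.restrict (ball 0 R)))
    (h' : RealWeakGradient f' G') (hf' : ∀ R, MemLp f' 2 (volume.restrict (ball 0 R)))
    (hG' : ∀ i R, MemLp (G' i) 2 (volume.restrict (ball 0 R))) {c : ℝ} (hc : c ≠ 0)
    (heq : ∀ᵐ z ∂volume.restrict (ball (0 : Plane) (3 * n / 2)),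
      ∑ i, G' i z * planeFlow ρ χ n m z i = c * f z) :
    ∫ z in ball 0 n, f z ^ 2 * ρ z ≤
      2 * L ^ 2 / m ^ 2 * ∫ z in ball 0 (3 * n / 2), (∑ i, G i z ^ 2) * ρ z := by
  have hm' : (0 : ℝ) < m := by positivity
  have hh : (0 : ℝ) < 1 / (2 * m) := by positivity
  obtain ⟨u, H⟩ := exists_strongLimit hn hρ hpos hχ h hf hG
  obtain ⟨u', H'⟩ := exists_strongLimit hn hρ hpos hχ h' hf' hG'
  have hKm : MeasurableSet (liftMap ρ χ n ⁻¹' ball 0 (3 * n / 2)) :=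
    measurableSet_ball.preimage (contDiff_liftMap hn hρ hpos hχ).continuous.measurable
  have hstream : ∀ᵐ w ∂volume.restrict (liftMap ρ χ n ⁻¹' ball 0 (3 * n / 2)),
      liftGrad ρ χ n G' (0, 1) w * dX (pairStream m) w -
      liftGrad ρ χ n G' (1, 0) w * dY (pairStream m) w = c * f (liftMap ρ χ n w) := by
    filter_upwards [ae_comp_liftMap hn hρ hpos hχ heq, ae_restrict_mem hKm] with w hw hwK
    rw [liftGrad_stream hn hρ hpos hχ m G' hwK, hw]
  have := setIntegral_sub_sq_le hn hρ hpos hχ hL hm hcov H (fun i => hG i _) 0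
    fun i j _ hsub => by
      -- Green's formula with the stream function itself as test function: c times the integral of f
      -- over the cell is zero.
      have hg := StrongLimit.green hh (H'.mono hsub) (contDiff_pairStream m)
        (pairStream_left hm i) (pairStream_right hm i) (pairStream_bottom hm j)
        (pairStream_top hm j)
      rw [← gridBox, integral_congr_ae (ae_restrict_of_ae_restrict_of_subset hsub hstream),
        integral_const_mul] at hg
      have hg0 := (mul_eq_zero.1 hg).resolve_left hc
      have hfin : IsFiniteMeasure (volume.restrict (gridBox (1 / (2 * m)) i j)) :=
        ⟨by
          rw [Measure.restrict_apply_univ]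
          exact (isCompact_box _ _ _).measure_lt_top⟩
      have hmem := (H.mono hsub).memLp
      -- As the cell mean is zero, subtracting any constant, in particular the edge average, can
      -- only increase the integral of the square.
      rw [integral_sub_const_sq hmem, integral_sub_const_sq hmem]
      have hg1 : ∫ w in gridBox (1 / (2 * m)) i j, f (liftMap ρ χ n w) = 0 := hg0
      rw [hg1]
      have := measureReal_nonneg (μ := volume.restrict (gridBox (1 / (2 * m)) i j)) (s := Set.univ)
      simp only [mul_zero, sub_zero, ne_eq, OfNat.ofNat_ne_zero, not_false_eq_true, zero_pow,
        zero_mul, add_zero, le_add_iff_nonneg_right]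
      positivity
  simpa using this

end Construction

/-! ### Real and imaginary parts of eigenfunctions -/

theorem locallyIntegrable_clm_comp {E F : Type*} [NormedAddCommGroup E] [NormedSpace ℝ E]
    [NormedAddCommGroup F] [NormedSpace ℝ F] {f : Plane → E} (hf : LocallyIntegrable f volume)
    (L : E →L[ℝ] F) : LocallyIntegrable (fun z => L (f z)) volume := fun x => by
  obtain ⟨s, hs, hi⟩ := hf x
  exact ⟨s, hs, L.integrable_comp hi⟩

/-- Test functions are real, so a real linear functional passes through the products and the
integrals. It is applied to the real and imaginary parts. -/
theorem HasWeakGradient.clm_comp {φ : Plane → ℂ} {g : Plane → EuclideanSpace ℂ (Fin 2)}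
    (h : HasWeakGradient φ g) (L : ℂ →L[ℝ] ℝ) :
    RealWeakGradient (fun z => L (φ z)) (fun i z => L (g z i)) := by
  obtain ⟨h1, h2, h3⟩ := h
  have h2' : ∀ i, LocallyIntegrable (fun z => g z i) volume := fun i =>
    locallyIntegrable_clm_comp h2 ((EuclideanSpace.proj (𝕜 := ℂ) i).restrictScalars ℝ)
  refine ⟨locallyIntegrable_clm_comp h1 L, fun i => locallyIntegrable_clm_comp (h2' i) L,
    fun ψ hψ hψc i => ?_⟩
  have hL : ∀ (c : ℂ) (r : ℝ), L c * r = L (c * (r : ℂ)) := fun c r => by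
    rw [mul_comm c, ← Complex.real_smul, map_smul, smul_eq_mul, mul_comm]
  have hsm : ∀ (c : ℂ) (r : ℝ), c * (r : ℂ) = r • c := fun c r => by
    rw [Complex.real_smul, mul_comm]
  have hpc : Continuous (pderiv i ψ) :=
    (contDiff_pderiv (k := 0) (hψ.of_le (by simp)) i).continuous
  have hps : HasCompactSupport (pderiv i ψ) := hψc.fderiv_apply ℝ _
  have i1 : Integrable (fun z => φ z * (pderiv i ψ z : ℂ)) volume := by
    simp only [hsm]
    exact h1.integrable_smul_left_of_hasCompactSupport hpc hps
  have i2 : Integrable (fun z => g z i * (ψ z : ℂ)) volume := by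
    simp only [hsm]
    exact (h2' i).integrable_smul_left_of_hasCompactSupport hψ.continuous hψc
  simp only [hL]
  rw [L.integral_comp_comm i1, L.integral_comp_comm i2, h3 ψ hψ hψc i, map_neg]

/-! ### The Gibbs measure -/

section Gibbs

variable {U : Plane → ℝ}

theorem measurable_gibbs (hU : ContDiff ℝ 2 U) :
    Measurable fun z => ENNReal.ofReal (gibbsDensity U z) :=
  (contDiff_gibbsDensity hU).continuous.measurable.ennreal_ofReal

theorem setIntegral_gibbs (hU : ContDiff ℝ 2 U)
    (hint : Integrable (fun z => Real.exp (-U z)) volume) {S : Set Plane} (hS : MeasurableSet S)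
    (p : Plane → ℝ) : ∫ z in S, p z ∂gibbsMeasure U = ∫ z in S, p z * gibbsDensity U z := by
  rw [gibbsMeasure, setIntegral_withDensity_eq_setIntegral_toReal_smul (measurable_gibbs hU)
    (ae_of_all _ fun _ => ENNReal.ofReal_lt_top) _ hS]
  refine integral_congr_ae (ae_of_all _ fun z => ?_)
  simp only [smul_eq_mul]
  rw [ENNReal.toReal_ofReal (gibbsDensity_pos hint z).le, mul_comm]

theorem integral_gibbs (hU : ContDiff ℝ 2 U)
    (hint : Integrable (fun z => Real.exp (-U z)) volume) (p : Plane → ℝ) :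
    ∫ z, p z ∂gibbsMeasure U = ∫ z, p z * gibbsDensity U z := by
  simpa using setIntegral_gibbs hU hint MeasurableSet.univ p

theorem integrable_gibbs (hU : ContDiff ℝ 2 U)
    (hint : Integrable (fun z => Real.exp (-U z)) volume) {p : Plane → ℝ}
    (hp : Integrable p (gibbsMeasure U)) : Integrable (fun z => p z * gibbsDensity U z) volume := by
  rw [gibbsMeasure, integrable_withDensity_iff_integrable_smul' (measurable_gibbs hU)
    (ae_of_all _ fun _ => ENNReal.ofReal_lt_top)] at hp
  refine hp.congr (ae_of_all _ fun z => ?_)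
  simp only [smul_eq_mul]
  rw [ENNReal.toReal_ofReal (gibbsDensity_pos hint z).le, mul_comm]

theorem isProbabilityMeasure_gibbs
    (hint : Integrable (fun z => Real.exp (-U z)) volume) :
    IsProbabilityMeasure (gibbsMeasure U) := by
  have hi : Integrable (gibbsDensity U) volume := hint.div_const _
  refine ⟨?_⟩
  rw [gibbsMeasure, withDensity_apply _ MeasurableSet.univ, Measure.restrict_univ,
    ← ofReal_integral_eq_lintegral_ofReal hi (ae_of_all _ fun z => (gibbsDensity_pos hint z).le),
    integral_gibbsDensity hint, ENNReal.ofReal_one]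

theorem absolutelyContinuous_gibbs (hU : ContDiff ℝ 2 U)
    (hint : Integrable (fun z => Real.exp (-U z)) volume) : volume ≪ gibbsMeasure U :=
  withDensity_absolutelyContinuous' (measurable_gibbs hU).aemeasurable
    (ae_of_all _ fun z => (ENNReal.ofReal_pos.2 (gibbsDensity_pos hint z)).ne')

/-- The density is bounded below by a positive constant on each ball, so weighted integrability
gives local integrability for Lebesgue measure, where mollification works. -/
theorem memLp_restrict_ball_of_gibbs (hU : ContDiff ℝ 2 U)
    (hint : Integrable (fun z => Real.exp (-U z)) volume) {f : Plane → ℝ}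
    (hf : MemLp f 2 (gibbsMeasure U)) (R : ℝ) : MemLp f 2 (volume.restrict (ball 0 R)) := by
  obtain ⟨c, hc, hcU⟩ : ∃ c > 0, ∀ z ∈ closedBall (0 : Plane) R, c ≤ gibbsDensity U z := by
    rcases (closedBall (0 : Plane) R).eq_empty_or_nonempty with h | h
    · exact ⟨1, one_pos, by simp [h]⟩
    obtain ⟨z, -, hz⟩ := (isCompact_closedBall (0 : Plane) R).exists_isMinOn h
      (contDiff_gibbsDensity hU).continuous.continuousOn
    exact ⟨_, gibbsDensity_pos hint z, fun w hw => hz hw⟩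
  have h1 : ENNReal.ofReal c • volume.restrict (ball (0 : Plane) R) ≤ gibbsMeasure U := by
    rw [← withDensity_const]
    refine le_trans (withDensity_mono ?_)
      ((restrict_withDensity measurableSet_ball _).symm.le.trans Measure.restrict_le_self)
    filter_upwards [ae_restrict_mem measurableSet_ball] with z hz
    exact ENNReal.ofReal_le_ofReal (hcU z (ball_subset_closedBall hz))
  have hc0 : ENNReal.ofReal c ≠ 0 := (ENNReal.ofReal_pos.2 hc).ne'
  refine hf.of_measure_le_smul (c := (ENNReal.ofReal c)⁻¹) (ENNReal.inv_ne_top.2 hc0) ?_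
  refine Measure.le_iff'.2 fun s => ?_
  have h2 := Measure.le_iff'.1 h1 s
  rw [Measure.smul_apply, smul_eq_mul] at h2 ⊢
  rwa [← ENNReal.div_eq_inv_mul, ENNReal.le_div_iff_mul_le (Or.inl hc0)
    (Or.inl ENNReal.ofReal_ne_top), mul_comm]

end Gibbs

/-! ### Mean-zero functions which are nearly constant on a set of large measure -/

/-- The quadratic x ↦ ∫(f - x)² is nonnegative, so its discriminant is not positive. -/
theorem sq_integral_le {α : Type*} [MeasurableSpace α] {μ : Measure α} [IsFiniteMeasure μ]
    {f : α → ℝ} (hf : MemLp f 2 μ) : (∫ z, f z ∂μ) ^ 2 ≤ μ.real Set.univ * ∫ z, f z ^ 2 ∂μ := by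
  have h := discrim_le_zero (a := μ.real Set.univ) (b := -2 * ∫ z, f z ∂μ)
    (c := ∫ z, f z ^ 2 ∂μ) fun x => by
      have := integral_sub_const_sq hf x
      have h0 : 0 ≤ ∫ z, (f z - x) ^ 2 ∂μ := integral_nonneg fun z => sq_nonneg _
      linarith
  rw [discrim] at h
  linarith

theorem setIntegral_sq_le_of_mean_zero {α : Type*} [MeasurableSpace α] {P : Measure α}
    [IsProbabilityMeasure P] {f : α → ℝ} (hf : MemLp f 2 P) (h0 : ∫ z, f z ∂P = 0) {B : Set α}
    (hB : MeasurableSet B) (hη : P.real Bᶜ ≤ 1 / 2) {t ε : ℝ}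
    (ht : ∫ z in B, (f z - t) ^ 2 ∂P ≤ ε) :
    ∫ z in B, f z ^ 2 ∂P ≤ 18 * ε + 16 * P.real Bᶜ * ∫ z, f z ^ 2 ∂P := by
  have hfB : MemLp f 2 (P.restrict B) := hf.restrict B
  have hfC : MemLp f 2 (P.restrict Bᶜ) := hf.restrict _
  have hfi : Integrable f P := hf.integrable (by norm_num)
  have hd : MemLp (fun z => f z - t) 2 (P.restrict B) := hfB.sub (memLp_const t)
  have a1 := sq_integral_le hd
  have a2 := sq_integral_le hfC
  have a3 := integral_sub_const_sq hfB t
  have a4 : ∫ z in B, (f z - t) ∂P = (∫ z in B, f z ∂P) - t * P.real B := by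
    rw [integral_sub hfi.integrableOn (integrable_const t)]
    simp [mul_comm]
  have a5 : (∫ z in B, f z ∂P) + ∫ z in Bᶜ, f z ∂P = 0 := by
    rw [integral_add_compl hB hfi, h0]
  have a6 : ∫ z in Bᶜ, f z ^ 2 ∂P ≤ ∫ z, f z ^ 2 ∂P :=
    setIntegral_le_integral hf.integrable_sq (ae_of_all _ fun z => sq_nonneg _)
  have a7 := probReal_compl_eq_one_sub (μ := P) hB
  have a8 : 0 ≤ P.real Bᶜ := measureReal_nonneg
  simp only [measureReal_restrict_apply_univ] at a1 a2 a3
  have e1 : 0 ≤ ∫ z in B, (f z - t) ^ 2 ∂P := integral_nonneg fun z => sq_nonneg _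
  set x := ∫ z in B, f z ∂P
  set y := ∫ z in Bᶜ, f z ∂P
  set b := P.real B
  set η := P.real Bᶜ
  set N := ∫ z, f z ^ 2 ∂P
  set D := ∫ z in B, (f z - t) ^ 2 ∂P
  set S := ∫ z in B, f z ^ 2 ∂P
  have hb1 : b ≤ 1 := by linarith
  have hb2 : 1 / 2 ≤ b := by linarith
  have c1 : (x - t * b) ^ 2 ≤ ε := by
    rw [← a4]
    exact a1.trans ((mul_le_of_le_one_left e1 hb1).trans ht)
  have c2 : x ^ 2 ≤ η * N := by
    have : x ^ 2 = y ^ 2 := by rw [eq_neg_of_add_eq_zero_left a5]; ring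
    rw [this]
    exact a2.trans (mul_le_mul_of_nonneg_left a6 a8)
  have c3 : (t * b) ^ 2 ≤ 2 * ε + 2 * (η * N) := by
    nlinarith [sq_nonneg (x - t * b + x), sq_nonneg (2 * x - t * b)]
  have c4 : t ^ 2 ≤ 8 * ε + 8 * (η * N) := by
    have : t ^ 2 * (1 / 4) ≤ (t * b) ^ 2 := by
      rw [mul_pow]
      exact mul_le_mul_of_nonneg_left (by nlinarith) (sq_nonneg _)
    linarith
  have c5 : t ^ 2 * b ≤ 8 * ε + 8 * (η * N) :=
    (mul_le_of_le_one_right (sq_nonneg _) hb1).trans c4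
  have c6 : 2 * t * x = 2 * t * (x - t * b) + 2 * (t ^ 2 * b) := by ring
  have c7 : S ≤ 2 * D + 2 * (t ^ 2 * b) := by
    have h1 : ∫ z in B, (f z - (2 * t)) ^ 2 ∂P = S - 2 * (2 * t) * x + (2 * t) ^ 2 * b := by
      rw [integral_sub_const_sq hfB (2 * t), measureReal_restrict_apply_univ]
    have h2 : 0 ≤ ∫ z in B, (f z - (2 * t)) ^ 2 ∂P := integral_nonneg fun z => sq_nonneg _
    linarith
  linarith

/-! ### The lower bound for the rate -/

/-- `f` is a real element of `H¹(μ)` with weak gradient `G`. -/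
structure IsRealH1 (μ : Measure Plane) (f : Plane → ℝ) (G : Fin 2 → Plane → ℝ) : Prop where
  weak : RealWeakGradient f G
  memLp : MemLp f 2 μ
  memLp_grad : ∀ i, MemLp (G i) 2 μ

theorem IsH1Eigenfunction.clm_comp {μ : Measure Plane} {v : Plane → Plane} {φ : Plane → ℂ}
    {g : Plane → EuclideanSpace ℂ (Fin 2)} (h : IsH1Eigenfunction μ v φ g) (L : ℂ →L[ℝ] ℝ) :
    IsRealH1 μ (fun z => L (φ z)) (fun i z => L (g z i)) :=
  ⟨h.hasWeakGradient.clm_comp L, L.comp_memLp' h.memLp, fun i =>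
    (L.comp ((EuclideanSpace.proj (𝕜 := ℂ) i).restrictScalars ℝ)).comp_memLp' h.memLp_grad⟩

section Gibbs

variable {U χ : Plane → ℝ} {n : ℕ}

/-- The real or imaginary part of an eigenfunction is small in `L²(B(0,n))` compared to its
gradient, up to the mass outside the ball. -/
theorem setIntegral_sq_le_of_coupled (hU : ContDiff ℝ 2 U)
    (hint : Integrable (fun z => Real.exp (-U z)) volume) (hn : 1 ≤ n) (hχ : IsCutoff n χ) {L : ℝ}
    (hL : ∀ w, liftMap (gibbsDensity U) χ n w ∈ ball (0 : Plane) (3 * n / 2) →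
      ∀ v : ℝ × ℝ, ‖v‖ ≤ 1 → ∀ i, |fderiv ℝ (liftMap (gibbsDensity U) χ n) w v i| ≤ L)
    {m : ℕ} (hm : 1 ≤ m) (hLm : 2 * L ^ 2 / m ^ 2 ≤ 1 / n)
    (hcov : ball (0 : Plane) n ⊆ cellRegion (gibbsDensity U) χ n m)
    {f f' : Plane → ℝ} {G G' : Fin 2 → Plane → ℝ} (h : IsRealH1 (gibbsMeasure U) f G)
    (h' : IsRealH1 (gibbsMeasure U) f' G') (h0 : ∫ z, f z ∂gibbsMeasure U = 0)
    (hη : (gibbsMeasure U).real (ball 0 n)ᶜ ≤ 1 / 2) {a : ℝ}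
    (e : ∀ᵐ z ∂gibbsMeasure U, ∑ i, G i z * planeFlow (gibbsDensity U) χ n m z i = a * f' z)
    (e' : ∀ᵐ z ∂gibbsMeasure U, ∑ i, G' i z * planeFlow (gibbsDensity U) χ n m z i = -a * f z) :
    ∫ z in ball 0 n, f z ^ 2 ∂gibbsMeasure U ≤
      18 / n * (∑ i, ∫ z, G i z ^ 2 ∂gibbsMeasure U)
        + 16 * (gibbsMeasure U).real (ball 0 n)ᶜ * ∫ z, f z ^ 2 ∂gibbsMeasure U := by
  have hn' : (0 : ℝ) < n := by positivity
  have hP := isProbabilityMeasure_gibbs hint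
  have hρ : ContDiff ℝ 1 (gibbsDensity U) := (contDiff_gibbsDensity hU).of_le (by norm_num)
  have hpos := gibbsDensity_pos hint
  have loc := fun {p : Plane → ℝ} (hp : MemLp p 2 (gibbsMeasure U)) =>
    memLp_restrict_ball_of_gibbs hU hint hp
  have ae := fun {p : Plane → Prop} (hp : ∀ᵐ z ∂gibbsMeasure U, p z) =>
    ae_restrict_of_ae (s := ball (0 : Plane) (3 * n / 2)) (absolutelyContinuous_gibbs hU hint hp)
  obtain ⟨t, ht⟩ : ∃ t, ∫ z in ball 0 n, (f z - t) ^ 2 * gibbsDensity U z ≤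
      2 * L ^ 2 / m ^ 2 *
        ∫ z in ball 0 (3 * n / 2), (∑ i, G i z ^ 2) * gibbsDensity U z := by
    -- The dichotomy of the proof: for a = 0 the constant t is the common edge average, and for a ≠
    -- 0 every cell mean vanishes and t = 0.
    by_cases ha : a = 0
    · refine exists_setIntegral_sub_sq_le hn hρ hpos hχ hL hm hcov h.weak (loc h.memLp)
        (fun i => loc (h.memLp_grad i)) ?_
      simpa [ha] using ae e
    · refine ⟨0, ?_⟩
      have := setIntegral_sq_le_of_eigen hn hρ hpos hχ hL hm hcov h.weak (loc h.memLp)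
        (fun i => loc (h.memLp_grad i)) h'.weak (loc h'.memLp) (fun i => loc (h'.memLp_grad i))
        (neg_ne_zero.2 ha) (ae e')
      simpa using this
  rw [← setIntegral_gibbs hU hint measurableSet_ball (fun z => (f z - t) ^ 2),
    ← setIntegral_gibbs hU hint measurableSet_ball (fun z => ∑ i, G i z ^ 2)] at ht
  have hGi : Integrable (fun z => ∑ i, G i z ^ 2) (gibbsMeasure U) :=
    integrable_finsetSum _ fun i _ => (h.memLp_grad i).integrable_sq
  have hA : ∫ z in ball 0 (3 * n / 2), (∑ i, G i z ^ 2) ∂gibbsMeasure U ≤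
      ∑ i, ∫ z, G i z ^ 2 ∂gibbsMeasure U := by
    rw [← integral_finsetSum _ fun i _ => (h.memLp_grad i).integrable_sq]
    exact setIntegral_le_integral hGi (ae_of_all _ fun z => Finset.sum_nonneg fun i _ => sq_nonneg _)
  have hA0 : 0 ≤ ∫ z in ball 0 (3 * n / 2), (∑ i, G i z ^ 2) ∂gibbsMeasure U :=
    integral_nonneg fun z => Finset.sum_nonneg fun i _ => sq_nonneg _
  have ht' : ∫ z in ball 0 n, (f z - t) ^ 2 ∂gibbsMeasure U ≤
      1 / n * ∑ i, ∫ z, G i z ^ 2 ∂gibbsMeasure U :=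
    ht.trans (mul_le_mul hLm hA hA0 (by positivity))
  refine (setIntegral_sq_le_of_mean_zero h.memLp h0 measurableSet_ball hη ht').trans_eq ?_
  ring

theorem norm_sq_eq_re_im (c : ℂ) : ‖c‖ ^ 2 = c.re ^ 2 + c.im ^ 2 := by
  rw [Complex.sq_norm, Complex.normSq_apply]; ring

/-- The Rayleigh quotient bound for eigenfunctions. -/
theorem IsH1Eigenfunction.mul_integral_le (hU : ContDiff ℝ 2 U)
    (hint : Integrable (fun z => Real.exp (-U z)) volume) (hn : 1 ≤ n) (hχ : IsCutoff n χ) {L : ℝ}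
    (hL : ∀ w, liftMap (gibbsDensity U) χ n w ∈ ball (0 : Plane) (3 * n / 2) →
      ∀ v : ℝ × ℝ, ‖v‖ ≤ 1 → ∀ i, |fderiv ℝ (liftMap (gibbsDensity U) χ n) w v i| ≤ L)
    {m : ℕ} (hm : 1 ≤ m) (hLm : 2 * L ^ 2 / m ^ 2 ≤ 1 / n)
    (hcov : ball (0 : Plane) n ⊆ cellRegion (gibbsDensity U) χ n m)
    (hη : (gibbsMeasure U).real (ball 0 n)ᶜ ≤ 1 / 2)
    {W : Plane → ℝ} (hW : ContDiff ℝ 2 W) (hW1 : ∀ z, 1 ≤ W z) {lam b r : ℝ} (hb : 0 ≤ b)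
    (hLy : ∀ z, generator U W z ≤
      -lam * W z + b * (ball (0 : Plane) r).indicator (fun _ => (1 : ℝ)) z)
    (hr : r ≤ n) (hbn : 18 * b / n ≤ 1) (hbη : 16 * b * (gibbsMeasure U).real (ball 0 n)ᶜ ≤ 1)
    {φ : Plane → ℂ} {g : Plane → EuclideanSpace ℂ (Fin 2)}
    (h : IsH1Eigenfunction (gibbsMeasure U) (planeFlow (gibbsDensity U) χ n m) φ g) :
    (lam - 1) * ∫ z, ‖φ z‖ ^ 2 ∂gibbsMeasure U ≤ 3 * ∫ z, ‖g z‖ ^ 2 ∂gibbsMeasure U := by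
  have hn' : (0 : ℝ) < n := by positivity
  have hP := isProbabilityMeasure_gibbs hint
  have hφi : Integrable φ (gibbsMeasure U) := h.memLp.integrable (by norm_num)
  have mean : ∀ K : ℂ →L[ℝ] ℝ, ∫ z, K (φ z) ∂gibbsMeasure U = 0 := fun K => by
    rw [K.integral_comp_comm hφi, h.mean_zero, map_zero]
  have part : ∀ {f : Plane → ℝ} {G : Fin 2 → Plane → ℝ}, IsRealH1 (gibbsMeasure U) f G →
      ∫ z in ball 0 n, f z ^ 2 ∂gibbsMeasure U ≤
        18 / n * (∑ i, ∫ z, G i z ^ 2 ∂gibbsMeasure U)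
          + 16 * (gibbsMeasure U).real (ball 0 n)ᶜ * ∫ z, f z ^ 2 ∂gibbsMeasure U →
      (lam - 1) * ∫ z, f z ^ 2 ∂gibbsMeasure U ≤
        3 * ∑ i, ∫ z, G i z ^ 2 ∂gibbsMeasure U := by
    intro f G hf hest
    have hl := lyapunov_weak hU hint hW hW1 hb hLy hf.weak
      (memLp_restrict_ball_of_gibbs hU hint hf.memLp)
      (fun i => memLp_restrict_ball_of_gibbs hU hint (hf.memLp_grad i))
      (integrable_gibbs hU hint hf.memLp.integrable_sq)
      (fun i => integrable_gibbs hU hint (hf.memLp_grad i).integrable_sq)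
    rw [← integral_gibbs hU hint (fun z => f z ^ 2),
      ← setIntegral_gibbs hU hint measurableSet_ball (fun z => f z ^ 2)] at hl
    have hG : ∀ i, ∫ z, G i z ^ 2 * gibbsDensity U z = ∫ z, G i z ^ 2 ∂gibbsMeasure U := fun i =>
      (integral_gibbs hU hint (fun z => G i z ^ 2)).symm
    simp only [hG] at hl
    have hball : ∫ z in ball 0 r, f z ^ 2 ∂gibbsMeasure U ≤
        ∫ z in ball 0 n, f z ^ 2 ∂gibbsMeasure U :=
      setIntegral_mono_set hf.memLp.integrable_sq.integrableOn (ae_of_all _ fun z => sq_nonneg _)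
        (ball_subset_ball hr).eventuallyLE
    have hA0 : 0 ≤ ∑ i, ∫ z, G i z ^ 2 ∂gibbsMeasure U :=
      Finset.sum_nonneg fun i _ => integral_nonneg fun z => sq_nonneg _
    have hN0 : 0 ≤ ∫ z, f z ^ 2 ∂gibbsMeasure U := integral_nonneg fun z => sq_nonneg _
    have k1 := mul_le_mul_of_nonneg_left (hball.trans hest) hb
    have k2 := mul_le_mul_of_nonneg_right hbn hA0
    have k3 := mul_le_mul_of_nonneg_right hbη hN0
    set A := ∑ i, ∫ z, G i z ^ 2 ∂gibbsMeasure U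
    set N := ∫ z, f z ^ 2 ∂gibbsMeasure U
    set η := (gibbsMeasure U).real (ball 0 n)ᶜ
    -- By `hbn` and `hbη` this is at most A + N. With the 2A from the Lyapunov bound it gives λN ≤
    -- 3A + N.
    have k4 : b * (18 / n * A + 16 * η * N) = 18 * b / n * A + 16 * b * η * N := by ring
    linarith
  obtain ⟨ν, hν⟩ := h.eigen
  have hre := h.clm_comp Complex.reCLM
  have him := h.clm_comp Complex.imCLM
  simp only [Complex.reCLM_apply, Complex.imCLM_apply] at hre him
  have ere : ∀ᵐ z ∂gibbsMeasure U,
      ∑ i, (g z i).re * planeFlow (gibbsDensity U) χ n m z i = -ν * (φ z).im := by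
    filter_upwards [hν] with z hz
    have := congrArg Complex.re hz
    simp only [Complex.re_sum, Complex.mul_re, Complex.mul_im, Complex.ofReal_re, Complex.ofReal_im,
      Complex.I_re, Complex.I_im] at this
    simp only [Fin.sum_univ_two] at this ⊢
    linarith
  have eim : ∀ᵐ z ∂gibbsMeasure U,
      ∑ i, (g z i).im * planeFlow (gibbsDensity U) χ n m z i = ν * (φ z).re := by
    filter_upwards [hν] with z hz
    have := congrArg Complex.im hz
    simp only [Complex.im_sum, Complex.mul_re, Complex.mul_im, Complex.ofReal_re, Complex.ofReal_im,
      Complex.I_re, Complex.I_im] at this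
    simp only [Fin.sum_univ_two] at this ⊢
    linarith
  -- The same estimate is used twice with the two parts exchanged; the coefficient is -ν for the
  -- real part and ν for the imaginary part.
  have p1 := part hre (setIntegral_sq_le_of_coupled hU hint hn hχ hL hm hLm hcov hre him
    (mean Complex.reCLM) hη ere (by simpa using eim))
  have p2 := part him (setIntegral_sq_le_of_coupled hU hint hn hχ hL hm hLm hcov him hre
    (mean Complex.imCLM) hη eim ere)
  have hN : ∫ z, ‖φ z‖ ^ 2 ∂gibbsMeasure U =
      (∫ z, (φ z).re ^ 2 ∂gibbsMeasure U) + ∫ z, (φ z).im ^ 2 ∂gibbsMeasure U := by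
    simp only [norm_sq_eq_re_im]
    exact integral_add hre.memLp.integrable_sq him.memLp.integrable_sq
  have hA : ∫ z, ‖g z‖ ^ 2 ∂gibbsMeasure U =
      (∑ i, ∫ z, (g z i).re ^ 2 ∂gibbsMeasure U) + ∑ i, ∫ z, (g z i).im ^ 2 ∂gibbsMeasure U := by
    rw [← integral_finsetSum _ fun i _ => (hre.memLp_grad i).integrable_sq,
      ← integral_finsetSum _ fun i _ => (him.memLp_grad i).integrable_sq,
      ← integral_add (integrable_finsetSum _ fun i _ => (hre.memLp_grad i).integrable_sq)
        (integrable_finsetSum _ fun i _ => (him.memLp_grad i).integrable_sq)]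
    refine integral_congr_ae (ae_of_all _ fun z => ?_)
    simp only [EuclideanSpace.norm_sq_eq, norm_sq_eq_re_im, Finset.sum_add_distrib]
  rw [hN, hA]
  linarith

theorem IsH1Eigenfunction.integral_pos {μ : Measure Plane} {v : Plane → Plane} {φ : Plane → ℂ}
    {g : Plane → EuclideanSpace ℂ (Fin 2)} (h : IsH1Eigenfunction μ v φ g) :
    0 < ∫ z, ‖φ z‖ ^ 2 ∂μ := by
  have hi : Integrable (fun z => ‖φ z‖ ^ 2) μ := h.memLp.integrable_norm_pow (by norm_num)
  refine lt_of_le_of_ne (integral_nonneg fun z => sq_nonneg _) fun h0 => h.ne_zero ?_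
  have := (integral_eq_zero_iff_of_nonneg (fun z => sq_nonneg _) hi).1 h0.symm
  filter_upwards [this] with z hz
  simpa using hz

theorem tendsto_gibbs_compl_ball (hint : Integrable (fun z => Real.exp (-U z)) volume) :
    Tendsto (fun n : ℕ => (gibbsMeasure U).real (ball 0 n)ᶜ) atTop (𝓝 0) := by
  have hP := isProbabilityMeasure_gibbs hint
  have h := tendsto_measure_iInter_atTop (μ := gibbsMeasure U)
    (s := fun n : ℕ => (ball (0 : Plane) n)ᶜ) (fun n => measurableSet_ball.compl.nullMeasurableSet)
    (fun i j hij => Set.compl_subset_compl.2 (ball_subset_ball (by exact_mod_cast hij)))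
    ⟨0, measure_ne_top _ _⟩
  have he : ⋂ n : ℕ, (ball (0 : Plane) n)ᶜ = ∅ := by
    rw [← Set.compl_iUnion, iUnion_ball_nat, Set.compl_univ]
  rw [he, measure_empty] at h
  have h' := (ENNReal.tendsto_toReal ENNReal.zero_ne_top).comp h
  rw [ENNReal.toReal_zero] at h'
  exact h'

theorem tendsto_relaxationRate (hU : ContDiff ℝ 2 U)
    (hint : Integrable (fun z => Real.exp (-U z)) volume) (hLyap : LyapunovCondition U)
    {χ : ℕ → Plane → ℝ} (hχ : ∀ n, 1 ≤ n → IsCutoff n (χ n)) {L : ℕ → ℝ}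
    (hL : ∀ n : ℕ, 1 ≤ n → ∀ w, liftMap (gibbsDensity U) (χ n) n w ∈ ball (0 : Plane) (3 * n / 2) →
      ∀ v : ℝ × ℝ, ‖v‖ ≤ 1 → ∀ i, |fderiv ℝ (liftMap (gibbsDensity U) (χ n) n) w v i| ≤ L n)
    {φ : ℕ → ℕ} (hφ : ∀ n, 1 ≤ φ n)
    (hLφ : ∀ n : ℕ, 1 ≤ n → 2 * L n ^ 2 / (φ n : ℝ) ^ 2 ≤ 1 / n)
    (hcov : ∀ n : ℕ, 1 ≤ n → ball (0 : Plane) n ⊆ cellRegion (gibbsDensity U) (χ n) n (φ n)) :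
    Tendsto (fun n => relaxationRate (gibbsMeasure U)
      (planeFlow (gibbsDensity U) (χ n) n (φ n))) atTop (𝓝 ⊤) := by
  obtain ⟨W, hW, hW1, R₀, hR₀, hr⟩ := hLyap
  -- Any admissible sequence of radii would do.
  obtain ⟨lam, b, hlam, -, hb, hLy⟩ := hr (fun k => R₀ + k)
    (fun i j hij => by
      have : (i : ℝ) < j := by exact_mod_cast hij
      simp only
      linarith)
    (tendsto_atTop_add_const_left _ _ tendsto_natCast_atTop_atTop)
    (fun k => le_add_of_nonneg_right (Nat.cast_nonneg k))
  refine ENNReal.tendsto_nhds_top fun N => ?_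
  -- The index k is fixed before n, so b_k and the radius are constants when n → ∞. The threshold is
  -- the one for which (λ_k - 1)/3 ≥ N + 1.
  obtain ⟨k, hk⟩ := (hlam.eventually_ge_atTop (3 * (N + 1 : ℝ) + 1)).exists
  have hη := tendsto_gibbs_compl_ball hint
  have hη' : Tendsto (fun n : ℕ => 16 * b k * (gibbsMeasure U).real (ball 0 n)ᶜ) atTop (𝓝 0) := by
    simpa using hη.const_mul (16 * b k)
  have hbn : Tendsto (fun n : ℕ => 18 * b k / (n : ℝ)) atTop (𝓝 0) :=
    tendsto_const_nhds.div_atTop tendsto_natCast_atTop_atTop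
  filter_upwards [eventually_ge_atTop 1,
    hη.eventually_le_const (show (0 : ℝ) < 1 / 2 by norm_num), hη'.eventually_le_const one_pos,
    hbn.eventually_le_const one_pos,
    tendsto_natCast_atTop_atTop.eventually_ge_atTop (R₀ + k)] with n h1 h2 h3 h4 h5
  refine lt_of_lt_of_le (b := ENNReal.ofReal (N + 1)) ?_ ?_
  · rw [← ENNReal.ofReal_natCast]
    exact (ENNReal.ofReal_lt_ofReal_iff (by positivity)).2 (by linarith)
  refine le_iInf fun ψ => le_iInf fun g => le_iInf fun h => ENNReal.ofReal_le_ofReal ?_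
  have key := h.mul_integral_le hU hint h1 (hχ n h1) (hL n h1) (hφ n) (hLφ n h1) (hcov n h1) h2 hW
    hW1 (hb k) (hLy k) h5 h4 h3
  have hpos := h.integral_pos
  rw [le_div_iff₀ hpos]
  have := mul_le_mul_of_nonneg_right hk hpos.le
  linarith

end Gibbs

theorem finiteEnergy_of_hasCompactSupport {μ : Measure Plane} [IsFiniteMeasure μ]
    {v : Plane → Plane} (hv : Continuous v) (hs : HasCompactSupport v) : FiniteEnergy μ v :=
  Continuous.integrable_of_hasCompactSupport (f := fun z => ‖v z‖ ^ 2) (hv.norm.pow 2)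
    (hs.comp_left (g := fun w : Plane => ‖w‖ ^ 2) (by simp))

end RelaxFlow

end

/-! ### The main theorem -/

theorem mainTheorem2 (U : RelaxFlow.Plane → ℝ) (hU : ContDiff ℝ 2 U)
    (hint : Integrable (fun z => Real.exp (-U z)) volume)
    (hLyap : RelaxFlow.LyapunovCondition U)
    (χ : ℕ → RelaxFlow.Plane → ℝ) (hχ : ∀ n, 1 ≤ n → RelaxFlow.IsCutoff n (χ n)) :
    (∃ m₀ : ℕ → ℕ, RelaxFlow.IsCellThreshold (RelaxFlow.gibbsDensity U) χ m₀) ∧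
    ∀ m₀ : ℕ → ℕ, RelaxFlow.IsCellThreshold (RelaxFlow.gibbsDensity U) χ m₀ →
      ∃ φ : ℕ → ℕ, Tendsto φ atTop atTop ∧ (∀ n, m₀ n ≤ φ n) ∧
        (∀ n, 1 ≤ n →
          (∀ k : ℕ∞, ContDiff ℝ ((k : WithTop ℕ∞) + 1) U →
            ContDiff ℝ (k : WithTop ℕ∞)
              (RelaxFlow.planeFlow (RelaxFlow.gibbsDensity U) (χ n) n (φ n))) ∧
          (∀ z, RelaxFlow.divergence (fun w => RelaxFlow.gibbsDensity U w •
            RelaxFlow.planeFlow (RelaxFlow.gibbsDensity U) (χ n) n (φ n) w) z = 0) ∧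
          HasCompactSupport (RelaxFlow.planeFlow (RelaxFlow.gibbsDensity U) (χ n) n (φ n)) ∧
          tsupport (RelaxFlow.planeFlow (RelaxFlow.gibbsDensity U) (χ n) n (φ n)) ⊆
            ball 0 (2 * n) ∧
          (∀ z ∈ ball (0 : RelaxFlow.Plane) (3 * n / 2),
            RelaxFlow.planeFlow (RelaxFlow.gibbsDensity U) (χ n) n (φ n) z =
              RelaxFlow.pushforward (RelaxFlow.transport (RelaxFlow.gibbsDensity U) (χ n) n)
                (RelaxFlow.cellFlow (φ n)) z)) ∧
        RelaxFlow.AsymptoticallyRelaxationEnhancing (RelaxFlow.gibbsMeasure U)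
          (fun n => RelaxFlow.planeFlow (RelaxFlow.gibbsDensity U) (χ n) n (φ n)) := by
  have hρ2 := RelaxFlow.contDiff_gibbsDensity hU
  have hρ1 : ContDiff ℝ 1 (RelaxFlow.gibbsDensity U) := hρ2.of_le (by norm_num)
  have hpos := RelaxFlow.gibbsDensity_pos hint
  have hP := RelaxFlow.isProbabilityMeasure_gibbs hint
  refine ⟨?_, fun m₀ hm₀ => ?_⟩
  · have h : ∀ n : ℕ, ∃ m₀ : ℕ, 1 ≤ n → ∀ m, m₀ ≤ m →
        ball (0 : RelaxFlow.Plane) n ⊆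
          RelaxFlow.cellRegion (RelaxFlow.gibbsDensity U) (χ n) n m := fun n => by
      by_cases hn : 1 ≤ n
      · obtain ⟨m₀, h⟩ := RelaxFlow.exists_threshold hn hρ1 hpos (hχ n hn)
        exact ⟨m₀, fun _ => h⟩
      · exact ⟨0, fun h => absurd h hn⟩
    choose m₀ h using h
    exact ⟨m₀, h⟩
  have h : ∀ n : ℕ, ∃ L : ℝ, 1 ≤ n → ∀ w,
      RelaxFlow.liftMap (RelaxFlow.gibbsDensity U) (χ n) n w ∈
        ball (0 : RelaxFlow.Plane) (3 * n / 2) → ∀ v : ℝ × ℝ, ‖v‖ ≤ 1 → ∀ i,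
        |fderiv ℝ (RelaxFlow.liftMap (RelaxFlow.gibbsDensity U) (χ n) n) w v i| ≤ L := fun n => by
    by_cases hn : 1 ≤ n
    · obtain ⟨L, -, h⟩ := RelaxFlow.exists_bound_fderiv_liftMap hn hρ1 hpos (hχ n hn)
      exact ⟨L, fun _ => h⟩
    · exact ⟨0, fun h => absurd h hn⟩
  choose L hL using h
  -- The summands of φ(n) serve separate needs: m₀(n) for the covering by cells, n for divergence, 1
  -- for positivity also at n = 0, and the ceiling for 2L²n ≤ φ(n) ≤ φ(n)², which makes the Poincaré
  -- factor at most 1/n.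
  obtain ⟨φ, hφ1, hφm, hφn, hφL⟩ : ∃ φ : ℕ → ℕ, (∀ n, 1 ≤ φ n) ∧ (∀ n, m₀ n ≤ φ n) ∧
      (∀ n, n ≤ φ n) ∧ ∀ n, ⌈2 * L n ^ 2 * n⌉₊ ≤ φ n :=
    ⟨fun n => m₀ n + n + 1 + ⌈2 * L n ^ 2 * n⌉₊, fun n => by dsimp only; omega, fun n => by dsimp only; omega,
      fun n => by dsimp only; omega, fun n => by dsimp only; omega⟩
  have hLφ : ∀ n : ℕ, 1 ≤ n → 2 * L n ^ 2 / (φ n : ℝ) ^ 2 ≤ 1 / n := fun n hn => by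
    have hn' : (0 : ℝ) < n := by positivity
    have h1 : (1 : ℝ) ≤ φ n := by exact_mod_cast hφ1 n
    have h2 : 2 * L n ^ 2 * n ≤ φ n := (Nat.le_ceil _).trans (by exact_mod_cast hφL n)
    rw [div_le_div_iff₀ (by positivity) hn', one_mul]
    nlinarith
  have hcs : ∀ n, 1 ≤ n → HasCompactSupport
      (RelaxFlow.planeFlow (RelaxFlow.gibbsDensity U) (χ n) n (φ n)) := fun n hn =>
    (isCompact_closedBall _ _).of_isClosed_subset (isClosed_tsupport _)
      (RelaxFlow.tsupport_planeFlow_subset (hχ n hn) (φ n))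
  have hk : ∀ n, 1 ≤ n → ∀ k : ℕ∞, ContDiff ℝ ((k : WithTop ℕ∞) + 1) U →
      ContDiff ℝ (k : WithTop ℕ∞)
        (RelaxFlow.planeFlow (RelaxFlow.gibbsDensity U) (χ n) n (φ n)) := fun n hn k hk =>
    RelaxFlow.contDiff_planeFlow hn (RelaxFlow.contDiff_gibbsDensity hk) hpos (hχ n hn) (φ n)
  refine ⟨φ, tendsto_atTop_mono hφn tendsto_id, hφm, fun n hn => ⟨hk n hn,
    RelaxFlow.divergence_planeFlow hn hρ2 hpos (hχ n hn) (φ n), hcs n hn,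
    (RelaxFlow.tsupport_planeFlow_subset (hχ n hn) (φ n)).trans (closedBall_subset_ball ?_),
    fun z hz => ?_⟩, fun n hn => ?_, ?_⟩
  · have hn' : (0 : ℝ) < n := by positivity
    linarith
  · rw [RelaxFlow.planeFlow_eq_pushforward hn hρ1 hpos (hχ n hn) (φ n) hz, RelaxFlow.pushforward,
      RelaxFlow.invFun_transport hn hρ1.continuous hpos (hχ n hn)]
  · exact RelaxFlow.finiteEnergy_of_hasCompactSupport
      (hk n hn 0 (by simpa using hU.of_le one_le_two)).continuous (hcs n hn)
  · exact RelaxFlow.tendsto_relaxationRate hU hint hLyap hχ hL hφ1 hLφ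
      fun n hn => hm₀ n hn _ (hφm n)
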